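/- **Theorem (local efficiency of $E_{st}$).** Let $d\in\{2,3\}$ and $\sigma>0$. There is a constant $C$, depending only on $d$ and $\sigma$, such that the following holds. *Setting.* Let $\Omega\subset\mathbb R^d$ be a bounded Lipschitz domain, $\mathcal D\subset\Omega$ a finite set, $\mathbf y_t\in\mathbb R^d$ ($t\in\mathcal D$), $\lambda>0$, $\mathbf a,\mathbf b\in\mathbb R^d$ with $\mathbf a<\mathbf b$ componentwise, $\mathbb U_{ad}=\{\mathbf v\in L^2(\Omega)^d:\mathbf a\le\mathbf v\le\mathbf b\text{ a.e. in }\Omega\}$ and $\alpha\in(d-2,2)$. If $\mathcal D=\{t\}$, let $\rho(x)=|x-t|^\alpha$. Otherwise let $\rho(x)=|x-t|^\alpha$ if $|x-t|<d_{\mathcal D}/2$ for some $t\in\mathcal D$, and $\rho(x)=1$ elsewhere, where $d_{\mathcal D}$ is the minimum of $\operatorname{dist}(\mathcal D,\partial\Omega)$ and of the distances between distinct points of $\mathcal D$. Let $H^1_0(\omega,\Omega)$ be the closure of $C_0^\infty(\Omega)$ in the weighted space $H^1(\omega,\Omega)$, and put $a(\mathbf w,\mathbf v)=\int_\Omega\nabla\mathbf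 w:\nabla\mathbf v$ and $b(\mathbf v,q)=-\int_\Omega q\,\operatorname{div}\mathbf v$. *Continuous solution.* Let $(\bar{\mathbf y},\bar p,\bar{\mathbf z},\bar r,\bar{\mathbf u})\in H^1_0(\Omega)^d\times L^2(\Omega)/\mathbb R\times H^1_0(\rho,\Omega)^d\times L^2(\rho,\Omega)/\mathbb R\times\mathbb U_{ad}$ solve the optimality system of the pointwise tracking problem, that is, - $a(\bar{\mathbf y},\mathbf v)+b(\mathbf v,\bar p)=(\bar{\mathbf u},\mathbf v)_{L^2(\Omega)}$ for all $\mathbf v\in H^1_0(\Omega)^d$, and $b(\bar{\mathbf y},q)=0$ for all $q\in L^2(\Omega)/\mathbb R$; - $a(\mathbf w,\bar{\mathbf z})-b(\mathbf w,\bar r)=\sum_{t\in\mathcal D}\langle(\bar{\mathbf y}(t)-\mathbf y_t)\delta_t,\mathbf w\rangle$ for all $\mathbf w\in H^1_0(\rho^{-1},\Omega)^d$, and $b(\bar{\mathbf z},s)=0$ for all $s\in L^2(\rho^{-1},\Omega)/\mathbb R$; - $(\bar{\mathbf z}+\lambda\bar{\mathbf u},\mathbf u-\bar{\mathbf u})_{L^2(\Omega)}\ge0$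 for all $\mathbf u\in\mathbb U_{ad}$. *Mesh.* Let $\mathscr T$ be a conforming partition of $\bar\Omega$ into closed simplices, with $h_T=\operatorname{diam}T$, which is shape regular with constant $\sigma$: every $T\in\mathscr T$ contains a ball of diameter $\delta>0$ with $h_T\le\sigma\delta$. Let $\mathscr S_T$ be the set of the sides of $T$ that are shared with another element, and let $\mathcal N_T$ be the union of $T$ and of the elements that share a side with $T$. *Discrete solution.* Let $Q(\mathscr T)$ be the space of continuous piecewise affine functions on $\bar\Omega$ modulo constants, $\mathbf U(\mathscr T)$ the space of continuous piecewise quadratic vector fields on $\bar\Omega$, and $\mathbf V(\mathscr T)=\mathbf U(\mathscr T)\cap H^1_0(\Omega)^d$. Let $(\bar{\mathbf y}_{\mathscr T},\bar p_{\mathscr T},\bar{\mathbf z}_{\mathscr T},\bar r_{\mathscr T},\bar{\mathbf u}_{\mathscr T})\in\mathbf V(\mathscr T)\times Q(\mathscr T)\times\mathbf V(\mathscr T)\times Q(\mathscr T)\times(\mathbf U(\mathscr T)\cap\mathbb U_{ad})$ solve the same system with the test functions $\mathbf v,\mathbf w$ ranging over $\mathbf V(\mathscr T)$, $q,s$ over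 $Q(\mathscr T)$ and $\mathbf u$ over $\mathbf U(\mathscr T)\cap\mathbb U_{ad}$. *Claim.* Put $\mathbf e_{\mathbf y}=\bar{\mathbf y}-\bar{\mathbf y}_{\mathscr T}$, $e_p=\bar p-\bar p_{\mathscr T}$, $\mathbf e_{\mathbf u}=\bar{\mathbf u}-\bar{\mathbf u}_{\mathscr T}$ and, for $T\in\mathscr T$, $$E_{st,T}^2=h_T^2\|\bar{\mathbf u}_{\mathscr T}+\Delta\bar{\mathbf y}_{\mathscr T}-\nabla\bar p_{\mathscr T}\|_{L^2(T)}^2+\tfrac{h_T}{2}\sum_{S\in\mathscr S_T}\|[\![\nabla\bar{\mathbf y}_{\mathscr T}\cdot\boldsymbol\nu]\!]\|_{L^2(S)}^2+\|\operatorname{div}\bar{\mathbf y}_{\mathscr T}\|_{L^2(T)}^2 ,$$ where, on a side $S$ shared by $T^+$ and $T^-$, $[\![\nabla\mathbf v\cdot\boldsymbol\nu]\!]=\nabla\mathbf v|_{T^+}\cdot\boldsymbol\nu^++\nabla\mathbf v|_{T^-}\cdot\boldsymbol\nu^-$ with $\boldsymbol\nu^\pm$ the unit normals on $S$ pointing towards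 $T^\pm$. Then, for every $T\in\mathscr T$ and every choice of the representatives of $\bar p$ and $\bar p_{\mathscr T}$ modulo constants, $$E_{st,T}^2\le C\left(h_T^{d-2}\|\mathbf e_{\mathbf y}\|_{L^\infty(\mathcal N_T)^d}^2+\|e_p\|_{L^2(\mathcal N_T)}^2+h_T^2\|\mathbf e_{\mathbf u}\|_{L^2(\mathcal N_T)^d}^2\right).$$ -/

import Mathlib

open MeasureTheory Filter Topology
open scoped ENNReal NNReal ContDiff InnerProductSpace

namespace StokesOCP

/-- Euclidean space `ℝᵈ`. -/
abbrev E (d : ℕ) : Type := EuclideanSpace ℝ (Fin d)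

/-! ### Domains -/

/-- The boundary is locally the graph of a Lipschitz function, with the set on one side of it:
near every boundary point there are a unit vector `e` (the vertical direction) and a Lipschitz
function `γ` of the component of `x` orthogonal to `e` such that `x ∈ Ω` iff `x` lies strictly
above the graph of `γ`. -/
def HasLipschitzBoundary {d : ℕ} (Ω : Set (E d)) : Prop :=
  ∀ x₀ ∈ frontier Ω, ∃ e : E d, ‖e‖ = 1 ∧ ∃ (K : ℝ≥0) (γ : E d → ℝ), LipschitzWith K γ ∧
    ∃ U ∈ 𝓝 x₀, ∀ x ∈ U, x ∈ Ω ↔ γ (x - ⟪e, x⟫_ℝ • e) < ⟪e, x⟫_ℝ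

/-- Bounded Lipschitz domain. -/
structure IsLipschitzDomain {d : ℕ} (Ω : Set (E d)) : Prop where
  isOpen : IsOpen Ω
  isConnected : IsConnected Ω
  isBounded : Bornology.IsBounded Ω
  lipschitz : HasLipschitzBoundary Ω

/-! ### Weighted Lebesgue and Sobolev spaces -/

/-- The measure `wt dx` on `Ω`; `v ∈ L²(wt, Ω)` is `MemLp v 2 (weightedMeasure wt Ω)`. -/
noncomputable def weightedMeasure {d : ℕ} (wt : E d → ℝ) (Ω : Set (E d)) : Measure (E d) :=
  (volume.restrict Ω).withDensity (fun x => ENNReal.ofReal (wt x))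

/-- `φ ∈ C₀^∞(Ω)`. -/
def IsTestFunction {d : ℕ} (Ω : Set (E d)) (φ : E d → ℝ) : Prop :=
  ContDiff ℝ ∞ φ ∧ HasCompactSupport φ ∧ tsupport φ ⊆ Ω

/-- `g` is a weak (distributional) gradient of `v` on `Ω`. -/
def IsWeakGradient {d : ℕ} (Ω : Set (E d)) (v : E d → ℝ) (g : E d → E d) : Prop :=
  LocallyIntegrableOn v Ω ∧ LocallyIntegrableOn g Ω ∧
    ∀ φ : E d → ℝ, IsTestFunction Ω φ →
      ∫ x in Ω, v x • gradient φ x = -∫ x in Ω, φ x • g x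

open Classical in
/-- The weak gradient `∇v` on `Ω` (unique up to null sets; `0` if there is none). -/
noncomputable def weakGradient {d : ℕ} (Ω : Set (E d)) (v : E d → ℝ) : E d → E d :=
  if h : ∃ g, IsWeakGradient Ω v g then h.choose else 0

/-- `v ∈ H¹(wt, Ω)`. -/
def MemH1 {d : ℕ} (wt : E d → ℝ) (Ω : Set (E d)) (v : E d → ℝ) : Prop :=
  MemLp v 2 (weightedMeasure wt Ω) ∧ (∃ g, IsWeakGradient Ω v g) ∧
    MemLp (weakGradient Ω v) 2 (weightedMeasure wt Ω)

/-- The sequence `φ n ∈ C₀^∞(Ω)` converges to `v` in the norm of `H¹(wt, Ω)`. -/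
def IsApproximating {d : ℕ} (wt : E d → ℝ) (Ω : Set (E d)) (v : E d → ℝ)
    (φ : ℕ → E d → ℝ) : Prop :=
  (∀ n, IsTestFunction Ω (φ n)) ∧
    Tendsto (fun n => eLpNorm (fun x => φ n x - v x) 2 (weightedMeasure wt Ω)) atTop (𝓝 0) ∧
    Tendsto (fun n => eLpNorm (fun x => gradient (φ n) x - weakGradient Ω v x) 2
      (weightedMeasure wt Ω)) atTop (𝓝 0)

/-- `v ∈ H¹₀(wt, Ω)`, the closure of `C₀^∞(Ω)` in `H¹(wt, Ω)`. -/
def MemH10 {d : ℕ} (wt : E d → ℝ) (Ω : Set (E d)) (v : E d → ℝ) : Prop :=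
  MemH1 wt Ω v ∧ ∃ φ, IsApproximating wt Ω v φ

/-- `v ∈ H¹₀(wt, Ω)ᵈ`. -/
def MemH10Vec {d : ℕ} (wt : E d → ℝ) (Ω : Set (E d)) (v : E d → E d) : Prop :=
  ∀ i, MemH10 wt Ω (fun x => v x i)

/-- The weak divergence of a vector field. -/
noncomputable def weakDiv {d : ℕ} (Ω : Set (E d)) (v : E d → E d) (x : E d) : ℝ :=
  ∑ i, weakGradient Ω (fun x' => v x' i) x i

/-- `a(w, v) = ∑ᵢ ∫_Ω ∇wᵢ · ∇vᵢ`. -/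
noncomputable def formA {d : ℕ} (Ω : Set (E d)) (w v : E d → E d) : ℝ :=
  ∑ i, ∫ x in Ω, ⟪weakGradient Ω (fun x' => w x' i) x, weakGradient Ω (fun x' => v x' i) x⟫_ℝ

/-- `b(v, q) = -∫_Ω q div v`. -/
noncomputable def formB {d : ℕ} (Ω : Set (E d)) (v : E d → E d) (q : E d → ℝ) : ℝ :=
  -∫ x in Ω, q x * weakDiv Ω v x

/-- `(w, v)_{L²(Ω)}` for vector fields. -/
noncomputable def l2Inner {d : ℕ} (Ω : Set (E d)) (w v : E d → E d) : ℝ :=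
  ∫ x in Ω, ⟪w x, v x⟫_ℝ

/-- The point value at `t` of (the continuous representative of) an almost everywhere defined
field: the limit of its averages over shrinking balls. -/
noncomputable def pointValue {d : ℕ} (y : E d → E d) (t : E d) : E d :=
  limUnder (𝓝[>] (0 : ℝ)) (fun r => ⨍ x in Metric.ball t r, y x)

/-- If `y` has a continuous representative `y'` on `Ω`, then `pointValue y t` is `y' t`. -/
theorem pointValue_eq {d : ℕ} {Ω : Set (E d)} (hΩ : IsOpen Ω) {y y' : E d → E d}
    (hy : y =ᵐ[volume.restrict Ω] y') (hc : ContinuousOn y' Ω) {t : E d} (ht : t ∈ Ω) :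
    pointValue y t = y' t := by
  refine Tendsto.limUnder_eq ?_
  rw [Metric.tendsto_nhds]
  intro ε hε
  have hct : ContinuousAt y' t := hc.continuousAt (hΩ.mem_nhds ht)
  obtain ⟨δ, hδ, hδ'⟩ := Metric.continuousAt_iff.1 hct (ε / 2) (half_pos hε)
  obtain ⟨η, hη, hη'⟩ := Metric.isOpen_iff.1 hΩ t ht
  filter_upwards [Ioo_mem_nhdsGT (lt_min hδ (half_pos hη))] with r hr
  have hr0 : 0 < r := hr.1
  have hrδ : r < δ := hr.2.trans_le (min_le_left _ _)
  have hrη : r < η := (hr.2.trans_le (min_le_right _ _)).trans (half_lt_self hη)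
  have hsub : Metric.closedBall t r ⊆ Ω := (Metric.closedBall_subset_ball hrη).trans hη'
  have hsub' : Metric.ball t r ⊆ Ω := Metric.ball_subset_closedBall.trans hsub
  have hae : y =ᵐ[volume.restrict (Metric.ball t r)] y' := ae_restrict_of_ae_restrict_of_subset
    hsub' hy
  have hint : IntegrableOn y' (Metric.ball t r) :=
    ((hc.mono hsub).integrableOn_compact (isCompact_closedBall t r)).mono_set
      Metric.ball_subset_closedBall
  have hmem := (convex_closedBall (y' t) (ε / 2)).set_average_mem Metric.isClosed_closedBall
    (μ := volume) (t := Metric.ball t r) (f := y) (Metric.measure_ball_pos _ _ hr0).ne'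
    measure_ball_lt_top.ne ?_ (hint.congr_fun_ae hae.symm)
  · exact (Metric.mem_closedBall.1 hmem).trans_lt (half_lt_self hε)
  · filter_upwards [hae, ae_restrict_mem Metric.isOpen_ball.measurableSet] with x hx hxb
    rw [hx]
    exact (hδ' ((Metric.mem_ball.1 hxb).trans hrδ)).le

/-! ### The optimal control problem -/

/-- Data of the pointwise tracking problem on `Ω`. -/
structure TrackingData (d : ℕ) (Ω : Set (E d)) where
  /-- the finite set of observation points -/
  obs : Finset (E d)
  obs_subset : (obs : Set (E d)) ⊆ Ω
  /-- the desired states at the observation points -/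
  desired : E d → E d
  /-- the regularization parameter -/
  lam : ℝ
  lam_pos : 0 < lam
  /-- the control bounds -/
  lower : E d
  upper : E d
  lower_lt_upper : ∀ i, lower i < upper i
  /-- the exponent of the weight -/
  α : ℝ
  lt_α : (d : ℝ) - 2 < α
  α_lt : α < 2

/-- `d_𝒟`: the distance of the observation points to the boundary or, if there are several of
them, the minimum of this distance and of the mutual distances of distinct points. -/
noncomputable def obsDist {d : ℕ} {Ω : Set (E d)} (P : TrackingData d Ω) : ℝ :=
  if P.obs.card = 1 then ⨅ t : P.obs, Metric.infDist (t : E d) (frontier Ω)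
  else min (⨅ t : P.obs, Metric.infDist (t : E d) (frontier Ω)) (P.obs : Set (E d)).infsep

open Classical in
/-- The weight `ρ`: `|x - t|^α` if `𝒟 = {t}`; if there are several points, `|x - t|^α` on the
ball of radius `d_𝒟 / 2` about each `t ∈ 𝒟` (these balls are disjoint) and `1` elsewhere. -/
noncomputable def weight {d : ℕ} {Ω : Set (E d)} (P : TrackingData d Ω) (x : E d) : ℝ :=
  if h₁ : P.obs.card = 1 then dist x (Finset.card_eq_one.1 h₁).choose ^ P.α
  else if h : ∃ t ∈ P.obs, dist x t < obsDist P / 2 then dist x h.choose ^ P.α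
  else 1

/-- `ρ⁻¹`. -/
noncomputable def weightInv {d : ℕ} {Ω : Set (E d)} (P : TrackingData d Ω) (x : E d) : ℝ :=
  (weight P x)⁻¹

/-- The set `𝕌_ad` of admissible controls. -/
def IsAdmissible {d : ℕ} {Ω : Set (E d)} (P : TrackingData d Ω) (u : E d → E d) : Prop :=
  MemLp u 2 (volume.restrict Ω) ∧
    ∀ᵐ x ∂(volume.restrict Ω), ∀ i, P.lower i ≤ u x i ∧ u x i ≤ P.upper i

/-- `(y, p, z, r, u)` solves the optimality system. Classes in `L²(Ω)/ℝ` and `L²(ρ, Ω)/ℝ`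
(unknowns and test functions) are given by arbitrary representatives; as `b(v, 1) = 0`, this does
not matter in the equations. The pairing `⟨F δ_t, w⟩` with `w ∈ H¹₀(ρ⁻¹, Ω)ᵈ` is the continuous
extension of `φ ↦ F · φ(t)` from `C₀^∞(Ω)ᵈ`. -/
structure IsOptimalitySystemSolution {d : ℕ} {Ω : Set (E d)} (P : TrackingData d Ω)
    (y : E d → E d) (p : E d → ℝ) (z : E d → E d) (r : E d → ℝ) (u : E d → E d) : Prop where
  y_mem : MemH10Vec (fun _ => 1) Ω y
  p_mem : MemLp p 2 (volume.restrict Ω)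
  z_mem : MemH10Vec (weight P) Ω z
  r_mem : MemLp r 2 (weightedMeasure (weight P) Ω)
  u_mem : IsAdmissible P u
  /-- momentum equation of the state -/
  state_momentum : ∀ v, MemH10Vec (fun _ => 1) Ω v →
    formA Ω y v + formB Ω v p = l2Inner Ω u v
  state_div : ∀ q, MemLp q 2 (volume.restrict Ω) → formB Ω y q = 0
  /-- momentum equation of the adjoint state -/
  adjoint_momentum : ∀ w, MemH10Vec (weightInv P) Ω w → ∀ φ : ℕ → E d → E d,
    (∀ i, IsApproximating (weightInv P) Ω (fun x => w x i) (fun n x => φ n x i)) →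
      Tendsto (fun n => ∑ t ∈ P.obs, ⟪pointValue y t - P.desired t, φ n t⟫_ℝ) atTop
        (𝓝 (formA Ω w z - formB Ω w r))
  adjoint_div : ∀ s, MemLp s 2 (weightedMeasure (weightInv P) Ω) → formB Ω z s = 0
  variational_inequality : ∀ u', IsAdmissible P u' →
    0 ≤ l2Inner Ω (fun x => z x + P.lam • u x) (fun x => u' x - u x)

/-! ### Meshes -/

/-- The closed simplex with vertex set `T`. -/
def simplex {d : ℕ} (T : Finset (E d)) : Set (E d) := convexHull ℝ (T : Set (E d))

/-- The size `h_T = diam T` of an element. -/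
noncomputable def size {d : ℕ} (T : Finset (E d)) : ℝ := Metric.diam (simplex T)

open Classical in
/-- `𝒯` is a conforming partition of `closure Ω` into nondegenerate simplices (given by their
vertex sets): the intersection of two elements is empty or a common face. -/
structure IsConformingMesh {d : ℕ} (Ω : Set (E d)) (𝒯 : Finset (Finset (E d))) : Prop where
  card_eq : ∀ T ∈ 𝒯, T.card = d + 1
  affineIndependent : ∀ T ∈ 𝒯, AffineIndependent ℝ ((↑) : T → E d)
  inter_eq : ∀ T ∈ 𝒯, ∀ T' ∈ 𝒯, simplex T ∩ simplex T' = simplex (T ∩ T')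
  iUnion_eq : ⋃ T ∈ 𝒯, simplex T = closure Ω

/-- Shape regularity with constant `σ`: every element contains a ball of diameter `2r > 0` with
`h_T ≤ σ (2r)`. -/
def IsShapeRegular {d : ℕ} (σ : ℝ) (𝒯 : Finset (Finset (E d))) : Prop :=
  ∀ T ∈ 𝒯, ∃ (c : E d) (r : ℝ), 0 < r ∧ Metric.closedBall c r ⊆ simplex T ∧
    size T ≤ σ * (2 * r)

open Classical in
/-- `𝒮_T`: the sides of the element `T` that are shared with another element of the mesh. -/
noncomputable def interiorSides {d : ℕ} (𝒯 : Finset (Finset (E d))) (T : Finset (E d)) :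
    Finset (Finset (E d)) :=
  (T.powersetCard d).filter (fun S => ∃ T' ∈ 𝒯, T' ≠ T ∧ S ⊆ T')

open Classical in
/-- `𝒩_S`: the elements having `S` as a side (exactly two for an interior side). -/
noncomputable def sidePatch {d : ℕ} (𝒯 : Finset (Finset (E d))) (S : Finset (E d)) :
    Finset (Finset (E d)) :=
  𝒯.filter (fun T => S ⊆ T)

open Classical in
/-- `𝒩_T`: the union of `T` and of the elements which share a side with `T`. -/
def patch {d : ℕ} (𝒯 : Finset (Finset (E d))) (T : Finset (E d)) : Set (E d) :=
  ⋃ T' ∈ {T' ∈ (𝒯 : Set (Finset (E d))) |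
    T' = T ∨ (interiorSides 𝒯 T ∩ interiorSides 𝒯 T').Nonempty}, simplex T'

open Classical in
/-- The unit normal on the side `S` of the simplex `T` that points towards `T`. -/
noncomputable def unitNormal {d : ℕ} (T S : Finset (E d)) : E d :=
  if h : ∃ n : E d, ‖n‖ = 1 ∧ (∀ x ∈ S, ∀ x' ∈ S, ⟪n, x - x'⟫_ℝ = 0) ∧
      ∀ x ∈ S, ∀ v ∈ T, v ∉ S → 0 < ⟪n, v - x⟫_ℝ
  then h.choose else 0

/-- The jump `⟦∇y · ν⟧ = ∇y|_{T⁺} · ν⁺ + ∇y|_{T⁻} · ν⁻` on the side `S`, where `𝒩_S = {T⁺, T⁻}`;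
`∇y · ν` is the directional derivative of `y` along `ν`. -/
noncomputable def jump {d : ℕ} (𝒯 : Finset (Finset (E d))) (y : E d → E d)
    (S : Finset (E d)) (x : E d) : E d :=
  ∑ T ∈ sidePatch 𝒯 S, fderivWithin ℝ y (simplex T) x (unitNormal T S)

/-! ### Discrete spaces and the discrete problem -/

/-- `f|_T ∈ ℙ_k(T)`. -/
def IsPolynomialOn {d : ℕ} (k : ℕ) (T : Finset (E d)) (f : E d → ℝ) : Prop :=
  ∃ P : MvPolynomial (Fin d) ℝ, P.totalDegree ≤ k ∧
    ∀ x ∈ simplex T, f x = MvPolynomial.eval (fun i => x i) P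

/-- The pressure space `Q(𝒯)`; elements of `L²(Ω)/ℝ` are given by arbitrary representatives. -/
def MemQ {d : ℕ} (Ω : Set (E d)) (𝒯 : Finset (Finset (E d))) (q : E d → ℝ) : Prop :=
  ContinuousOn q (closure Ω) ∧ ∀ T ∈ 𝒯, IsPolynomialOn 1 T q

/-- Continuous piecewise quadratic vector fields: the space `𝐔(𝒯)`. -/
def MemU {d : ℕ} (Ω : Set (E d)) (𝒯 : Finset (Finset (E d))) (v : E d → E d) : Prop :=
  ContinuousOn v (closure Ω) ∧ ∀ T ∈ 𝒯, ∀ i, IsPolynomialOn 2 T (fun x => v x i)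

/-- The velocity space `𝐕(𝒯)`. -/
def MemV {d : ℕ} (Ω : Set (E d)) (𝒯 : Finset (Finset (E d))) (v : E d → E d) : Prop :=
  MemU Ω 𝒯 v ∧ MemH10Vec (fun _ => 1) Ω v

/-- `(y, p, z, r, u)` solves the discrete optimality system on the mesh `𝒯`. -/
structure IsDiscreteSolution {d : ℕ} {Ω : Set (E d)} (P : TrackingData d Ω)
    (𝒯 : Finset (Finset (E d)))
    (y : E d → E d) (p : E d → ℝ) (z : E d → E d) (r : E d → ℝ) (u : E d → E d) : Prop where
  y_mem : MemV Ω 𝒯 y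
  p_mem : MemQ Ω 𝒯 p
  z_mem : MemV Ω 𝒯 z
  r_mem : MemQ Ω 𝒯 r
  u_mem : MemU Ω 𝒯 u
  u_admissible : IsAdmissible P u
  state_momentum : ∀ v, MemV Ω 𝒯 v → formA Ω y v + formB Ω v p = l2Inner Ω u v
  state_div : ∀ q, MemQ Ω 𝒯 q → formB Ω y q = 0
  adjoint_momentum : ∀ w, MemV Ω 𝒯 w →
    formA Ω w z - formB Ω w r = ∑ t ∈ P.obs, ⟪y t - P.desired t, w t⟫_ℝ
  adjoint_div : ∀ s, MemQ Ω 𝒯 s → formB Ω z s = 0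
  variational_inequality : ∀ u', MemU Ω 𝒯 u' → IsAdmissible P u' →
    0 ≤ l2Inner Ω (fun x => z x + P.lam • u x) (fun x => u' x - u x)

/-! ### The error indicator -/

/-- The element residual `u + Δy - ∇p` of the discrete fields restricted to `T`. -/
noncomputable def elementResidual {d : ℕ} (T : Finset (E d)) (y : E d → E d) (p : E d → ℝ)
    (u : E d → E d) (x : E d) : E d :=
  u x + InnerProductSpace.laplacianWithin y (simplex T) x - gradientWithin p (simplex T) x

/-- The divergence of the restriction of `y` to `T`. -/
noncomputable def elementDiv {d : ℕ} (T : Finset (E d)) (y : E d → E d) (x : E d) : ℝ :=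
  ∑ i, fderivWithin ℝ y (simplex T) x (EuclideanSpace.single i 1) i

/-- The local error indicator `E_{st,T}(y, p, u)`. The `L²`-norm of the jump over `∂T ∖ ∂Ω`
is taken over the interior sides of `T`, with respect to surface measure. -/
noncomputable def indicatorSt {d : ℕ} (𝒯 : Finset (Finset (E d))) (T : Finset (E d))
    (y : E d → E d) (p : E d → ℝ) (u : E d → E d) : ℝ≥0∞ :=
  (ENNReal.ofReal (size T ^ 2) *
      eLpNorm (elementResidual T y p u) 2 (volume.restrict (simplex T)) ^ 2
    + ENNReal.ofReal (size T / 2) * ∑ S ∈ interiorSides 𝒯 T,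
        eLpNorm (jump 𝒯 y S) 2 (μHE[d - 1].restrict (simplex S)) ^ 2
    + eLpNorm (elementDiv T y) 2 (volume.restrict (simplex T)) ^ 2) ^ (1 / 2 : ℝ)

end StokesOCP

/-! The exact state equations see only the error. Let `φ` be smooth with compact support in a ball
of radius `r` inside `Ω`. The momentum equation tested with `φ eᵢ`, with all derivatives moved onto
`φ`, reads `∫ yᵢ Δφ + ∫ p ∂ᵢφ + ∫ uᵢ φ = 0`. The same expression ℒ(φ) for the discrete fields is
therefore a functional of the errors alone. No derivative falls on the velocity error, so its `L^∞`
norm suffices: if `|φ| ≤ M`, `|∂φ| ≤ M / r` and `|∂²φ| ≤ M / r²`, then `ℒ(φ)² ≤ C M² r^(d-2)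
(r^(d-2) ‖e_y‖_∞² + ‖e_p‖² + r² ‖e_u‖²)`. This scaling is `TestBound`, the bracket is `errorSize`,
and the bound is `exists_testBound_discreteFunctional`. The divergence equation is treated in the
same way.

The lower bounds on ℒ follow Verfürth's bubble function technique, with a smooth radial bump on a
ball in place of polynomial bubbles. On each element the discrete fields are polynomials of degree
at most two, and on this finite dimensional space the `L²` norm on a ball controls the values on any
fixed multiple of the ball, with a constant that survives dilation
(`exists_isQuad_sq_le_integral_ball`).

Residual and divergence: in a ball inside `T`, integration by parts gives `ℒ(φ) = ∫ R φ` with the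
polynomial residual `R`. The choice `φ = bump · R` makes the integral comparable to `∫ R²` and
bounds `R` pointwise on all of `T` (`exists_residual_bound`).

Jump: near the barycenter of a common side, the two elements fill the two halves of a ball. The
velocity pieces differ by a quadratic function that vanishes on the hyperplane of the side, hence by
`ℓ m + κ ℓ²`, where `ℓ` is the signed distance and the affine function `m` is constant along the
normal `n`; on the hyperplane `m` is the jump of the normal derivative. The pressure is continuous,
so its pieces differ by a multiple of `ℓ` and contribute no jump. What is left of ℒ after
subtracting the residuals is the surface integral of `m φ`, written as the volume integral `-∫ m
∂ₙφ` over the half space. For `φ = bump · m` the derivative falls on the radially decreasing bump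
only, so the integrand has a sign (`exists_jump_bound`).

Shape regularity makes these balls comparable to `h_T`: barycentric coordinates have slope at most
`1 / (2r)` if the element contains a ball of radius `r`, which compares neighbours through a common
edge and determines how far from the barycenter of a side an element is a half space. -/

namespace StokesOCP

/-! ### Quadratic functions -/

/-- `f` is an affine function. -/
def IsAff {d : ℕ} (f : E d → ℝ) : Prop :=
  ∃ (c : ℝ) (g : E d), ∀ x, f x = c + ⟪g, x⟫_ℝ

/-- `f` is a polynomial of degree at most two. -/
def IsQuad {d : ℕ} (f : E d → ℝ) : Prop :=
  ∃ (c : ℝ) (g : E d) (A : E d →L[ℝ] E d), ∀ x, f x = c + ⟪g, x⟫_ℝ + ⟪A x, x⟫_ℝ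

section Quadratic

variable {d : ℕ} {f f' : E d → ℝ}

theorem IsAff.isQuad (hf : IsAff f) : IsQuad f := by
  obtain ⟨c, g, h⟩ := hf
  exact ⟨c, g, 0, fun x => by simp [h]⟩

theorem isAff_const (c : ℝ) : IsAff (fun _ : E d => c) := ⟨c, 0, fun x => by simp⟩

theorem isQuad_const (c : ℝ) : IsQuad (fun _ : E d => c) := (isAff_const c).isQuad

theorem isAff_inner (n : E d) : IsAff (fun x => ⟪n, x⟫_ℝ) := ⟨0, n, fun x => by simp⟩

theorem isAff_coord (i : Fin d) : IsAff (fun x : E d => x i) :=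
  ⟨0, EuclideanSpace.single i 1, fun x => by simp [EuclideanSpace.inner_single_left]⟩

theorem IsAff.add (hf : IsAff f) (hf' : IsAff f') : IsAff (fun x => f x + f' x) := by
  obtain ⟨c, g, h⟩ := hf
  obtain ⟨c', g', h'⟩ := hf'
  exact ⟨c + c', g + g', fun x => by simp only [h, h', inner_add_left]; ring⟩

theorem IsAff.const_mul (a : ℝ) (hf : IsAff f) : IsAff (fun x => a * f x) := by
  obtain ⟨c, g, h⟩ := hf
  exact ⟨a * c, a • g, fun x => by simp only [h, inner_smul_left, conj_trivial]; ring⟩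

theorem IsAff.sub (hf : IsAff f) (hf' : IsAff f') : IsAff (fun x => f x - f' x) := by
  simpa [sub_eq_add_neg] using hf.add (hf'.const_mul (-1))

theorem IsQuad.add (hf : IsQuad f) (hf' : IsQuad f') : IsQuad (fun x => f x + f' x) := by
  obtain ⟨c, g, A, h⟩ := hf
  obtain ⟨c', g', A', h'⟩ := hf'
  exact ⟨c + c', g + g', A + A', fun x => by
    simp only [h, h', inner_add_left, _root_.add_apply]; ring⟩

theorem IsQuad.const_mul (a : ℝ) (hf : IsQuad f) : IsQuad (fun x => a * f x) := by
  obtain ⟨c, g, A, h⟩ := hf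
  exact ⟨a * c, a • g, a • A, fun x => by
    simp only [h, inner_smul_left, conj_trivial, _root_.smul_apply]; ring⟩

theorem IsQuad.sub (hf : IsQuad f) (hf' : IsQuad f') : IsQuad (fun x => f x - f' x) := by
  simpa [sub_eq_add_neg] using hf.add (hf'.const_mul (-1))

theorem IsAff.mul (hf : IsAff f) (hf' : IsAff f') : IsQuad (fun x => f x * f' x) := by
  obtain ⟨c, g, h⟩ := hf
  obtain ⟨c', g', h'⟩ := hf'
  refine ⟨c * c', c • g' + c' • g, (innerSL ℝ g).smulRight g', fun x => ?_⟩
  simp only [h, h', inner_add_left, inner_smul_left, conj_trivial,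
    ContinuousLinearMap.smulRight_apply, innerSL_apply_apply]
  ring

theorem IsAff.sum {ι : Type*} (s : Finset ι) {F : ι → E d → ℝ} (h : ∀ i ∈ s, IsAff (F i)) :
    IsAff (fun x => ∑ i ∈ s, F i x) := by
  classical
  induction s using Finset.induction_on with
  | empty => simpa using isAff_const (d := d) 0
  | insert a s ha ih =>
    simp only [Finset.sum_insert ha]
    exact (h a (by simp)).add (ih fun i hi => h i (by simp [hi]))

theorem IsQuad.sum {ι : Type*} (s : Finset ι) {F : ι → E d → ℝ} (h : ∀ i ∈ s, IsQuad (F i)) :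
    IsQuad (fun x => ∑ i ∈ s, F i x) := by
  classical
  induction s using Finset.induction_on with
  | empty => simpa using isQuad_const (d := d) 0
  | insert a s ha ih =>
    simp only [Finset.sum_insert ha]
    exact (h a (by simp)).add (ih fun i hi => h i (by simp [hi]))

theorem IsQuad.comp_dilation (hf : IsQuad f) (c : E d) (r : ℝ) :
    IsQuad (fun x => f (c + r • x)) := by
  obtain ⟨a, g, A, h⟩ := hf
  refine ⟨a + ⟪g, c⟫_ℝ + ⟪A c, c⟫_ℝ,
    r • g + r • A c + r • (ContinuousLinearMap.adjoint A) c, (r ^ 2) • A, fun x => ?_⟩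
  simp only [h, inner_add_left, inner_add_right, inner_smul_left, inner_smul_right, conj_trivial,
    map_add, map_smul, _root_.smul_apply, ContinuousLinearMap.adjoint_inner_left]
  rw [real_inner_comm c (A x)]
  ring

theorem IsAff.comp_dilation (hf : IsAff f) (c : E d) (r : ℝ) :
    IsAff (fun x => f (c + r • x)) := by
  obtain ⟨a, g, h⟩ := hf
  refine ⟨a + ⟪g, c⟫_ℝ, r • g, fun x => ?_⟩
  simp only [h, inner_add_right, inner_smul_left, inner_smul_right, conj_trivial]
  ring

theorem IsAff.contDiff (hf : IsAff f) {n : WithTop ℕ∞} : ContDiff ℝ n f := by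
  obtain ⟨c, g, h⟩ := hf
  rw [funext h]
  exact contDiff_const.add (contDiff_const.inner ℝ contDiff_id)

theorem IsQuad.contDiff (hf : IsQuad f) {n : WithTop ℕ∞} : ContDiff ℝ n f := by
  obtain ⟨c, g, A, h⟩ := hf
  rw [funext h]
  exact (contDiff_const.add (contDiff_const.inner ℝ contDiff_id)).add
    (A.contDiff.inner ℝ contDiff_id)

theorem IsQuad.continuous (hf : IsQuad f) : Continuous f := (hf.contDiff (n := 0)).continuous

theorem IsAff.fderiv_apply (hf : IsAff f) (x v : E d) : fderiv ℝ f x v = f (x + v) - f x := by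
  obtain ⟨c, g, h⟩ := hf
  have h1 : HasFDerivAt f (innerSL ℝ g) x := by
    rw [funext h]
    exact ((innerSL ℝ g).hasFDerivAt (x := x)).const_add c
  rw [h1.fderiv, h, h, inner_add_right, innerSL_apply_apply]
  ring

theorem IsQuad.fderiv_eq {c : ℝ} {g : E d} {A : E d →L[ℝ] E d}
    (h : ∀ x, f x = c + ⟪g, x⟫_ℝ + ⟪A x, x⟫_ℝ) (x v : E d) :
    fderiv ℝ f x v = ⟪g, v⟫_ℝ + ⟪A x, v⟫_ℝ + ⟪A v, x⟫_ℝ := by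
  have h1 : HasFDerivAt f (innerSL ℝ g + (fderivInnerCLM ℝ (A x, x)).comp
      (A.prod (ContinuousLinearMap.id ℝ (E d)))) x := by
    rw [funext h]
    exact (((innerSL ℝ g).hasFDerivAt (x := x)).const_add c).add
      ((A.hasFDerivAt (x := x)).inner ℝ (hasFDerivAt_id x))
  rw [h1.fderiv]
  simp only [_root_.add_apply, innerSL_apply_apply, ContinuousLinearMap.comp_apply,
    ContinuousLinearMap.prod_apply, fderivInnerCLM_apply, ContinuousLinearMap.id_apply]
  ring

/-- Central differences are exact for quadratic functions, with any step. Together with the second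
difference below, this bounds derivatives by values and serves as inverse estimate. -/
theorem IsQuad.fderiv_apply (hf : IsQuad f) (x v : E d) :
    fderiv ℝ f x v = (f (x + v) - f (x - v)) / 2 := by
  obtain ⟨c, g, A, h⟩ := hf
  rw [IsQuad.fderiv_eq h, h, h]
  simp only [map_add, map_sub, inner_add_left, inner_add_right, inner_sub_left, inner_sub_right]
  ring

theorem IsQuad.isAff_fderiv (hf : IsQuad f) (v : E d) : IsAff (fun x => fderiv ℝ f x v) := by
  obtain ⟨c, g, A, h⟩ := hf
  refine ⟨⟪g, v⟫_ℝ, (ContinuousLinearMap.adjoint A) v + A v, fun x => ?_⟩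
  simp only [IsQuad.fderiv_eq h]
  rw [inner_add_left, ContinuousLinearMap.adjoint_inner_left,
    real_inner_comm v (A x)]
  ring

theorem IsQuad.fderiv_fderiv (hf : IsQuad f) (x v : E d) :
    fderiv ℝ (fun x => fderiv ℝ f x v) x v = f (x + v) + f (x - v) - 2 * f x := by
  rw [(hf.isAff_fderiv v).fderiv_apply]
  obtain ⟨c, g, A, h⟩ := hf
  rw [IsQuad.fderiv_eq h, IsQuad.fderiv_eq h, h, h, h]
  simp only [map_add, map_sub, inner_add_left, inner_add_right, inner_sub_left, inner_sub_right]
  ring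

theorem IsAff.fderiv_const (hf : IsAff f) (x v : E d) : fderiv ℝ f x v = f v - f 0 := by
  obtain ⟨c, g, h⟩ := id hf
  rw [hf.fderiv_apply, h, h, h, h, inner_add_right]
  simp

theorem isAff_eval {P : MvPolynomial (Fin d) ℝ} (hP : P.totalDegree ≤ 1) :
    IsAff (fun x : E d => MvPolynomial.eval (fun i => x i) P) := by
  simp only [MvPolynomial.eval_eq']
  refine IsAff.sum _ fun m hm => IsAff.const_mul _ ?_
  -- A monomial is the product over the multiset of its variables, whose cardinality is its degree.
  have h1 : m.toMultiset.card ≤ 1 := by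
    rw [Finsupp.card_toMultiset]
    exact (MvPolynomial.le_totalDegree hm).trans hP
  have h2 : ∀ x : E d, ∏ i, x i ^ m i = (m.toMultiset.map (fun i => x i)).prod := by
    intro x
    rw [Finsupp.toMultiset_map, Finsupp.prod_toMultiset, Finsupp.prod_mapDomain_index]
    · rw [Finsupp.prod_fintype]; simp
    · simp
    · intro b m n; rw [pow_add]
  simp only [h2]
  rcases Nat.lt_or_eq_of_le h1 with h | h
  · have : m.toMultiset = 0 := Multiset.card_eq_zero.1 (by omega)
    simpa [this] using isAff_const (d := d) 1
  · obtain ⟨i, hi⟩ := Multiset.card_eq_one.1 h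
    simpa [hi] using isAff_coord i

theorem isQuad_eval {P : MvPolynomial (Fin d) ℝ} (hP : P.totalDegree ≤ 2) :
    IsQuad (fun x : E d => MvPolynomial.eval (fun i => x i) P) := by
  simp only [MvPolynomial.eval_eq']
  refine IsQuad.sum _ fun m hm => IsQuad.const_mul _ ?_
  have h1 : m.toMultiset.card ≤ 2 := by
    rw [Finsupp.card_toMultiset]
    exact (MvPolynomial.le_totalDegree hm).trans hP
  have h2 : ∀ x : E d, ∏ i, x i ^ m i = (m.toMultiset.map (fun i => x i)).prod := by
    intro x
    rw [Finsupp.toMultiset_map, Finsupp.prod_toMultiset, Finsupp.prod_mapDomain_index]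
    · rw [Finsupp.prod_fintype]; simp
    · simp
    · intro b m n; rw [pow_add]
  simp only [h2]
  have h3 : m.toMultiset.card = 0 ∨ m.toMultiset.card = 1 ∨ m.toMultiset.card = 2 := by omega
  rcases h3 with h | h | h
  · simpa [Multiset.card_eq_zero.1 h] using isQuad_const (d := d) 1
  · obtain ⟨i, hi⟩ := Multiset.card_eq_one.1 h
    simpa [hi] using (isAff_coord i).isQuad
  · obtain ⟨i, j, hi⟩ := Multiset.card_eq_two.1 h
    simpa [hi] using (isAff_coord i).mul (isAff_coord j)

/-- A quadratic function which vanishes on a ball vanishes identically. -/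
theorem IsQuad.eq_zero_of_ball (hf : IsQuad f) {r : ℝ} (hr : 0 < r)
    (h0 : ∀ x ∈ Metric.ball (0 : E d) r, f x = 0) (x : E d) : f x = 0 := by
  obtain ⟨c, g, A, h⟩ := hf
  obtain ⟨t, ht, htx⟩ : ∃ t : ℝ, 0 < t ∧ t * ‖x‖ < r := by
    refine ⟨r / (‖x‖ + 1), by positivity, ?_⟩
    rw [div_mul_eq_mul_div, div_lt_iff₀ (by positivity)]
    nlinarith [norm_nonneg x]
  -- Along the line through `0` and `x`, `f` is a quadratic polynomial in `s`; its zeros `0`, `t`,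
  -- `-t` force all three coefficients to vanish.
  have k : ∀ s : ℝ, |s| ≤ t → c + s * ⟪g, x⟫_ℝ + s ^ 2 * ⟪A x, x⟫_ℝ = 0 := by
    intro s hs
    have := h0 (s • x) (by
      rw [mem_ball_zero_iff, norm_smul, Real.norm_eq_abs]
      exact (mul_le_mul_of_nonneg_right hs (norm_nonneg x)).trans_lt htx)
    rw [h] at this
    simp only [map_smul, inner_smul_left, inner_smul_right, conj_trivial] at this
    linarith
  have k0 := k 0 (by simpa using ht.le)
  have k1 := k t (abs_of_pos ht).le
  have k2 := k (-t) (by rw [abs_neg, abs_of_pos ht])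
  have hc : c = 0 := by simpa using k0
  subst hc
  have hA : t ^ 2 * ⟪A x, x⟫_ℝ = 0 := by nlinarith
  have hA' : ⟪A x, x⟫_ℝ = 0 := by
    rcases mul_eq_zero.1 hA with h | h
    · exact absurd h (by positivity)
    · exact h
  have hg : t * ⟪g, x⟫_ℝ = 0 := by nlinarith
  have hg' : ⟪g, x⟫_ℝ = 0 := by
    rcases mul_eq_zero.1 hg with h | h
    · exact absurd h ht.ne'
    · exact h
  rw [h, hA', hg']; simp

end Quadratic

/-! ### Norm equivalence for quadratic functions -/

section NormEquivalence

variable {d : ℕ}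

theorem memLp_ball_of_continuous {f : E d → ℝ} (hf : Continuous f) (c : E d) (r : ℝ) {p : ℝ≥0∞} :
    MemLp f p (volume.restrict (Metric.ball c r)) := by
  have hfin : IsFiniteMeasure (volume.restrict (Metric.ball c r)) :=
    ⟨by simpa using measure_ball_lt_top⟩
  obtain ⟨C, hC⟩ := (isCompact_closedBall c r).exists_bound_of_continuousOn hf.continuousOn
  refine MemLp.of_bound hf.aestronglyMeasurable C ?_
  filter_upwards [ae_restrict_mem Metric.isOpen_ball.measurableSet] with x hx
  exact hC x (Metric.ball_subset_closedBall hx)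

/-- The linear map from coefficients to quadratic functions in `L²` of the unit ball. -/
noncomputable def quadToLp (d : ℕ) :
    (ℝ × E d × (E d →L[ℝ] E d)) →ₗ[ℝ] Lp ℝ 2 (volume.restrict (Metric.ball (0 : E d) 1)) where
  toFun v := (memLp_ball_of_continuous (f := fun x => v.1 + ⟪v.2.1, x⟫_ℝ + ⟪v.2.2 x, x⟫_ℝ)
    (IsQuad.continuous ⟨_, _, _, fun _ => rfl⟩) 0 1).toLp _
  map_add' v w := by
    rw [← MemLp.toLp_add]
    congr 1
    ext x
    simp only [Prod.fst_add, Prod.snd_add, inner_add_left, _root_.add_apply, Pi.add_apply]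
    ring
  map_smul' a v := by
    rw [← MemLp.toLp_const_smul]
    congr 1
    ext x
    simp only [Prod.smul_fst, Prod.smul_snd, inner_smul_left, _root_.smul_apply, Pi.smul_apply,
      smul_eq_mul, conj_trivial, RingHom.id_apply]
    ring

theorem norm_sq_toLp {μ : Measure (E d)} {f : E d → ℝ} (hf : MemLp f 2 μ) :
    ‖hf.toLp f‖ ^ 2 = ∫ x, f x ^ 2 ∂μ := by
  rw [← real_inner_self_eq_norm_sq, L2.inner_def]
  refine integral_congr_ae ?_
  filter_upwards [hf.coeFn_toLp] with x hx
  rw [hx]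
  simp [sq]

/-- A linear map on a finite dimensional space is bounded below modulo its kernel. -/
theorem exists_norm_le_of_finiteDimensional {V W : Type*} [NormedAddCommGroup V] [NormedSpace ℝ V]
    [FiniteDimensional ℝ V] [NormedAddCommGroup W] [NormedSpace ℝ W] (G : V →ₗ[ℝ] W) :
    ∃ C : ℝ, 0 ≤ C ∧ ∀ v, ∃ v', G v' = G v ∧ ‖v'‖ ≤ C * ‖G v‖ := by
  -- `L` is a linear section of `G` over its range, bounded because the range is finite dimensional.
  obtain ⟨L, hL⟩ := G.rangeRestrict.exists_rightInverse_of_surjective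
    (LinearMap.range_rangeRestrict _)
  refine ⟨‖LinearMap.toContinuousLinearMap L‖, ContinuousLinearMap.opNorm_nonneg _, fun v => ⟨L (G.rangeRestrict v),
    congrArg Subtype.val (LinearMap.congr_fun hL (G.rangeRestrict v)), ?_⟩⟩
  exact (LinearMap.toContinuousLinearMap L).le_opNorm (G.rangeRestrict v)

theorem quadToLp_apply (v : ℝ × E d × (E d →L[ℝ] E d)) :
    quadToLp d v = (memLp_ball_of_continuous (f := fun x => v.1 + ⟪v.2.1, x⟫_ℝ + ⟪v.2.2 x, x⟫_ℝ)
    (IsQuad.continuous ⟨_, _, _, fun _ => rfl⟩) 0 1).toLp _ := rfl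

/-- The coefficients are not determined by the function, as a skew-symmetric operator gives the zero
form; but two triples with the same class differ by a continuous quadratic function that vanishes on
the unit ball. -/
theorem eq_of_quadToLp_eq {v w : ℝ × E d × (E d →L[ℝ] E d)} (h : quadToLp d v = quadToLp d w)
    (x : E d) : v.1 + ⟪v.2.1, x⟫_ℝ + ⟪v.2.2 x, x⟫_ℝ = w.1 + ⟪w.2.1, x⟫_ℝ + ⟪w.2.2 x, x⟫_ℝ := by
  rw [quadToLp_apply, quadToLp_apply, MemLp.toLp_eq_toLp_iff] at h
  have hv : IsQuad (fun x => v.1 + ⟪v.2.1, x⟫_ℝ + ⟪v.2.2 x, x⟫_ℝ) := ⟨_, _, _, fun _ => rfl⟩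
  have hw : IsQuad (fun x => w.1 + ⟪w.2.1, x⟫_ℝ + ⟪w.2.2 x, x⟫_ℝ) := ⟨_, _, _, fun _ => rfl⟩
  have h0 := Measure.eqOn_open_of_ae_eq h Metric.isOpen_ball hv.continuous.continuousOn
    hw.continuous.continuousOn
  have := (hv.sub hw).eq_zero_of_ball one_pos (fun y hy => sub_eq_zero.2 (h0 hy)) x
  exact sub_eq_zero.1 this

theorem norm_sq_quadToLp (v : ℝ × E d × (E d →L[ℝ] E d)) :
    ‖quadToLp d v‖ ^ 2 =
      ∫ y in Metric.ball 0 1, (v.1 + ⟪v.2.1, y⟫_ℝ + ⟪v.2.2 y, y⟫_ℝ) ^ 2 := by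
  rw [quadToLp_apply]
  exact norm_sq_toLp _

/-- Equivalence of norms in finite dimension: `f` has a coefficient triple bounded by its `L²` norm
on the unit ball, and the triple bounds the values on the ball of radius `R`. -/
theorem exists_isQuad_sq_le_integral (d : ℕ) (R : ℝ) : ∃ C : ℝ, 0 < C ∧ ∀ f : E d → ℝ, IsQuad f →
    ∀ x ∈ Metric.closedBall (0 : E d) R, f x ^ 2 ≤ C * ∫ y in Metric.ball 0 1, f y ^ 2 := by
  obtain ⟨K, hK, hG⟩ := exists_norm_le_of_finiteDimensional (quadToLp d)
  set B := K * (1 + |R| + |R| ^ 2) with hB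
  refine ⟨B ^ 2 + 1, by positivity, ?_⟩
  rintro f ⟨c, g, A, h⟩ x hx
  obtain ⟨⟨c', g', A'⟩, h', hnorm⟩ := hG (c, g, A)
  have hf' : f x = c' + ⟪g', x⟫_ℝ + ⟪A' x, x⟫_ℝ := by
    rw [h]; exact eq_of_quadToLp_eq h'.symm x
  have hysq := norm_sq_quadToLp (c, g, A)
  simp only [← h] at hysq
  generalize ‖quadToLp d (c, g, A)‖ = Y at hysq hnorm
  have hc' : |c'| ≤ K * Y := (norm_fst_le (c', g', A')).trans hnorm
  have hg' : ‖g'‖ ≤ K * Y :=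
    ((norm_fst_le (g', A')).trans (norm_snd_le (c', g', A'))).trans hnorm
  have hA' : ‖A'‖ ≤ K * Y :=
    ((norm_snd_le (g', A')).trans (norm_snd_le (c', g', A'))).trans hnorm
  have hxR : ‖x‖ ≤ |R| := (mem_closedBall_zero_iff.1 hx).trans (le_abs_self R)
  have hKY : 0 ≤ K * Y := (abs_nonneg _).trans hc'
  have hfx : |f x| ≤ B * Y := by
    have e1 : |⟪g', x⟫_ℝ| ≤ K * Y * |R| :=
      (abs_real_inner_le_norm _ _).trans (by gcongr)
    have e2 : |⟪A' x, x⟫_ℝ| ≤ K * Y * |R| * |R| :=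
      (abs_real_inner_le_norm _ _).trans (by
        gcongr
        exact (A'.le_opNorm x).trans (by gcongr))
    rw [hf']
    refine (abs_add_three _ _ _).trans ?_
    rw [hB]
    nlinarith
  have : f x ^ 2 ≤ (B * Y) ^ 2 := sq_le_sq' (by linarith [neg_abs_le (f x)])
    ((le_abs_self _).trans hfx)
  rw [← hysq]
  nlinarith [sq_nonneg Y]

theorem integral_ball_dilation (f : E d → ℝ) (c : E d) {r : ℝ} (hr : 0 < r) :
    ∫ y in Metric.ball (0 : E d) 1, f (c + r • y) = (r ^ d)⁻¹ * ∫ y in Metric.ball c r, f y := by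
  have h1 := Measure.setIntegral_comp_smul_of_pos (volume : Measure (E d))
    (fun y => f (c + y)) (Metric.ball 0 1) hr
  rw [finrank_euclideanSpace_fin, smul_unitBall_of_pos hr] at h1
  rw [h1, smul_eq_mul]
  congr 1
  have h2 := (measurePreserving_add_left (volume : Measure (E d)) c).setIntegral_preimage_emb
    (measurableEmbedding_addLeft c) f (Metric.ball c r)
  rw [← h2]
  congr 2
  ext x
  simp

/-- The constant does not depend on `c` and `r`, by dilation. The factor `R` lets a small ball
control a polynomial on a whole element and beyond. -/
theorem exists_isQuad_sq_le_integral_ball (d : ℕ) (R : ℝ) : ∃ C : ℝ, 0 < C ∧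
    ∀ f : E d → ℝ, IsQuad f → ∀ (c : E d) (r : ℝ), 0 < r →
    ∀ x ∈ Metric.closedBall c (R * r),
      r ^ d * f x ^ 2 ≤ C * ∫ y in Metric.ball c r, f y ^ 2 := by
  obtain ⟨C, hC, h⟩ := exists_isQuad_sq_le_integral d R
  refine ⟨C, hC, fun f hf c r hr x hx => ?_⟩
  have h1 := h _ (hf.comp_dilation c r) (r⁻¹ • (x - c)) (by
    rw [mem_closedBall_zero_iff, norm_smul, norm_inv, Real.norm_of_nonneg hr.le,
      inv_mul_le_iff₀ hr, mul_comm]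
    simpa [dist_eq_norm] using hx)
  rw [smul_inv_smul₀ hr.ne', add_sub_cancel,
    integral_ball_dilation (fun y => f y ^ 2) c hr] at h1
  have hrd : 0 < r ^ d := by positivity
  calc r ^ d * f x ^ 2 ≤ r ^ d * (C * ((r ^ d)⁻¹ * ∫ y in Metric.ball c r, f y ^ 2)) := by gcongr
    _ = C * ∫ y in Metric.ball c r, f y ^ 2 := by field_simp

end NormEquivalence

/-! ### Directional derivatives -/

/-- The derivative of `f` in the direction `v`. -/
noncomputable def dirDeriv {d : ℕ} (v : E d) (f : E d → ℝ) (x : E d) : ℝ := fderiv ℝ f x v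

/-- The `k`-th standard basis vector. -/
noncomputable abbrev stdVec {d : ℕ} (k : Fin d) : E d := EuclideanSpace.single k 1

/-- The Laplacian in coordinates. -/
noncomputable def coordLaplacian {d : ℕ} (f : E d → ℝ) (x : E d) : ℝ :=
  ∑ k, dirDeriv (stdVec k) (dirDeriv (stdVec k) f) x

section DirDeriv

variable {d : ℕ} {f g : E d → ℝ}

theorem ContDiff.dirDeriv (hf : ContDiff ℝ ∞ f) (v : E d) : ContDiff ℝ ∞ (dirDeriv v f) :=
  (hf.fderiv_right (m := ∞) (by norm_cast)).clm_apply contDiff_const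

theorem dirDeriv_mul (hf : ContDiff ℝ ∞ f) (hg : ContDiff ℝ ∞ g) (v : E d) :
    dirDeriv v (fun x => f x * g x) = fun x => dirDeriv v f x * g x + f x * dirDeriv v g x := by
  ext x
  have hf' := hf.differentiable (by simp) x
  have hg' := hg.differentiable (by simp) x
  simp only [dirDeriv, fderiv_fun_mul hf' hg', _root_.add_apply, _root_.smul_apply, smul_eq_mul]
  ring

theorem dirDeriv_add (hf : ContDiff ℝ ∞ f) (hg : ContDiff ℝ ∞ g) (v : E d) :
    dirDeriv v (fun x => f x + g x) = fun x => dirDeriv v f x + dirDeriv v g x := by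
  ext x
  have hf' := hf.differentiable (by simp) x
  have hg' := hg.differentiable (by simp) x
  simp only [dirDeriv, fderiv_fun_add hf' hg', _root_.add_apply]

theorem dirDeriv_dilation (hf : ContDiff ℝ ∞ f) (c : E d) (r : ℝ) (v : E d) :
    dirDeriv v (fun x => f (r⁻¹ • (x - c))) = fun x => r⁻¹ * dirDeriv v f (r⁻¹ • (x - c)) := by
  ext x
  have h1 : HasFDerivAt (fun x : E d => r⁻¹ • (x - c)) (r⁻¹ • ContinuousLinearMap.id ℝ (E d)) x :=
    HasFDerivAt.fun_const_smul ((hasFDerivAt_id x).sub_const c) _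
  have h2 := ((hf.differentiable (by simp) (r⁻¹ • (x - c))).hasFDerivAt).comp x h1
  simp only [dirDeriv]
  rw [show (fun x => f (r⁻¹ • (x - c))) = f ∘ (fun x : E d => r⁻¹ • (x - c)) from rfl, h2.fderiv]
  simp

theorem dirDeriv_const_mul (a : ℝ) (v : E d) :
    dirDeriv v (fun x => a * f x) = fun x => a * dirDeriv v f x := by
  ext x
  simp only [dirDeriv]
  rw [show (fun x => a * f x) = a • f from rfl, fderiv_const_smul_field]
  simp

theorem dirDeriv_smul (a : ℝ) (v : E d) (x : E d) :
    dirDeriv (a • v) f x = a * dirDeriv v f x := by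
  simp [dirDeriv]

theorem dirDeriv_eq_sum (v : E d) (x : E d) :
    dirDeriv v f x = ∑ k, v k * dirDeriv (stdVec k) f x := by
  simp only [dirDeriv]
  conv_lhs => rw [← (EuclideanSpace.basisFun (Fin d) ℝ).sum_repr v]
  simp [map_sum]

theorem tsupport_dirDeriv_subset (v : E d) : tsupport (dirDeriv v f) ⊆ tsupport f :=
  tsupport_fderiv_apply_subset ℝ v

theorem HasCompactSupport.dirDeriv (hf : HasCompactSupport f) (v : E d) :
    HasCompactSupport (dirDeriv v f) := hf.fderiv_apply ℝ v

theorem dirDeriv_eq_zero {v x : E d} (hx : x ∉ tsupport f) : dirDeriv v f x = 0 :=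
  image_eq_zero_of_notMem_tsupport fun h => hx (tsupport_dirDeriv_subset v h)

theorem ContDiff.coordLaplacian (hf : ContDiff ℝ ∞ f) : ContDiff ℝ ∞ (coordLaplacian f) :=
  ContDiff.sum fun _ _ => ContDiff.dirDeriv (ContDiff.dirDeriv hf _) _

theorem coordLaplacian_eq_zero {x : E d} (hx : x ∉ tsupport f) : coordLaplacian f x = 0 :=
  Finset.sum_eq_zero fun _ _ => dirDeriv_eq_zero fun h => hx (tsupport_dirDeriv_subset _ h)

end DirDeriv

/-! ### A radial bump function -/

/-- A smooth radially decreasing function supported in the unit ball. -/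
noncomputable def bump (d : ℕ) (x : E d) : ℝ := expNegInvGlue (3 / 4 - ‖x‖ ^ 2)

section Bump

variable {d : ℕ}

theorem contDiff_bump : ContDiff ℝ ∞ (bump d) :=
  expNegInvGlue.contDiff.comp (contDiff_const.sub (contDiff_norm_sq ℝ))

theorem bump_nonneg (x : E d) : 0 ≤ bump d x := expNegInvGlue.nonneg _

theorem support_bump_subset : Function.support (bump d) ⊆ Metric.closedBall 0 (9 / 10) := by
  intro x hx
  rw [mem_closedBall_zero_iff]
  by_contra! h
  -- `(9 / 10)² = 0.81` exceeds `3 / 4`.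
  exact hx (expNegInvGlue.zero_of_nonpos (by nlinarith))

theorem hasCompactSupport_bump : HasCompactSupport (bump d) :=
  HasCompactSupport.of_support_subset_isCompact (isCompact_closedBall _ _) support_bump_subset

theorem exists_le_bump : ∃ b₀ : ℝ, 0 < b₀ ∧ ∀ d, ∀ x ∈ Metric.ball (0 : E d) (1 / 2),
    b₀ ≤ bump d x := by
  refine ⟨expNegInvGlue (1 / 2), expNegInvGlue.pos_of_pos (by norm_num), fun d x hx => ?_⟩
  rw [mem_ball_zero_iff] at hx
  exact expNegInvGlue.monotone (by nlinarith [norm_nonneg x])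

/-- Chain rule with `g' = s⁻² g` for `g(s) = exp(-1 / s)`. The formula displays the sign of the
derivative in directions that point outwards. -/
theorem dirDeriv_bump (v x : E d) : dirDeriv v (bump d) x =
    -(2 * ((3 / 4 - ‖x‖ ^ 2)⁻¹ ^ 2 * expNegInvGlue (3 / 4 - ‖x‖ ^ 2)) * ⟪x, v⟫_ℝ) := by
  have h1 := expNegInvGlue.hasDerivAt_polynomial_eval_inv_mul 1 (3 / 4 - ‖x‖ ^ 2)
  simp only [Polynomial.eval_one, one_mul, Polynomial.derivative_one, sub_zero, mul_one,
    Polynomial.eval_pow, Polynomial.eval_X] at h1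
  have h2 : HasFDerivAt (fun x : E d => 3 / 4 - ‖x‖ ^ 2) (-(2 • innerSL ℝ x)) x :=
    ((hasStrictFDerivAt_norm_sq x).hasFDerivAt).const_sub _
  have h3 := h1.comp_hasFDerivAt x h2
  simp only [dirDeriv]
  rw [show bump d = expNegInvGlue ∘ (fun x => 3 / 4 - ‖x‖ ^ 2) from rfl, h3.fderiv]
  simp
  ring

theorem dirDeriv_bump_nonpos {v x : E d} (h : 0 ≤ ⟪x, v⟫_ℝ) : dirDeriv v (bump d) x ≤ 0 := by
  rw [dirDeriv_bump, neg_nonpos]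
  have := expNegInvGlue.nonneg (3 / 4 - ‖x‖ ^ 2)
  positivity

/-- Provides a ball strictly inside the half space with normal `n` on which the bump decreases along
`n` at a definite rate, uniformly in `n`. -/
theorem exists_le_neg_dirDeriv_bump : ∃ b₁ : ℝ, 0 < b₁ ∧ ∀ d, ∀ n : E d, ‖n‖ = 1 →
    ∀ x ∈ Metric.ball ((1 / 2 : ℝ) • n) (1 / 8), 0 < ⟪x, n⟫_ℝ ∧ b₁ ≤ -dirDeriv n (bump d) x := by
  have hp := expNegInvGlue.pos_of_pos (show (0 : ℝ) < 23 / 64 by norm_num)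
  -- On this ball `‖x‖ ≤ 5 / 8` and `⟪x, n⟫ ≥ 3 / 8`; hence `3 / 4 - ‖x‖² ≥ 23 / 64`, and the
  -- prefactor is `2 * 1 * (3 / 8)`.
  refine ⟨3 / 4 * expNegInvGlue (23 / 64), by positivity, fun d n hn x hx => ?_⟩
  rw [mem_ball_iff_norm] at hx
  have h1 : ‖x‖ ≤ 5 / 8 := by
    have := norm_add_le (x - (1 / 2 : ℝ) • n) ((1 / 2 : ℝ) • n)
    rw [sub_add_cancel, norm_smul, hn] at this
    norm_num at this; linarith
  have h2 : 3 / 8 ≤ ⟪x, n⟫_ℝ := by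
    have e : ⟪x, n⟫_ℝ = ⟪x - (1 / 2 : ℝ) • n, n⟫_ℝ + 1 / 2 := by
      rw [inner_sub_left, inner_smul_left, real_inner_self_eq_norm_sq, hn]; simp
    have := abs_real_inner_le_norm (x - (1 / 2 : ℝ) • n) n
    rw [hn, mul_one] at this
    have := neg_abs_le ⟪x - (1 / 2 : ℝ) • n, n⟫_ℝ
    linarith
  refine ⟨by linarith, ?_⟩
  rw [dirDeriv_bump, neg_neg]
  have hs : 23 / 64 ≤ 3 / 4 - ‖x‖ ^ 2 := by nlinarith [norm_nonneg x]
  have hs' : 1 ≤ (3 / 4 - ‖x‖ ^ 2)⁻¹ ^ 2 :=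
    one_le_pow₀ ((one_le_inv₀ (by linarith)).2 (by nlinarith [norm_nonneg x]))
  have hg := expNegInvGlue.monotone hs
  calc 3 / 4 * expNegInvGlue (23 / 64)
      = 2 * (1 * expNegInvGlue (23 / 64)) * (3 / 8) := by ring
    _ ≤ _ := by
      have := hp.le.trans hg
      gcongr

theorem HasCompactSupport.exists_abs_le {f : E d → ℝ} (h : HasCompactSupport f)
    (hc : Continuous f) : ∃ K, ∀ x, |f x| ≤ K := hc.bounded_above_of_compact_support h

theorem exists_bump_bounds (d : ℕ) : ∃ K : ℝ, 0 < K ∧ ∀ x : E d, |bump d x| ≤ K ∧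
    (∀ k, |dirDeriv (stdVec k) (bump d) x| ≤ K) ∧
    ∀ k, |dirDeriv (stdVec k) (dirDeriv (stdVec k) (bump d)) x| ≤ K := by
  obtain ⟨K₀, h₀⟩ := HasCompactSupport.exists_abs_le (hasCompactSupport_bump (d := d))
    contDiff_bump.continuous
  have h1 := fun k => HasCompactSupport.exists_abs_le
    (HasCompactSupport.dirDeriv (hasCompactSupport_bump (d := d)) (stdVec k))
    (ContDiff.dirDeriv contDiff_bump _).continuous
  have h2 := fun k => HasCompactSupport.exists_abs_le
    (HasCompactSupport.dirDeriv (HasCompactSupport.dirDeriv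
      (hasCompactSupport_bump (d := d)) (stdVec k)) (stdVec k))
    (ContDiff.dirDeriv (ContDiff.dirDeriv contDiff_bump _) _).continuous
  choose K₁ h1 using h1
  choose K₂ h2 using h2
  have n1 : ∀ k, 0 ≤ K₁ k := fun k => (abs_nonneg _).trans (h1 k 0)
  have n2 : ∀ k, 0 ≤ K₂ k := fun k => (abs_nonneg _).trans (h2 k 0)
  have n0 : 0 ≤ K₀ := (abs_nonneg _).trans (h₀ 0)
  have s1 : ∀ k, K₁ k ≤ ∑ k, K₁ k := fun k =>
    Finset.single_le_sum (fun k _ => n1 k) (Finset.mem_univ k)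
  have s2 : ∀ k, K₂ k ≤ ∑ k, K₂ k := fun k =>
    Finset.single_le_sum (fun k _ => n2 k) (Finset.mem_univ k)
  have t1 : 0 ≤ ∑ k, K₁ k := Finset.sum_nonneg fun k _ => n1 k
  have t2 : 0 ≤ ∑ k, K₂ k := Finset.sum_nonneg fun k _ => n2 k
  refine ⟨K₀ + ∑ k, K₁ k + ∑ k, K₂ k + 1, by positivity, fun x => ⟨?_, fun k => ?_, fun k => ?_⟩⟩
  · linarith [show |bump d x| ≤ K₀ from h₀ x]
  · linarith [show _ ≤ K₁ k from h1 k x, s1 k]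
  · linarith [show _ ≤ K₂ k from h2 k x, s2 k]

/-- The bump function on the ball of radius `r` about `c`, times `f`. -/
noncomputable def bumpMul (c : E d) (r : ℝ) (f : E d → ℝ) (x : E d) : ℝ :=
  bump d (r⁻¹ • (x - c)) * f x

theorem contDiff_bump_dilation (c : E d) (r : ℝ) :
    ContDiff ℝ ∞ (fun x => bump d (r⁻¹ • (x - c))) :=
  contDiff_bump.comp (f := fun x : E d => r⁻¹ • (x - c)) (by fun_prop)

theorem contDiff_bumpMul (c : E d) (r : ℝ) {f : E d → ℝ} (hf : IsQuad f) :
    ContDiff ℝ ∞ (bumpMul c r f) := (contDiff_bump_dilation c r).mul hf.contDiff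

theorem tsupport_bumpMul_subset (c : E d) {r : ℝ} (hr : 0 < r) (f : E d → ℝ) :
    tsupport (bumpMul c r f) ⊆ Metric.ball c r := by
  refine (closure_minimal (t := Metric.closedBall c (9 / 10 * r)) ?_
    Metric.isClosed_closedBall).trans (Metric.closedBall_subset_ball (by linarith))
  intro x hx
  have := support_bump_subset (left_ne_zero_of_mul hx)
  rwa [mem_closedBall_zero_iff, norm_smul, norm_inv, Real.norm_of_nonneg hr.le,
    inv_mul_le_iff₀ hr, mul_comm, ← mem_closedBall_iff_norm] at this

theorem IsQuad.abs_dirDeriv_le {f : E d → ℝ} (hf : IsQuad f) {x : E d} {r M : ℝ} (hr : 0 < r)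
    (h : ∀ y ∈ Metric.closedBall x r, |f y| ≤ M) (k : Fin d) :
    |dirDeriv (stdVec k) f x| ≤ M / r ∧
      |dirDeriv (stdVec k) (dirDeriv (stdVec k) f) x| ≤ 4 * M / r ^ 2 := by
  have m0 := h x (Metric.mem_closedBall_self hr.le)
  have m1 := h (x + r • stdVec k) (by simp [norm_smul, abs_of_pos hr])
  have m2 := h (x - r • stdVec k) (by simp [norm_smul, abs_of_pos hr])
  rw [abs_le] at m0 m1 m2
  have h1 := hf.fderiv_apply x (r • stdVec k)
  have h2 := hf.fderiv_fderiv x (r • stdVec k)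
  have h1' : dirDeriv (stdVec k) f x * r = (f (x + r • stdVec k) - f (x - r • stdVec k)) / 2 := by
    rw [← h1, mul_comm]; exact (dirDeriv_smul r (stdVec k) x).symm
  have h2' : dirDeriv (stdVec k) (dirDeriv (stdVec k) f) x * r ^ 2 =
      f (x + r • stdVec k) + f (x - r • stdVec k) - 2 * f x := by
    rw [← h2]
    have e : (fun x => fderiv ℝ f x (r • stdVec k)) = fun x => r * dirDeriv (stdVec k) f x := by
      ext y; exact dirDeriv_smul r (stdVec k) y
    rw [e]
    have e2 : dirDeriv (r • stdVec k) (fun x => r * dirDeriv (stdVec k) f x) x =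
      r * (r * dirDeriv (stdVec k) (dirDeriv (stdVec k) f) x) := by
      rw [dirDeriv_smul, dirDeriv_const_mul]
    exact Eq.trans (by ring) e2.symm
  constructor
  · rw [le_div_iff₀ hr, ← abs_of_pos hr, ← abs_mul, h1', abs_le]
    constructor <;> linarith
  · have hr2 : 0 < r ^ 2 := by positivity
    rw [le_div_iff₀ hr2, ← abs_of_pos hr2, ← abs_mul, h2', abs_le]
    constructor <;> linarith

/-- Makes the bump times a quadratic function admissible in `TestBound` with amplitude `K * M`.
Values on the doubled ball are needed since derivatives at points of the ball are differences with
step `r`. -/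
theorem exists_bumpMul_bounds (d : ℕ) : ∃ K : ℝ, 0 < K ∧ ∀ f : E d → ℝ, IsQuad f →
    ∀ (c : E d) (r M : ℝ), 0 < r → (∀ x ∈ Metric.closedBall c (2 * r), |f x| ≤ M) → ∀ x,
      |bumpMul c r f x| ≤ K * M ∧ (∀ k, |dirDeriv (stdVec k) (bumpMul c r f) x| ≤ K * M / r) ∧
      ∀ k, |dirDeriv (stdVec k) (dirDeriv (stdVec k) (bumpMul c r f)) x| ≤ K * M / r ^ 2 := by
  obtain ⟨K, hK, hb⟩ := exists_bump_bounds d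
  -- The second derivative of the product costs most: `1 + 1 + 1 + 4 = 7`, the `4` coming from the
  -- second difference of `f`.
  refine ⟨7 * K, by positivity, fun f hf c r M hr hM x => ?_⟩
  have hM0 : 0 ≤ M := (abs_nonneg _).trans (hM c (Metric.mem_closedBall_self (by linarith)))
  by_cases hx : x ∈ Metric.ball c r
  swap
  · have hx' : x ∉ tsupport (bumpMul c r f) := fun h => hx (tsupport_bumpMul_subset c hr f h)
    refine ⟨?_, fun k => ?_, fun k => ?_⟩
    · rw [image_eq_zero_of_notMem_tsupport hx', abs_zero]; positivity
    · rw [dirDeriv_eq_zero hx', abs_zero]; positivity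
    · rw [dirDeriv_eq_zero fun h => hx' (tsupport_dirDeriv_subset _ h), abs_zero]; positivity
  have hMx : ∀ y ∈ Metric.closedBall x r, |f y| ≤ M := fun y hy => hM y (by
    rw [Metric.mem_closedBall] at hy ⊢
    rw [Metric.mem_ball] at hx
    linarith [dist_triangle y x c])
  obtain ⟨b0, b1, b2⟩ := hb (r⁻¹ • (x - c))
  have f0 := hMx x (Metric.mem_closedBall_self hr.le)
  refine ⟨?_, fun k => ?_, fun k => ?_⟩
  · rw [bumpMul, abs_mul]
    calc _ ≤ K * M := by gcongr
      _ ≤ 7 * K * M := by nlinarith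
  · obtain ⟨f1, -⟩ := hf.abs_dirDeriv_le hr hMx k
    have e : dirDeriv (stdVec k) (bumpMul c r f) = _ :=
      dirDeriv_mul (contDiff_bump_dilation c r) hf.contDiff (stdVec k)
    rw [e, dirDeriv_dilation contDiff_bump]
    refine (abs_add_le _ _).trans ?_
    rw [abs_mul, abs_mul, abs_mul, abs_of_pos (inv_pos.2 hr)]
    calc _ ≤ r⁻¹ * K * M + K * (M / r) := by gcongr; exact b1 k
      _ = 2 * (K * M / r) := by field_simp; ring
      _ ≤ 7 * (K * M / r) := by gcongr; norm_num
      _ = _ := by ring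
  · obtain ⟨f1, f2⟩ := hf.abs_dirDeriv_le hr hMx k
    have e : dirDeriv (stdVec k) (bumpMul c r f) = _ :=
      dirDeriv_mul (contDiff_bump_dilation c r) hf.contDiff (stdVec k)
    have hβ' := ContDiff.dirDeriv (contDiff_bump_dilation (d := d) c r) (stdVec k)
    have hf' := ContDiff.dirDeriv (hf.contDiff (n := ∞)) (stdVec k)
    rw [e, dirDeriv_add (hβ'.mul hf.contDiff) ((contDiff_bump_dilation c r).mul hf'),
      dirDeriv_mul hβ' hf.contDiff, dirDeriv_mul (contDiff_bump_dilation c r) hf',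
      dirDeriv_dilation contDiff_bump, dirDeriv_const_mul,
      dirDeriv_dilation (ContDiff.dirDeriv contDiff_bump _)]
    refine (abs_add_le _ _).trans ((add_le_add (abs_add_le _ _) (abs_add_le _ _)).trans ?_)
    simp only [abs_mul, abs_of_pos (inv_pos.2 hr)]
    calc _ ≤ r⁻¹ * (r⁻¹ * K) * M + r⁻¹ * K * (M / r) + (r⁻¹ * K * (M / r) + K * (4 * M / r ^ 2)) := by
          gcongr
          · exact b2 k
          · exact b1 k
          · exact b1 k
      _ = 7 * K * M / r ^ 2 := by field_simp; ring

end Bump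

/-! ### Functionals on test functions -/

/-- The functional `ℒ` on the test functions of the ball of radius `r` about `c` is bounded by
`G`, in a scaling that is adapted to residuals. -/
def TestBound {d : ℕ} (c : E d) (r G : ℝ) (ℒ : (E d → ℝ) → ℝ) : Prop :=
  ∀ (φ : E d → ℝ) (M : ℝ), ContDiff ℝ ∞ φ → tsupport φ ⊆ Metric.ball c r →
    (∀ x, |φ x| ≤ M) → (∀ x k, |dirDeriv (stdVec k) φ x| ≤ M / r) →
    (∀ x k, |dirDeriv (stdVec k) (dirDeriv (stdVec k) φ) x| ≤ M / r ^ 2) →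
    ℒ φ ^ 2 ≤ M ^ 2 * r ^ (d - 2) * G

section TestBound

variable {d : ℕ}

theorem hasCompactSupport_of_tsupport_subset_ball {φ : E d → ℝ} {c : E d} {r : ℝ}
    (h : tsupport φ ⊆ Metric.ball c r) : HasCompactSupport φ :=
  HasCompactSupport.of_support_subset_isCompact (isCompact_closedBall c r)
    ((subset_tsupport φ).trans (h.trans Metric.ball_subset_closedBall))

theorem TestBound.apply_bumpMul {c : E d} {r G K M : ℝ} {ℒ : (E d → ℝ) → ℝ}
    (h : TestBound c r G ℒ) (hr : 0 < r) {f : E d → ℝ} (hf : IsQuad f)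
    (hK : ∀ x, |bumpMul c r f x| ≤ K * M ∧
      (∀ k, |dirDeriv (stdVec k) (bumpMul c r f) x| ≤ K * M / r) ∧
      ∀ k, |dirDeriv (stdVec k) (dirDeriv (stdVec k) (bumpMul c r f)) x| ≤ K * M / r ^ 2) :
    ℒ (bumpMul c r f) ^ 2 ≤ (K * M) ^ 2 * r ^ (d - 2) * G :=
  h _ _ (contDiff_bumpMul c r hf) (tsupport_bumpMul_subset c hr f) (fun x => (hK x).1)
    (fun x => (hK x).2.1) (fun x => (hK x).2.2)

/-- Testing with the bump times `f` gives `∫ f²` from below, up to constants, and an amplitude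
comparable to the `L²` norm of `f` from above. -/
theorem exists_residual_bound (hd : 2 ≤ d) (R : ℝ) : ∃ C : ℝ, 0 < C ∧
    ∀ (f : E d → ℝ) (c : E d) (r G : ℝ) (ℒ : (E d → ℝ) → ℝ), IsQuad f → 0 < r → 0 ≤ G →
      TestBound c r G ℒ →
      (∀ φ, ContDiff ℝ ∞ φ → tsupport φ ⊆ Metric.ball c r → ℒ φ = ∫ x, f x * φ x) →
      ∀ x ∈ Metric.closedBall c (R * r), r ^ (d + 2) * f x ^ 2 ≤ C * G := by
  -- The reference ball has radius `r / 2`, whence the factor `2`; the maximum with `2` covers the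
  -- doubled ball that `exists_bumpMul_bounds` requires.
  obtain ⟨C₁, hC₁, hN⟩ := exists_isQuad_sq_le_integral_ball d (2 * max R 2)
  obtain ⟨K, hK, hb⟩ := exists_bumpMul_bounds d
  obtain ⟨b₀, hb₀, hbb⟩ := exists_le_bump
  refine ⟨2 ^ d * C₁ * (K ^ 2 * C₁ * 2 ^ d / b₀ ^ 2), by positivity, ?_⟩
  intro f c r G ℒ hf hr hG hℒ hrep x hx
  set I := ∫ y in Metric.ball c (r / 2), f y ^ 2 with hI
  have hI0 : 0 ≤ I := integral_nonneg fun y => sq_nonneg _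
  have hN' : ∀ x ∈ Metric.closedBall c (max R 2 * r), (r / 2) ^ d * f x ^ 2 ≤ C₁ * I :=
    fun x hx => hN f hf c (r / 2) (by positivity) x (by convert hx using 2; ring)
  have hrd : 0 < (r / 2) ^ d := by positivity
  set M := √(C₁ * I / (r / 2) ^ d) with hM
  have hM2 : M ^ 2 = C₁ * I / (r / 2) ^ d := Real.sq_sqrt (by positivity)
  have hfM : ∀ x ∈ Metric.closedBall c (2 * r), |f x| ≤ M := fun x hx => by
    refine Real.abs_le_sqrt ?_
    rw [le_div_iff₀ hrd, mul_comm]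
    exact hN' x (Metric.closedBall_subset_closedBall (by gcongr; exact le_max_right _ _) hx)
  have h1 := hℒ.apply_bumpMul hr hf (hb f hf c r M hr hfM)
  rw [hrep _ (contDiff_bumpMul c r hf) (tsupport_bumpMul_subset c hr f)] at h1
  have hcont : Continuous (fun x => f x * bumpMul c r f x) :=
    hf.continuous.mul (contDiff_bumpMul c r hf).continuous
  have hint : Integrable (fun x => f x * bumpMul c r f x) :=
    hcont.integrable_of_hasCompactSupport
      (hasCompactSupport_of_tsupport_subset_ball (tsupport_bumpMul_subset c hr f)).mul_left
  have h2 : b₀ * I ≤ ∫ x, f x * bumpMul c r f x := by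
    calc b₀ * I = ∫ x in Metric.ball c (r / 2), b₀ * f x ^ 2 := (integral_const_mul _ _).symm
      _ ≤ ∫ x in Metric.ball c (r / 2), f x * bumpMul c r f x := by
        refine setIntegral_mono_on ?_ hint.integrableOn Metric.isOpen_ball.measurableSet ?_
        · exact (((continuous_const.mul (hf.continuous.pow 2)).continuousOn).integrableOn_compact
            (isCompact_closedBall c (r / 2))).mono_set Metric.ball_subset_closedBall
        · intro y hy
          have : b₀ ≤ bump d (r⁻¹ • (y - c)) := hbb d _ (by
            rw [mem_ball_zero_iff, norm_smul, norm_inv, Real.norm_of_nonneg hr.le,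
              inv_mul_lt_iff₀ hr]
            linarith [mem_ball_iff_norm.1 hy])
          rw [bumpMul]
          nlinarith [mul_le_mul_of_nonneg_right this (sq_nonneg (f y))]
      _ ≤ ∫ x, f x * bumpMul c r f x := by
        refine setIntegral_le_integral hint (ae_of_all _ fun y => ?_)
        have := bump_nonneg (r⁻¹ • (y - c))
        simp only [bumpMul, Pi.zero_apply]
        nlinarith [mul_nonneg this (sq_nonneg (f y))]
  have h3 : (b₀ * I) ^ 2 ≤ (K * M) ^ 2 * r ^ (d - 2) * G :=
    (pow_le_pow_left₀ (by positivity) h2 2).trans h1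
  have hrd2 : r ^ d = r ^ (d - 2) * r ^ 2 := by rw [← pow_add]; congr 1; omega
  -- As `M²` is proportional to `I / r ^ d`, `h3` is quadratic in `I` on the left and linear on the
  -- right, so one factor `I` cancels; `I = 0` is separate.
  have h4 : r ^ 2 * I ≤ K ^ 2 * C₁ * 2 ^ d / b₀ ^ 2 * G := by
    rcases hI0.eq_or_lt with h0 | h0
    · rw [← h0, mul_zero]; positivity
    · rw [mul_pow, mul_pow, hM2, div_pow, hrd2] at h3
      have h5 : K ^ 2 * (C₁ * I / (r ^ (d - 2) * r ^ 2 / 2 ^ d)) * r ^ (d - 2) * G =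
        I * (K ^ 2 * C₁ * 2 ^ d * G / r ^ 2) := by field_simp
      rw [h5] at h3
      have h6 : b₀ ^ 2 * I ≤ K ^ 2 * C₁ * 2 ^ d * G / r ^ 2 :=
        le_of_mul_le_mul_left (by linarith [h3, show b₀ ^ 2 * I ^ 2 = I * (b₀ ^ 2 * I) by ring]) h0
      rw [le_div_iff₀ (by positivity)] at h6
      rw [div_mul_eq_mul_div, le_div_iff₀ (by positivity)]
      linarith
  have h7 := hN' x (Metric.closedBall_subset_closedBall (by gcongr; exact le_max_left _ _) hx)
  calc r ^ (d + 2) * f x ^ 2 = 2 ^ d * r ^ 2 * ((r / 2) ^ d * f x ^ 2) := by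
        rw [div_pow, pow_add]; field_simp
    _ ≤ 2 ^ d * r ^ 2 * (C₁ * I) := by gcongr
    _ = 2 ^ d * C₁ * (r ^ 2 * I) := by ring
    _ ≤ 2 ^ d * C₁ * (K ^ 2 * C₁ * 2 ^ d / b₀ ^ 2 * G) := by gcongr
    _ = _ := by ring

/-- Formally the functional is the integral of `m φ` over the hyperplane. In the volume form, `φ =
bump * m` yields `m²` times the negative normal derivative of the bump, which is nonnegative in the
half space and bounded below on a ball inside it. -/
theorem exists_jump_bound (hd : 2 ≤ d) (R : ℝ) : ∃ C : ℝ, 0 < C ∧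
    ∀ (m : E d → ℝ) (n c : E d) (r G : ℝ) (ℒ : (E d → ℝ) → ℝ), IsAff m → ‖n‖ = 1 →
      (∀ x, dirDeriv n m x = 0) → 0 < r → 0 ≤ G → TestBound c r G ℒ →
      (∀ φ, ContDiff ℝ ∞ φ → tsupport φ ⊆ Metric.ball c r →
        ℒ φ = -∫ x in {x | 0 < ⟪n, x - c⟫_ℝ}, m x * dirDeriv n φ x) →
      ∀ x ∈ Metric.closedBall c (R * r), r ^ d * m x ^ 2 ≤ C * G := by
  -- The reference ball has radius `r / 8` and a center at distance `r / 2` from `c`.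
  obtain ⟨C₁, hC₁, hN⟩ := exists_isQuad_sq_le_integral_ball d (8 * (max R 2 + 1 / 2))
  obtain ⟨K, hK, hb⟩ := exists_bumpMul_bounds d
  obtain ⟨b₁, hb₁, hbb⟩ := exists_le_neg_dirDeriv_bump
  refine ⟨8 ^ d * C₁ * (K ^ 2 * C₁ * 8 ^ d / b₁ ^ 2), by positivity, ?_⟩
  intro m n c r G ℒ hm hn hmn hr hG hℒ hrep x hx
  set c' := c + (r / 2) • n with hc'
  set I := ∫ y in Metric.ball c' (r / 8), m y ^ 2 with hI
  have hI0 : 0 ≤ I := integral_nonneg fun y => sq_nonneg _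
  have hcc' : dist c c' = r / 2 := by
    rw [hc', dist_self_add_right, norm_smul, hn, mul_one, Real.norm_of_nonneg (by positivity)]
  have hN' : ∀ x ∈ Metric.closedBall c (max R 2 * r), (r / 8) ^ d * m x ^ 2 ≤ C₁ * I :=
    fun x hx => hN m hm.isQuad c' (r / 8) (by positivity) x (by
      rw [Metric.mem_closedBall] at hx ⊢
      have := dist_triangle x c c'
      linarith)
  have hrd : 0 < (r / 8) ^ d := by positivity
  set M := √(C₁ * I / (r / 8) ^ d) with hM
  have hM2 : M ^ 2 = C₁ * I / (r / 8) ^ d := Real.sq_sqrt (by positivity)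
  have hfM : ∀ x ∈ Metric.closedBall c (2 * r), |m x| ≤ M := fun x hx => by
    refine Real.abs_le_sqrt ?_
    rw [le_div_iff₀ hrd, mul_comm]
    exact hN' x (Metric.closedBall_subset_closedBall (by gcongr; exact le_max_right _ _) hx)
  have h1 := hℒ.apply_bumpMul hr hm.isQuad (hb m hm.isQuad c r M hr hfM)
  rw [hrep _ (contDiff_bumpMul c r hm.isQuad) (tsupport_bumpMul_subset c hr m),
    ← integral_neg] at h1
  have hcont : Continuous (fun x => -(m x * dirDeriv n (bumpMul c r m) x)) :=
    (hm.isQuad.continuous.mul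
      (ContDiff.dirDeriv (contDiff_bumpMul c r hm.isQuad) n).continuous).neg
  have hint : Integrable (fun x => -(m x * dirDeriv n (bumpMul c r m) x)) := by
    refine hcont.integrable_of_hasCompactSupport (HasCompactSupport.neg ?_)
    exact (HasCompactSupport.dirDeriv (hasCompactSupport_of_tsupport_subset_ball
      (tsupport_bumpMul_subset c hr m)) n).mul_left
  -- As `m` is constant along `n`, only the bump is differentiated.
  have hderiv : ∀ x, -(m x * dirDeriv n (bumpMul c r m) x) =
      r⁻¹ * (-dirDeriv n (bump d) (r⁻¹ • (x - c))) * m x ^ 2 := by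
    intro x
    have e : dirDeriv n (bumpMul c r m) = _ :=
      dirDeriv_mul (contDiff_bump_dilation c r) hm.contDiff n
    rw [e, dirDeriv_dilation contDiff_bump]
    simp only [hmn]
    ring
  have hmeas : MeasurableSet {x : E d | 0 < ⟪n, x - c⟫_ℝ} :=
    (isOpen_lt continuous_const (by fun_prop)).measurableSet
  have hball : ∀ y ∈ Metric.ball c' (r / 8),
      r⁻¹ • (y - c) ∈ Metric.ball ((1 / 2 : ℝ) • n) (1 / 8) := by
    intro y hy
    rw [mem_ball_iff_norm] at hy ⊢
    have e : r⁻¹ • (y - c) - (1 / 2 : ℝ) • n = r⁻¹ • (y - c') := by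
      rw [hc', ← sub_sub, smul_sub r⁻¹ (y - c), smul_smul]
      congr 2; field_simp
    rw [e, norm_smul, norm_inv, Real.norm_of_nonneg hr.le, inv_mul_lt_iff₀ hr]
    linarith
  have h2 : b₁ / r * I ≤ ∫ x in {x | 0 < ⟪n, x - c⟫_ℝ}, -(m x * dirDeriv n (bumpMul c r m) x) := by
    calc b₁ / r * I = ∫ x in Metric.ball c' (r / 8), b₁ / r * m x ^ 2 :=
          (integral_const_mul _ _).symm
      _ ≤ ∫ x in Metric.ball c' (r / 8), -(m x * dirDeriv n (bumpMul c r m) x) := by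
        refine setIntegral_mono_on ?_ hint.integrableOn Metric.isOpen_ball.measurableSet ?_
        · exact (((continuous_const.mul
            (hm.isQuad.continuous.pow 2)).continuousOn).integrableOn_compact
            (isCompact_closedBall c' (r / 8))).mono_set Metric.ball_subset_closedBall
        · intro y hy
          obtain ⟨-, h⟩ := hbb d n hn _ (hball y hy)
          simp only [hderiv, div_eq_inv_mul b₁ r]
          gcongr
      _ ≤ _ := by
        refine setIntegral_mono_set hint.integrableOn ?_ (ae_of_all _ ?_)
        · filter_upwards [ae_restrict_mem hmeas] with y hy
          simp only [hderiv, Pi.zero_apply]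
          have : 0 ≤ ⟪r⁻¹ • (y - c), n⟫_ℝ := by
            rw [inner_smul_left, real_inner_comm]
            exact mul_nonneg (by simpa using hr.le) (le_of_lt hy)
          have := dirDeriv_bump_nonpos this
          have : 0 ≤ -dirDeriv n (bump d) (r⁻¹ • (y - c)) := by linarith
          positivity
        · intro y hy
          obtain ⟨h, -⟩ := hbb d n hn _ (hball y hy)
          rw [inner_smul_left, real_inner_comm] at h
          exact pos_of_mul_pos_right h (by simpa using hr.le)
  have h3 : (b₁ / r * I) ^ 2 ≤ (K * M) ^ 2 * r ^ (d - 2) * G :=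
    (pow_le_pow_left₀ (by positivity) h2 2).trans h1
  have hrd2 : r ^ d = r ^ (d - 2) * r ^ 2 := by rw [← pow_add]; congr 1; omega
  -- Again one factor `I` cancels in `h3`. The derivative of the bump put `1 / r` on the left, so
  -- here no power of `r` remains.
  have h4 : I ≤ K ^ 2 * C₁ * 8 ^ d / b₁ ^ 2 * G := by
    rcases hI0.eq_or_lt with h0 | h0
    · rw [← h0]; positivity
    · rw [mul_pow, mul_pow, hM2, div_pow, div_pow, hrd2] at h3
      have h5 : K ^ 2 * (C₁ * I / (r ^ (d - 2) * r ^ 2 / 8 ^ d)) * r ^ (d - 2) * G =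
        I * (K ^ 2 * C₁ * 8 ^ d * G) / r ^ 2 := by field_simp
      rw [h5, div_mul_eq_mul_div, div_le_div_iff_of_pos_right (by positivity)] at h3
      have h6 : b₁ ^ 2 * I ≤ K ^ 2 * C₁ * 8 ^ d * G :=
        le_of_mul_le_mul_left (by linarith [h3, show b₁ ^ 2 * I ^ 2 = I * (b₁ ^ 2 * I) by ring]) h0
      rw [div_mul_eq_mul_div, le_div_iff₀ (by positivity)]
      linarith
  have h7 := hN' x (Metric.closedBall_subset_closedBall (by gcongr; exact le_max_left _ _) hx)
  calc r ^ d * m x ^ 2 = 8 ^ d * ((r / 8) ^ d * m x ^ 2) := by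
        rw [div_pow]; field_simp
    _ ≤ 8 ^ d * (C₁ * I) := by gcongr
    _ = 8 ^ d * C₁ * I := by ring
    _ ≤ 8 ^ d * C₁ * (K ^ 2 * C₁ * 8 ^ d / b₁ ^ 2 * G) := by gcongr
    _ = _ := by ring

end TestBound

/-! ### Integration by parts -/

section IntegrationByParts

variable {d : ℕ} {f φ : E d → ℝ}

theorem integrable_mul_of_hasCompactSupport (hf : Continuous f) (hφ : Continuous φ)
    (hs : HasCompactSupport φ) : Integrable (fun x => f x * φ x) :=
  (hf.mul hφ).integrable_of_hasCompactSupport hs.mul_left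

theorem integral_mul_dirDeriv (hf : ContDiff ℝ ∞ f) (hφ : ContDiff ℝ ∞ φ)
    (hs : HasCompactSupport φ) (v : E d) :
    ∫ x, f x * dirDeriv v φ x = -∫ x, dirDeriv v f x * φ x :=
  integral_mul_fderiv_eq_neg_fderiv_mul_of_integrable
    (integrable_mul_of_hasCompactSupport (ContDiff.dirDeriv hf v).continuous hφ.continuous hs)
    (integrable_mul_of_hasCompactSupport hf.continuous (ContDiff.dirDeriv hφ v).continuous
      (HasCompactSupport.dirDeriv hs v))
    (integrable_mul_of_hasCompactSupport hf.continuous hφ.continuous hs)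
    (fun x _ => hf.differentiable (by simp) x) (fun x _ => hφ.differentiable (by simp) x)

theorem integral_mul_coordLaplacian (hf : ContDiff ℝ ∞ f) (hφ : ContDiff ℝ ∞ φ)
    (hs : HasCompactSupport φ) :
    ∫ x, f x * coordLaplacian φ x = ∫ x, coordLaplacian f x * φ x := by
  simp only [coordLaplacian, Finset.mul_sum, Finset.sum_mul]
  rw [integral_finsetSum, integral_finsetSum]
  · refine Finset.sum_congr rfl fun k _ => ?_
    rw [integral_mul_dirDeriv hf (ContDiff.dirDeriv hφ _) (HasCompactSupport.dirDeriv hs _),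
      integral_mul_dirDeriv (ContDiff.dirDeriv hf _) hφ hs, neg_neg]
  · exact fun k _ => integrable_mul_of_hasCompactSupport
      (ContDiff.dirDeriv (ContDiff.dirDeriv hf _) _).continuous hφ.continuous hs
  · exact fun k _ => integrable_mul_of_hasCompactSupport hf.continuous
      (ContDiff.dirDeriv (ContDiff.dirDeriv hφ _) _).continuous
      (HasCompactSupport.dirDeriv (HasCompactSupport.dirDeriv hs _) _)

/-- The open half space above the hyperplane through `c` with normal `n`. -/
def halfSpace (n c : E d) : Set (E d) := {x | 0 < ⟪n, x - c⟫_ℝ}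

theorem isOpen_halfSpace (n c : E d) : IsOpen (halfSpace n c) :=
  isOpen_lt continuous_const (by fun_prop)

theorem ae_inner_sub_ne_zero {n : E d} (hn : n ≠ 0) (c : E d) : ∀ᵐ x, ⟪n, x - c⟫_ℝ ≠ 0 := by
  have h := Measure.addHaar_affineSubspace (volume : Measure (E d))
    (AffineSubspace.mk' c (LinearMap.ker (innerₛₗ ℝ n))) (fun htop => by
      have : c + n ∈ AffineSubspace.mk' c (LinearMap.ker (innerₛₗ ℝ n)) := by rw [htop]; trivial
      rw [AffineSubspace.mem_mk', LinearMap.mem_ker] at this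
      simp [hn] at this)
  rw [measure_eq_zero_iff_ae_notMem] at h
  filter_upwards [h] with x hx h0
  refine hx ?_
  rw [SetLike.mem_coe, AffineSubspace.mem_mk', LinearMap.mem_ker]
  simpa using h0

/-- Integration by parts against the Lipschitz function `max ⟪n, x - c⟫ 0`, whose derivative along
`v` is `⟪n, v⟫` times the indicator of the half space, off a null set. As this function vanishes on
the hyperplane, no surface integral arises. -/
theorem inner_mul_integral_halfSpace {n : E d} (hn : n ≠ 0) (c v : E d) (hφ : ContDiff ℝ ∞ φ)
    (hs : HasCompactSupport φ) :
    ⟪n, v⟫_ℝ * ∫ x in halfSpace n c, φ x =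
      -∫ x in halfSpace n c, ⟪n, x - c⟫_ℝ * dirDeriv v φ x := by
  have hlip : LipschitzWith ‖n‖₊ (fun x : E d => max ⟪n, x - c⟫_ℝ 0) := by
    refine LipschitzWith.max_const (LipschitzWith.of_dist_le_mul fun x y => ?_) 0
    rw [Real.dist_eq, ← inner_sub_right, sub_sub_sub_cancel_right, dist_eq_norm, coe_nnnorm]
    exact abs_real_inner_le_norm _ _
  obtain ⟨D, hD⟩ := hφ.lipschitzWith_of_hasCompactSupport hs (by simp)
  have key := hlip.integral_lineDeriv_mul_eq hD hs v (μ := volume)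
  have hmeas := (isOpen_halfSpace n c).measurableSet
  have h1 : ∫ x, lineDeriv ℝ (fun x : E d => max ⟪n, x - c⟫_ℝ 0) x v * φ x =
      ⟪n, v⟫_ℝ * ∫ x in halfSpace n c, φ x := by
    rw [← integral_const_mul, ← integral_indicator hmeas]
    refine integral_congr_ae ?_
    filter_upwards [ae_inner_sub_ne_zero hn c] with x hx
    have hcont : ContinuousAt (fun x : E d => ⟪n, x - c⟫_ℝ) x := by fun_prop
    rcases lt_or_gt_of_ne hx with h | h
    · rw [Set.indicator_of_notMem (s := halfSpace n c) (fun h' => absurd h (not_lt.2 (le_of_lt h')))]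
      have : (fun x : E d => max ⟪n, x - c⟫_ℝ 0) =ᶠ[𝓝 x] fun _ => 0 := by
        filter_upwards [hcont.eventually (gt_mem_nhds h)] with y hy
        exact max_eq_right hy.le
      rw [this.lineDeriv_eq,
        ((hasFDerivAt_const (0 : ℝ) x).hasLineDerivAt v).lineDeriv]; simp
    · rw [Set.indicator_of_mem (s := halfSpace n c) h]
      have : (fun x : E d => max ⟪n, x - c⟫_ℝ 0) =ᶠ[𝓝 x] fun x => ⟪n, x - c⟫_ℝ := by
        filter_upwards [hcont.eventually (lt_mem_nhds h)] with y hy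
        exact max_eq_left (le_of_lt hy)
      rw [this.lineDeriv_eq]
      have h2 : HasFDerivAt (fun x : E d => ⟪n, x - c⟫_ℝ) (innerSL ℝ n) x :=
        (innerSL ℝ n).hasFDerivAt.comp x ((hasFDerivAt_id x).sub_const c)
      rw [h2.hasLineDerivAt v |>.lineDeriv]
      simp
  have h2 : ∫ x, lineDeriv ℝ φ x (-v) * max ⟪n, x - c⟫_ℝ 0 =
      -∫ x in halfSpace n c, ⟪n, x - c⟫_ℝ * dirDeriv v φ x := by
    rw [← integral_neg, ← integral_indicator hmeas]
    refine integral_congr_ae (ae_of_all _ fun x => ?_)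
    simp only
    rw [(hφ.differentiable (by simp) x).lineDeriv_eq_fderiv, map_neg]
    by_cases h : x ∈ halfSpace n c
    · rw [Set.indicator_of_mem h, max_eq_left (le_of_lt h), dirDeriv]; ring
    · rw [Set.indicator_of_notMem h, max_eq_right (not_lt.1 h), mul_zero]
  rw [← h1, key, h2]

/-- Green's formula for `w = ℓ m + κ ℓ²`, with `ℓ` the signed distance: `w` vanishes on the
hyperplane, `Δw = 2κ`, and the surface integral of `φ ∂ₙw = φ m` equals `-∫ m ∂ₙφ` over the half
space since `∂ₙm = 0`. -/
theorem integral_halfSpace_mul_coordLaplacian {n : E d} (hn : ‖n‖ = 1) (c : E d) {m : E d → ℝ}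
    (hm : IsAff m) (hmn : ∀ x, dirDeriv n m x = 0) (κ : ℝ) (hφ : ContDiff ℝ ∞ φ)
    (hs : HasCompactSupport φ) :
    ∫ x in halfSpace n c, (⟪n, x - c⟫_ℝ * m x + κ * ⟪n, x - c⟫_ℝ ^ 2) * coordLaplacian φ x =
      -(∫ x in halfSpace n c, m x * dirDeriv n φ x) + 2 * κ * ∫ x in halfSpace n c, φ x := by
  have hn0 : n ≠ 0 := by rintro rfl; simp at hn
  set ℓ : E d → ℝ := fun x => ⟪n, x - c⟫_ℝ with hℓ
  have hℓa : IsAff ℓ := by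
    have := (isAff_inner n).sub (isAff_const ⟪n, c⟫_ℝ)
    simpa only [hℓ, inner_sub_right] using this
  -- Absorbs the quadratic term, so that the weight of the Laplacian is the product `ℓ * m'`.
  set m' : E d → ℝ := fun x => m x + κ * ℓ x with hm'
  have hma : IsAff m' := hm.add (hℓa.const_mul κ)
  have hdℓ : ∀ v x, dirDeriv v ℓ x = ⟪n, v⟫_ℝ := fun v x => by
    rw [dirDeriv, hℓa.fderiv_apply]; simp only [hℓ, ← inner_sub_right]; congr 1; abel
  have hint : ∀ {g ψ : E d → ℝ}, Continuous g → ContDiff ℝ ∞ ψ → HasCompactSupport ψ →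
      IntegrableOn (fun x => g x * ψ x) (halfSpace n c) := fun hg hψ hψs =>
    (integrable_mul_of_hasCompactSupport hg hψ.continuous hψs).integrableOn
  have hℓc : Continuous ℓ := hℓa.isQuad.continuous
  have hmc : Continuous m' := hma.isQuad.continuous
  -- `inner_mul_integral_halfSpace` is applied to `m' ∂ₖφ`; the term in which `∂ₖ` falls on `m'`, a
  -- constant, is removed by a second application, to `φ`.
  have hk : ∀ k, ∫ x in halfSpace n c,
      ℓ x * m' x * dirDeriv (stdVec k) (dirDeriv (stdVec k) φ) x =
      -(n k * ∫ x in halfSpace n c, m' x * dirDeriv (stdVec k) φ x) +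
        n k * dirDeriv (stdVec k) m' 0 * ∫ x in halfSpace n c, φ x := by
    intro k
    have hφk := ContDiff.dirDeriv hφ (stdVec k)
    have hsk := HasCompactSupport.dirDeriv hs (stdVec k)
    have e1 := inner_mul_integral_halfSpace hn0 c (stdVec k)
      (hma.contDiff.mul hφk) hsk.mul_left
    have e2 := inner_mul_integral_halfSpace hn0 c (stdVec k) hφ hs
    have hnk : ⟪n, stdVec k⟫_ℝ = n k := by
      rw [real_inner_comm, EuclideanSpace.inner_single_left]; simp
    rw [hnk] at e1 e2
    rw [dirDeriv_mul hma.contDiff hφk] at e1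
    have e3 : ∀ x, dirDeriv (stdVec k) m' x = dirDeriv (stdVec k) m' 0 := fun x => by
      rw [dirDeriv, dirDeriv, hma.fderiv_const, hma.fderiv_const]
    set a := dirDeriv (stdVec k) m' 0
    simp only [e3] at e1
    have e4 : ∫ x in halfSpace n c, ⟪n, x - c⟫_ℝ * (a * dirDeriv (stdVec k) φ x +
        m' x * dirDeriv (stdVec k) (dirDeriv (stdVec k) φ) x) =
        a * (∫ x in halfSpace n c, ⟪n, x - c⟫_ℝ * dirDeriv (stdVec k) φ x) +
        ∫ x in halfSpace n c, ℓ x * m' x * dirDeriv (stdVec k) (dirDeriv (stdVec k) φ) x := by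
      rw [← integral_const_mul, ← integral_add]
      · congr 1; ext x; simp only [hℓ]; ring
      · exact (hint hℓc hφk hsk).const_mul a
      · exact hint (hℓc.mul hmc) (ContDiff.dirDeriv hφk _) (HasCompactSupport.dirDeriv hsk _)
    rw [e4] at e1
    linear_combination e1 - a * e2
  have e0 : ∀ x, (⟪n, x - c⟫_ℝ * m x + κ * ⟪n, x - c⟫_ℝ ^ 2) * coordLaplacian φ x =
      ∑ k, ℓ x * m' x * dirDeriv (stdVec k) (dirDeriv (stdVec k) φ) x := fun x => by
    rw [coordLaplacian, ← Finset.mul_sum]; simp only [hm', hℓ]; ring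
  simp only [e0]
  rw [integral_finsetSum _ fun k _ => hint (g := fun x => ℓ x * m' x) (hℓc.mul hmc)
    (ContDiff.dirDeriv (ContDiff.dirDeriv hφ _) _)
    (HasCompactSupport.dirDeriv (HasCompactSupport.dirDeriv hs _) _)]
  simp only [hk]
  rw [Finset.sum_add_distrib, Finset.sum_neg_distrib, ← Finset.sum_mul, ← dirDeriv_eq_sum]
  have e5 : ∑ k, n k * ∫ x in halfSpace n c, m' x * dirDeriv (stdVec k) φ x =
      ∫ x in halfSpace n c, m' x * dirDeriv n φ x := by
    simp only [dirDeriv_eq_sum n, Finset.mul_sum, ← integral_const_mul]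
    rw [integral_finsetSum]
    · refine Finset.sum_congr rfl fun k _ => ?_
      congr 1; ext x; ring
    · intro k _
      have := (hint hmc (ContDiff.dirDeriv hφ (stdVec k))
        (HasCompactSupport.dirDeriv hs (stdVec k))).const_mul (n k)
      refine this.congr (ae_of_all _ fun x => ?_)
      simp only; ring
  have e6 : dirDeriv n m' 0 = κ := by
    rw [show m' = fun x => m x + κ * ℓ x from rfl,
      dirDeriv_add hm.contDiff (hℓa.const_mul κ).contDiff, dirDeriv_const_mul]
    simp only [hmn, hdℓ, real_inner_self_eq_norm_sq, hn]; ring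
  have e7 : ∫ x in halfSpace n c, m' x * dirDeriv n φ x =
      (∫ x in halfSpace n c, m x * dirDeriv n φ x) - κ * ∫ x in halfSpace n c, φ x := by
    have := inner_mul_integral_halfSpace hn0 c n hφ hs
    rw [real_inner_self_eq_norm_sq, hn, one_pow, one_mul] at this
    rw [this, mul_neg, sub_neg_eq_add, ← integral_const_mul, ← integral_add]
    · congr 1; ext x; simp only [hm', hℓ]; ring
    · exact hint hm.isQuad.continuous (ContDiff.dirDeriv hφ n) (HasCompactSupport.dirDeriv hs n)
    · exact (hint hℓc (ContDiff.dirDeriv hφ n) (HasCompactSupport.dirDeriv hs n)).const_mul κ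
  rw [e5, e6, e7]
  ring

end IntegrationByParts

/-! ### Bounds for functionals of the errors -/

section ErrorBounds

variable {d : ℕ}

theorem sq_setIntegral_mul_le {e φ : E d → ℝ} {c : E d} {r K : ℝ}
    (he : MemLp e 2 (volume.restrict (Metric.ball c r))) (hφ : Continuous φ)
    (hK : ∀ x, |φ x| ≤ K) :
    (∫ x in Metric.ball c r, e x * φ x) ^ 2 ≤
      K ^ 2 * volume.real (Metric.ball c r) * ∫ x in Metric.ball c r, e x ^ 2 := by
  have hφ2 := memLp_ball_of_continuous hφ c r (p := 2)
  have h1 : ∫ x in Metric.ball c r, e x * φ x = ⟪he.toLp e, hφ2.toLp φ⟫_ℝ := by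
    rw [L2.inner_def]
    refine integral_congr_ae ?_
    filter_upwards [he.coeFn_toLp, hφ2.coeFn_toLp] with x h1 h2
    simp [h1, h2, mul_comm]
  have h2 : ∫ x in Metric.ball c r, φ x ^ 2 ≤ K ^ 2 * volume.real (Metric.ball c r) := by
    have := norm_setIntegral_le_of_norm_le_const (μ := volume) (s := Metric.ball c r)
      (f := fun x => φ x ^ 2) (C := K ^ 2) measure_ball_lt_top (fun x _ => by
        rw [norm_pow, Real.norm_eq_abs]
        exact pow_le_pow_left₀ (abs_nonneg _) (hK x) 2)
    exact (le_abs_self _).trans this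
  rw [h1, ← sq_abs]
  calc |⟪he.toLp e, hφ2.toLp φ⟫_ℝ| ^ 2 ≤ (‖he.toLp e‖ * ‖hφ2.toLp φ‖) ^ 2 := by
        gcongr; exact abs_real_inner_le_norm _ _
    _ = (∫ x in Metric.ball c r, φ x ^ 2) * ∫ x in Metric.ball c r, e x ^ 2 := by
        rw [mul_pow, norm_sq_toLp, norm_sq_toLp, mul_comm]
    _ ≤ _ := by
        gcongr

theorem sq_setIntegral_mul_le_of_bound {e φ : E d → ℝ} {c : E d} {r K B : ℝ}
    (he : ∀ᵐ x ∂(volume.restrict (Metric.ball c r)), |e x| ≤ B) (hB : 0 ≤ B)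
    (hK : ∀ x, |φ x| ≤ K) :
    (∫ x in Metric.ball c r, e x * φ x) ^ 2 ≤
      (B * K * volume.real (Metric.ball c r)) ^ 2 := by
  have hfin : volume.restrict (Metric.ball c r) Set.univ < ⊤ := by
    simpa using measure_ball_lt_top
  have : IsFiniteMeasure (volume.restrict (Metric.ball c r)) := ⟨hfin⟩
  have h := norm_integral_le_of_norm_le_const (μ := volume.restrict (Metric.ball c r))
    (f := fun x => e x * φ x) (C := B * K) (by
      filter_upwards [he] with x hx
      rw [Real.norm_eq_abs, abs_mul]
      exact mul_le_mul hx (hK x) (abs_nonneg _) hB)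
  rw [Real.norm_eq_abs] at h
  rw [← sq_abs]
  refine pow_le_pow_left₀ (abs_nonneg _) (h.trans_eq ?_) 2
  simp [Measure.real]

theorem volume_real_ball (c : E d) {r : ℝ} (hr : 0 < r) :
    volume.real (Metric.ball c r) = r ^ d * volume.real (Metric.ball (0 : E d) 1) := by
  rw [Measure.real, Measure.addHaar_ball_of_pos volume c hr, ENNReal.toReal_mul,
    finrank_euclideanSpace_fin, ENNReal.toReal_ofReal (by positivity), Measure.real]

theorem TestBound.sub {c : E d} {r G₁ G₂ : ℝ} {ℒ₁ ℒ₂ : (E d → ℝ) → ℝ}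
    (h₁ : TestBound c r G₁ ℒ₁) (h₂ : TestBound c r G₂ ℒ₂) :
    TestBound c r (2 * (G₁ + G₂)) (fun φ => ℒ₁ φ - ℒ₂ φ) := by
  intro φ M a1 a2 a3 a4 a5
  have e1 := h₁ φ M a1 a2 a3 a4 a5
  have e2 := h₂ φ M a1 a2 a3 a4 a5
  nlinarith [sq_nonneg (ℒ₁ φ + ℒ₂ φ)]

theorem exists_testBound_of_bound (hd : 2 ≤ d) : ∃ C : ℝ, 0 < C ∧ ∀ (c : E d) (r B : ℝ)
    (e : E d → ℝ), 0 < r → 0 ≤ B → (∀ᵐ x ∂(volume.restrict (Metric.ball c r)), |e x| ≤ B) →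
    TestBound c r (C * (r ^ (d + 2) * B ^ 2)) (fun φ => ∫ x in Metric.ball c r, e x * φ x) := by
  set w := volume.real (Metric.ball (0 : E d) 1) with hw
  refine ⟨w ^ 2 + 1, by positivity, fun c r B e hr hB he φ M _ _ h3 _ _ => ?_⟩
  have h := sq_setIntegral_mul_le_of_bound he hB h3
  rw [volume_real_ball c hr, ← hw] at h
  have hrd : r ^ d * r ^ d = r ^ (d - 2) * r ^ (d + 2) := by
    rw [← pow_add, ← pow_add]; congr 1; omega
  refine h.trans ?_
  calc (B * M * (r ^ d * w)) ^ 2 = w ^ 2 * (M ^ 2 * (r ^ d * r ^ d) * B ^ 2) := by ring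
    _ ≤ (w ^ 2 + 1) * (M ^ 2 * (r ^ d * r ^ d) * B ^ 2) := by gcongr; linarith
    _ = _ := by rw [hrd]; ring

/-- Each term has the factor `M² r^(d-2)`: the Laplacian is at most `d M / r²`, paired with a sup
bound over a volume of order `r^d`; the other two terms use the Cauchy–Schwarz inequality and `r^d =
r^(d-2) r²`. -/
theorem exists_testBound_error (hd : 2 ≤ d) : ∃ C : ℝ, 0 < C ∧ ∀ (c : E d) (r EY EP EU : ℝ)
    (ey ep eu : E d → ℝ) (i : Fin d), 0 < r → 0 ≤ EY →
    (∀ᵐ x ∂(volume.restrict (Metric.ball c r)), |ey x| ≤ EY) →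
    MemLp ep 2 (volume.restrict (Metric.ball c r)) →
    ∫ x in Metric.ball c r, ep x ^ 2 ≤ EP ^ 2 →
    MemLp eu 2 (volume.restrict (Metric.ball c r)) →
    ∫ x in Metric.ball c r, eu x ^ 2 ≤ EU ^ 2 →
    TestBound c r (C * (r ^ (d - 2) * EY ^ 2 + EP ^ 2 + r ^ 2 * EU ^ 2)) (fun φ =>
      (∫ x in Metric.ball c r, ey x * coordLaplacian φ x) +
      (∫ x in Metric.ball c r, ep x * dirDeriv (stdVec i) φ x) +
      ∫ x in Metric.ball c r, eu x * φ x) := by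
  set w := volume.real (Metric.ball (0 : E d) 1) with hw
  refine ⟨3 * (w ^ 2 * d ^ 2 + w + 1), by positivity, ?_⟩
  intro c r EY EP EU ey ep eu i hr hEY hey hep hEP heu hEU φ M h1 h2 h3 h4 h5
  have hlap : ∀ x, |coordLaplacian φ x| ≤ d * (M / r ^ 2) := fun x => by
    refine (Finset.abs_sum_le_sum_abs _ _).trans ((Finset.sum_le_sum fun k _ => h5 x k).trans ?_)
    simp
  have b1 := sq_setIntegral_mul_le_of_bound hey hEY hlap
  have b2 := sq_setIntegral_mul_le hep (ContDiff.dirDeriv h1 (stdVec i)).continuous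
    (fun x => h4 x i)
  have b3 := sq_setIntegral_mul_le heu h1.continuous h3
  rw [volume_real_ball c hr, ← hw] at b1 b2 b3
  have hrd : r ^ d = r ^ (d - 2) * r ^ 2 := by rw [← pow_add]; congr 1; omega
  have hw₀ : 0 ≤ w := measureReal_nonneg
  have b2' := b2.trans (mul_le_mul_of_nonneg_left hEP (by positivity))
  have b3' := b3.trans (mul_le_mul_of_nonneg_left hEU (by positivity))
  rw [hrd] at b1 b2' b3'
  set X := ∫ x in Metric.ball c r, ey x * coordLaplacian φ x
  set Y := ∫ x in Metric.ball c r, ep x * dirDeriv (stdVec i) φ x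
  set Z := ∫ x in Metric.ball c r, eu x * φ x
  set t := r ^ (d - 2)
  have ht : 0 < t := by positivity
  have c1 : X ^ 2 ≤ w ^ 2 * d ^ 2 * (M ^ 2 * t * (t * EY ^ 2)) := b1.trans_eq (by field_simp)
  have c2 : Y ^ 2 ≤ w * (M ^ 2 * t * EP ^ 2) := b2'.trans_eq (by field_simp)
  have c3 : Z ^ 2 ≤ w * (M ^ 2 * t * (r ^ 2 * EU ^ 2)) := b3'.trans_eq (by ring)
  have p1 : 0 ≤ M ^ 2 * t * (t * EY ^ 2) := by positivity
  have p2 : 0 ≤ M ^ 2 * t * EP ^ 2 := by positivity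
  have p3 : 0 ≤ M ^ 2 * t * (r ^ 2 * EU ^ 2) := by positivity
  have q : 0 ≤ w ^ 2 * (d : ℝ) ^ 2 := by positivity
  have h3s : (X + Y + Z) ^ 2 ≤ 3 * (X ^ 2 + Y ^ 2 + Z ^ 2) := by
    nlinarith [sq_nonneg (X - Y), sq_nonneg (X - Z), sq_nonneg (Y - Z)]
  calc (X + Y + Z) ^ 2 ≤ 3 * (X ^ 2 + Y ^ 2 + Z ^ 2) := h3s
    _ ≤ 3 * (w ^ 2 * d ^ 2 * (M ^ 2 * t * (t * EY ^ 2)) + w * (M ^ 2 * t * EP ^ 2) +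
        w * (M ^ 2 * t * (r ^ 2 * EU ^ 2))) := by gcongr
    _ ≤ 3 * ((w ^ 2 * d ^ 2 + w + 1) * (M ^ 2 * t * (t * EY ^ 2)) +
        (w ^ 2 * d ^ 2 + w + 1) * (M ^ 2 * t * EP ^ 2) +
        (w ^ 2 * d ^ 2 + w + 1) * (M ^ 2 * t * (r ^ 2 * EU ^ 2))) := by
        gcongr <;> linarith
    _ = _ := by ring

theorem exists_testBound_div (hd : 2 ≤ d) : ∃ C : ℝ, 0 < C ∧ ∀ (c : E d) (r EY : ℝ)
    (ey : Fin d → E d → ℝ), 0 < r → 0 ≤ EY →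
    (∀ i, ∀ᵐ x ∂(volume.restrict (Metric.ball c r)), |ey i x| ≤ EY) →
    TestBound c r (C * (r ^ d * EY ^ 2)) (fun φ =>
      ∑ i, ∫ x in Metric.ball c r, ey i x * dirDeriv (stdVec i) φ x) := by
  set w := volume.real (Metric.ball (0 : E d) 1) with hw
  refine ⟨d ^ 2 * (w ^ 2 + 1), by positivity, ?_⟩
  intro c r EY ey hr hEY hey φ M h1 h2 h3 h4 h5
  have hrd : r ^ d = r ^ (d - 2) * r ^ 2 := by rw [← pow_add]; congr 1; omega
  have b : ∀ i, (∫ x in Metric.ball c r, ey i x * dirDeriv (stdVec i) φ x) ^ 2 ≤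
      (w ^ 2 + 1) * (M ^ 2 * r ^ (d - 2) * (r ^ d * EY ^ 2)) := fun i => by
    have := sq_setIntegral_mul_le_of_bound (hey i) hEY (fun x => h4 x i)
    rw [volume_real_ball c hr, ← hw] at this
    refine this.trans ?_
    calc (EY * (M / r) * (r ^ d * w)) ^ 2
        = w ^ 2 * (M ^ 2 * r ^ (d - 2) * (r ^ d * EY ^ 2)) := by rw [hrd]; field_simp
      _ ≤ _ := by gcongr; linarith
  calc (∑ i, ∫ x in Metric.ball c r, ey i x * dirDeriv (stdVec i) φ x) ^ 2
      ≤ d * ∑ i, (∫ x in Metric.ball c r, ey i x * dirDeriv (stdVec i) φ x) ^ 2 := by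
        simpa using sq_sum_le_card_mul_sum_sq (s := Finset.univ)
          (f := fun i => ∫ x in Metric.ball c r, ey i x * dirDeriv (stdVec i) φ x)
    _ ≤ d * ∑ i : Fin d, (w ^ 2 + 1) * (M ^ 2 * r ^ (d - 2) * (r ^ d * EY ^ 2)) := by
        gcongr with i; exact b i
    _ = _ := by simp; ring

end ErrorBounds

/-! ### Testing the weak formulation with smooth functions -/

section WeakFormulation

variable {d : ℕ} {Ω : Set (E d)} {φ : E d → ℝ}

theorem gradient_apply (f : E d → ℝ) (x : E d) (k : Fin d) :
    gradient f x k = dirDeriv (stdVec k) f x := by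
  have h : ⟪gradient f x, stdVec k⟫_ℝ = fderiv ℝ f x (stdVec k) := by
    rw [gradient, InnerProductSpace.toDual_symm_apply]
  rw [dirDeriv, ← h, real_inner_comm, EuclideanSpace.inner_single_left]
  simp

theorem continuous_gradient (hφ : ContDiff ℝ ∞ φ) : Continuous (gradient φ) :=
  (InnerProductSpace.toDual ℝ (E d)).symm.continuous.comp (hφ.continuous_fderiv (by simp))

theorem hasCompactSupport_gradient (hs : HasCompactSupport φ) : HasCompactSupport (gradient φ) :=
  (hs.fderiv ℝ).comp_left (g := (InnerProductSpace.toDual ℝ (E d)).symm) (map_zero _)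

theorem IsTestFunction.dirDeriv (hφ : IsTestFunction Ω φ) (v : E d) :
    IsTestFunction Ω (dirDeriv v φ) :=
  ⟨ContDiff.dirDeriv hφ.1 v, HasCompactSupport.dirDeriv hφ.2.1 v,
    (tsupport_dirDeriv_subset v).trans hφ.2.2⟩

theorem isTestFunction_zero : IsTestFunction Ω (fun _ => 0) :=
  ⟨contDiff_const, HasCompactSupport.zero, by simp [tsupport, Function.support]⟩

theorem integrableOn_smul_of_locallyIntegrableOn {F : Type*} [NormedAddCommGroup F]
    [NormedSpace ℝ F] {g : E d → F} (hg : LocallyIntegrableOn g Ω) {ψ : E d → ℝ}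
    (hψ : Continuous ψ) (hs : HasCompactSupport ψ) (hΩ : tsupport ψ ⊆ Ω) :
    IntegrableOn (fun x => ψ x • g x) Ω := by
  have h1 := (hg.integrableOn_compact_subset hΩ hs).continuousOn_smul hψ.continuousOn hs
  refine (h1.integrable_of_forall_notMem_eq_zero fun x hx => ?_).integrableOn
  rw [image_eq_zero_of_notMem_tsupport hx, zero_smul]

theorem setIntegral_eq_integral_of_tsupport {s : Set (E d)} {g ψ : E d → ℝ}
    (h : tsupport ψ ⊆ s) : ∫ x in s, g x * ψ x = ∫ x, g x * ψ x :=
  setIntegral_eq_integral_of_forall_compl_eq_zero fun x hx => by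
    rw [image_eq_zero_of_notMem_tsupport fun h' => hx (h h'), mul_zero]

theorem setIntegral_eq_setIntegral_of_tsupport {s t : Set (E d)} {g ψ : E d → ℝ}
    (hs : tsupport ψ ⊆ s) (ht : tsupport ψ ⊆ t) :
    ∫ x in s, g x * ψ x = ∫ x in t, g x * ψ x := by
  rw [setIntegral_eq_integral_of_tsupport hs, setIntegral_eq_integral_of_tsupport ht]

theorem isWeakGradient_testFunction (hφ : IsTestFunction Ω φ) :
    IsWeakGradient Ω φ (gradient φ) := by
  refine ⟨hφ.1.continuous.locallyIntegrable.locallyIntegrableOn _,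
    (continuous_gradient hφ.1).locallyIntegrable.locallyIntegrableOn _, fun ψ hψ => ?_⟩
  have i1 : ∀ i, Integrable (fun x => (φ x • gradient ψ x) i) (volume.restrict Ω) := fun i => by
    simp only [PiLp.smul_apply, gradient_apply, smul_eq_mul]
    exact (integrable_mul_of_hasCompactSupport hφ.1.continuous
      (ContDiff.dirDeriv hψ.1 _).continuous (HasCompactSupport.dirDeriv hψ.2.1 _)).integrableOn
  have i2 : ∀ i, Integrable (fun x => (ψ x • gradient φ x) i) (volume.restrict Ω) := fun i => by
    simp only [PiLp.smul_apply, gradient_apply, smul_eq_mul]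
    exact (integrable_mul_of_hasCompactSupport hψ.1.continuous
      (ContDiff.dirDeriv hφ.1 _).continuous (HasCompactSupport.dirDeriv hφ.2.1 _)).integrableOn
  ext k
  rw [PiLp.neg_apply, eval_integral_piLp i1, eval_integral_piLp i2]
  simp only [PiLp.smul_apply, gradient_apply, smul_eq_mul]
  rw [setIntegral_eq_integral_of_tsupport ((tsupport_dirDeriv_subset _).trans hψ.2.2),
    integral_mul_dirDeriv hφ.1 hψ.1 hψ.2.1,
    setIntegral_eq_integral_of_tsupport ((tsupport_dirDeriv_subset _).trans hφ.2.2)]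
  simp only [mul_comm]

theorem isWeakGradient_weakGradient {v : E d → ℝ} (h : ∃ g, IsWeakGradient Ω v g) :
    IsWeakGradient Ω v (weakGradient Ω v) := by
  rw [weakGradient, dif_pos h]
  exact h.choose_spec

/-- The fundamental lemma of the calculus of variations. It identifies the chosen `weakGradient` of
a test function with the classical gradient. -/
theorem IsWeakGradient.ae_eq (hΩ : IsOpen Ω) {v : E d → ℝ} {g g' : E d → E d}
    (h : IsWeakGradient Ω v g) (h' : IsWeakGradient Ω v g') :
    g =ᵐ[volume.restrict Ω] g' := by
  have key := hΩ.ae_eq_zero_of_integral_contDiff_smul_eq_zero (μ := volume) (h.2.1.sub h'.2.1)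
    (fun ψ h1 h2 h3 => by
      have e1 := h.2.2 ψ ⟨h1, h2, h3⟩
      have e2 := h'.2.2 ψ ⟨h1, h2, h3⟩
      rw [e1, neg_inj] at e2
      rw [← setIntegral_eq_integral_of_forall_compl_eq_zero (s := Ω) fun x hx => by
        rw [image_eq_zero_of_notMem_tsupport fun h' => hx (h3 h'), zero_smul]]
      simp only [Pi.sub_apply, smul_sub]
      rw [integral_sub (integrableOn_smul_of_locallyIntegrableOn h.2.1 h1.continuous h2 h3)
        (integrableOn_smul_of_locallyIntegrableOn h'.2.1 h1.continuous h2 h3), e2, sub_self])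
  filter_upwards [ae_restrict_of_ae key, ae_restrict_mem hΩ.measurableSet] with x hx hxΩ
  exact sub_eq_zero.1 (hx hxΩ)

theorem weakGradient_testFunction (hΩ : IsOpen Ω) (hφ : IsTestFunction Ω φ) :
    weakGradient Ω φ =ᵐ[volume.restrict Ω] gradient φ :=
  (isWeakGradient_weakGradient ⟨_, isWeakGradient_testFunction hφ⟩).ae_eq hΩ
    (isWeakGradient_testFunction hφ)

theorem weightedMeasure_one : weightedMeasure (fun _ => 1) Ω = volume.restrict Ω := by
  simp [weightedMeasure]

theorem memH10_testFunction (hΩ : IsOpen Ω) (hφ : IsTestFunction Ω φ) :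
    MemH10 (fun _ => 1) Ω φ := by
  have hae := weakGradient_testFunction hΩ hφ
  -- The approximating sequence is constant.
  refine ⟨⟨?_, ⟨_, isWeakGradient_testFunction hφ⟩, ?_⟩, fun _ => φ, fun _ => hφ, ?_, ?_⟩
  · rw [weightedMeasure_one]
    exact (hφ.1.continuous.memLp_of_hasCompactSupport hφ.2.1).restrict _
  · rw [weightedMeasure_one, memLp_congr_ae hae]
    exact ((continuous_gradient hφ.1).memLp_of_hasCompactSupport
      (hasCompactSupport_gradient hφ.2.1)).restrict _
  · simp
  · rw [weightedMeasure_one]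
    have : (fun x => gradient φ x - weakGradient Ω φ x) =ᵐ[volume.restrict Ω] 0 := by
      filter_upwards [hae] with x hx
      simp [hx]
    simp [eLpNorm_congr_ae this]

theorem IsWeakGradient.integral_mul_dirDeriv {v : E d → ℝ} {g : E d → E d}
    (h : IsWeakGradient Ω v g) (hφ : IsTestFunction Ω φ) (k : Fin d) :
    ∫ x in Ω, v x * dirDeriv (stdVec k) φ x = -∫ x in Ω, g x k * φ x := by
  have i1 : ∀ i, Integrable (fun x => (v x • gradient φ x) i) (volume.restrict Ω) := fun i => by
    have := integrableOn_smul_of_locallyIntegrableOn h.1 (hφ.dirDeriv (stdVec i)).1.continuous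
      (hφ.dirDeriv (stdVec i)).2.1 (hφ.dirDeriv (stdVec i)).2.2
    simpa only [PiLp.smul_apply, gradient_apply, smul_eq_mul, mul_comm, IntegrableOn] using this
  have i2 := integrableOn_smul_of_locallyIntegrableOn h.2.1 hφ.1.continuous hφ.2.1 hφ.2.2
  have i2' : ∀ i, Integrable (fun x => (φ x • g x) i) (volume.restrict Ω) := fun i =>
    (EuclideanSpace.proj (𝕜 := ℝ) i).integrable_comp i2
  have e := congrArg (fun z : E d => z k) (h.2.2 φ hφ)
  simp only [PiLp.neg_apply] at e
  rw [eval_integral_piLp i1, eval_integral_piLp i2'] at e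
  simpa only [PiLp.smul_apply, gradient_apply, smul_eq_mul, mul_comm] using e

theorem integrableOn_mul_testFunction {g : E d → ℝ} (hg : LocallyIntegrableOn g Ω)
    (hφ : IsTestFunction Ω φ) : IntegrableOn (fun x => g x * φ x) Ω := by
  have := integrableOn_smul_of_locallyIntegrableOn hg hφ.1.continuous hφ.2.1 hφ.2.2
  simpa only [smul_eq_mul, mul_comm] using this

/-- The vector field `φ eᵢ`. -/
noncomputable def coordField (i : Fin d) (φ : E d → ℝ) (x : E d) : E d :=
  EuclideanSpace.single i (φ x)

theorem coordField_same (i : Fin d) (φ : E d → ℝ) : (fun x => coordField i φ x i) = φ := by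
  ext x; simp [coordField]

theorem coordField_ne {i j : Fin d} (h : j ≠ i) (φ : E d → ℝ) :
    (fun x => coordField i φ x j) = fun _ => 0 := by
  ext x; simp [coordField, h]

theorem memH10Vec_coordField (hΩ : IsOpen Ω) (hφ : IsTestFunction Ω φ) (i : Fin d) :
    MemH10Vec (fun _ => 1) Ω (coordField i φ) := by
  intro j
  by_cases h : j = i
  · subst h; rw [coordField_same]; exact memH10_testFunction hΩ hφ
  · rw [coordField_ne h]; exact memH10_testFunction hΩ isTestFunction_zero

theorem weakGradient_zero (hΩ : IsOpen Ω) :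
    weakGradient Ω (fun _ => 0) =ᵐ[volume.restrict Ω] fun _ => 0 := by
  filter_upwards [weakGradient_testFunction hΩ isTestFunction_zero] with x hx
  rw [hx, gradient_fun_const]

/-- The weak derivative of `yᵢ`, tested with `∂ₖφ`, moves the remaining derivative onto `φ`. This is
why the gradient of the velocity error never has to be estimated. -/
theorem formA_coordField (hΩ : IsOpen Ω) (hφ : IsTestFunction Ω φ) (i : Fin d) {y : E d → E d}
    (hy : ∃ g, IsWeakGradient Ω (fun x => y x i) g) :
    formA Ω y (coordField i φ) = -∫ x in Ω, y x i * coordLaplacian φ x := by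
  have hg := isWeakGradient_weakGradient hy
  set g := weakGradient Ω (fun x => y x i)
  rw [formA, Finset.sum_eq_single i]
  · rw [coordField_same]
    have e1 : ∫ x in Ω, ⟪g x, weakGradient Ω φ x⟫_ℝ =
        ∫ x in Ω, ∑ k, g x k * dirDeriv (stdVec k) φ x := by
      refine integral_congr_ae ?_
      filter_upwards [weakGradient_testFunction hΩ hφ] with x hx
      rw [hx, PiLp.inner_apply]
      simp [gradient_apply, mul_comm]
    have hgk : ∀ k, LocallyIntegrableOn (fun x => g x k) Ω := fun k x hx =>
      (EuclideanSpace.proj (𝕜 := ℝ) k).integrableAtFilter_comp (hg.2.1 x hx)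
    have hyl : LocallyIntegrableOn (fun x => y x i) Ω := hg.1
    rw [e1, integral_finsetSum _ fun k _ => integrableOn_mul_testFunction (hgk k) (hφ.dirDeriv _)]
    simp only [coordLaplacian, Finset.mul_sum]
    rw [integral_finsetSum _ fun k _ =>
      integrableOn_mul_testFunction hyl ((hφ.dirDeriv _).dirDeriv _), ← Finset.sum_neg_distrib]
    refine Finset.sum_congr rfl fun k _ => ?_
    rw [hg.integral_mul_dirDeriv (hφ.dirDeriv (stdVec k)) k, neg_neg]
  · intro j _ hj
    rw [coordField_ne hj]
    refine (integral_congr_ae (g := fun _ => 0) ?_).trans (integral_zero _ _)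
    filter_upwards [weakGradient_zero hΩ] with x hx
    rw [hx]; simp
  · simp

theorem formB_coordField (hΩ : IsOpen Ω) (hφ : IsTestFunction Ω φ) (i : Fin d) (q : E d → ℝ) :
    formB Ω (coordField i φ) q = -∫ x in Ω, q x * dirDeriv (stdVec i) φ x := by
  rw [formB]
  congr 1
  refine integral_congr_ae ?_
  filter_upwards [weakGradient_testFunction hΩ hφ, weakGradient_zero hΩ] with x h1 h2
  rw [weakDiv, Finset.sum_eq_single i]
  · rw [coordField_same, h1, gradient_apply]
  · intro j _ hj
    rw [coordField_ne hj, h2]; simp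
  · simp

theorem l2Inner_coordField (i : Fin d) (u : E d → E d) :
    l2Inner Ω u (coordField i φ) = ∫ x in Ω, u x i * φ x := by
  rw [l2Inner]
  congr 1
  ext x
  rw [coordField, real_inner_comm, EuclideanSpace.inner_single_left]
  simp [mul_comm]

variable {P : TrackingData d Ω} {y z u : E d → E d} {p r : E d → ℝ}

/-- The momentum equation of the state, tested with `φ eᵢ`. -/
theorem IsOptimalitySystemSolution.momentum_testFunction
    (h : IsOptimalitySystemSolution P y p z r u) (hΩ : IsOpen Ω) (hφ : IsTestFunction Ω φ)
    (i : Fin d) :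
    (∫ x in Ω, y x i * coordLaplacian φ x) + (∫ x in Ω, p x * dirDeriv (stdVec i) φ x) +
      ∫ x in Ω, u x i * φ x = 0 := by
  have e := h.state_momentum _ (memH10Vec_coordField hΩ hφ i)
  rw [formA_coordField hΩ hφ i (h.y_mem i).1.2.1, formB_coordField hΩ hφ, l2Inner_coordField] at e
  linarith

/-- The divergence constraint of the state, tested with `φ`. -/
theorem IsOptimalitySystemSolution.div_testFunction
    (h : IsOptimalitySystemSolution P y p z r u) (hφ : IsTestFunction Ω φ) :
    ∑ i, ∫ x in Ω, y x i * dirDeriv (stdVec i) φ x = 0 := by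
  have e := h.state_div φ ((hφ.1.continuous.memLp_of_hasCompactSupport hφ.2.1).restrict _)
  have hg := fun i => isWeakGradient_weakGradient (h.y_mem i).1.2.1
  simp only [formB, weakDiv, Finset.mul_sum] at e
  rw [integral_finsetSum, neg_eq_zero] at e
  · rw [← neg_eq_zero, ← Finset.sum_neg_distrib, ← e]
    refine Finset.sum_congr rfl fun i _ => ?_
    rw [(hg i).integral_mul_dirDeriv hφ i, neg_neg]
    simp only [mul_comm]
  · intro i _
    have : LocallyIntegrableOn (fun x => weakGradient Ω (fun x => y x i) x i) Ω := fun x hx =>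
      (EuclideanSpace.proj (𝕜 := ℝ) i).integrableAtFilter_comp ((hg i).2.1 x hx)
    simpa only [mul_comm, IntegrableOn] using integrableOn_mul_testFunction this hφ

end WeakFormulation

/-! ### Quadratic functions vanishing on a hyperplane -/

section Hyperplane

variable {d : ℕ} {n c : E d}

/-- The orthogonal projection onto the hyperplane with unit normal `n`. -/
noncomputable def tangentProj (n : E d) : E d →L[ℝ] E d :=
  ContinuousLinearMap.id ℝ (E d) - (innerSL ℝ n).smulRight n

theorem tangentProj_apply (n x : E d) : tangentProj n x = x - ⟪n, x⟫_ℝ • n := by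
  simp [tangentProj]

theorem inner_tangentProj (hn : ‖n‖ = 1) (x : E d) : ⟪n, tangentProj n x⟫_ℝ = 0 := by
  rw [tangentProj_apply, inner_sub_right, inner_smul_right, real_inner_self_eq_norm_sq, hn]
  simp

theorem norm_tangentProj_le (hn : ‖n‖ = 1) (x : E d) : ‖tangentProj n x‖ ≤ ‖x‖ := by
  have h : ‖tangentProj n x‖ ^ 2 = ‖x‖ ^ 2 - ⟪n, x⟫_ℝ ^ 2 := by
    rw [tangentProj_apply, norm_sub_sq_real, norm_smul, inner_smul_right, real_inner_comm, hn]
    simp only [mul_one, Real.norm_eq_abs, sq_abs]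
    ring
  exact (pow_le_pow_iff_left₀ (norm_nonneg _) (norm_nonneg _) two_ne_zero).1
    (by nlinarith [sq_nonneg ⟪n, x⟫_ℝ])

theorem eq_tangentProj_add (n x : E d) : x = tangentProj n x + ⟪n, x⟫_ℝ • n := by
  rw [tangentProj_apply]; abel

/-- The composition with the projection is again quadratic, and it vanishes on a full ball since the
projection does not increase norms. -/
theorem IsQuad.comp_tangentProj_eq_zero (hn : ‖n‖ = 1) {w : E d → ℝ} (hw : IsQuad w) {r : ℝ}
    (hr : 0 < r) (h0 : ∀ x ∈ Metric.ball (0 : E d) r, ⟪n, x⟫_ℝ = 0 → w x = 0) (x : E d) :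
    w (tangentProj n x) = 0 := by
  have hq : IsQuad (fun x => w (tangentProj n x)) := by
    obtain ⟨a, g, A, h⟩ := hw
    refine ⟨a, ContinuousLinearMap.adjoint (tangentProj n) g,
      (ContinuousLinearMap.adjoint (tangentProj n)).comp (A.comp (tangentProj n)), fun x => ?_⟩
    simp only [h]
    rw [ContinuousLinearMap.comp_apply, ContinuousLinearMap.comp_apply,
      ContinuousLinearMap.adjoint_inner_left, ContinuousLinearMap.adjoint_inner_left]
  refine hq.eq_zero_of_ball hr (fun y hy => h0 _ ?_ (inner_tangentProj hn y)) x
  rw [mem_ball_zero_iff] at hy ⊢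
  exact (norm_tangentProj_le hn y).trans_lt hy

/-- Write `x - c = v + t n` with `v` tangential. The terms without `t` vanish by hypothesis; what
remains is `t` times an affine function of `v`, plus a multiple of `t²`. -/
theorem IsQuad.exists_factor (hn : ‖n‖ = 1) {w : E d → ℝ} (hw : IsQuad w) {r : ℝ} (hr : 0 < r)
    (h0 : ∀ x ∈ Metric.ball c r, ⟪n, x - c⟫_ℝ = 0 → w x = 0) :
    ∃ (m : E d → ℝ) (κ : ℝ), IsAff m ∧ (∀ x, dirDeriv n m x = 0) ∧
      ∀ x, w x = ⟪n, x - c⟫_ℝ * m x + κ * ⟪n, x - c⟫_ℝ ^ 2 := by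
  have hw' : IsQuad (fun x => w (c + x)) := by simpa using hw.comp_dilation c 1
  have h1 := hw'.comp_tangentProj_eq_zero hn hr (fun x hx hnx => h0 _ (by simpa using hx)
    (by simpa using hnx))
  obtain ⟨a, g, A, h⟩ := hw'
  simp only at h
  -- The mixed terms `⟪A v, n⟫ + ⟪A n, v⟫` as a functional of `x - c`; composing with the projection
  -- makes it vanish on `n`.
  set b := ContinuousLinearMap.adjoint (tangentProj n) (ContinuousLinearMap.adjoint A n + A n)
  have hm : IsAff (fun x => ⟪g, n⟫_ℝ + ⟪b, x - c⟫_ℝ) :=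
    ⟨⟪g, n⟫_ℝ - ⟪b, c⟫_ℝ, b, fun x => by simp only [inner_sub_right]; ring⟩
  refine ⟨_, ⟪A n, n⟫_ℝ, hm, fun x => ?_, fun x => ?_⟩
  · have hPn : tangentProj n n = 0 := by
      rw [tangentProj_apply, real_inner_self_eq_norm_sq, hn]; simp
    have hbn : ⟪b, n⟫_ℝ = 0 := by rw [ContinuousLinearMap.adjoint_inner_left, hPn, inner_zero_right]
    rw [dirDeriv, hm.fderiv_apply]
    simp only [inner_sub_right, inner_add_right, hbn]
    ring
  · have e1 := h (x - c)
    have e2 := h1 (x - c)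
    rw [h] at e2
    rw [add_sub_cancel] at e1
    have e3 : ⟪b, x - c⟫_ℝ = ⟪A (tangentProj n (x - c)), n⟫_ℝ + ⟪A n, tangentProj n (x - c)⟫_ℝ := by
      rw [ContinuousLinearMap.adjoint_inner_left, inner_add_left,
        ContinuousLinearMap.adjoint_inner_left, real_inner_comm]
    rw [e3]
    set t := ⟪n, x - c⟫_ℝ
    set v := tangentProj n (x - c)
    have hx : x - c = v + t • n := eq_tangentProj_add n (x - c)
    rw [hx] at e1
    simp only [map_add, map_smul, inner_add_left, inner_add_right, inner_smul_left,
      inner_smul_right, conj_trivial] at e1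
    linear_combination e1 + e2

theorem IsAff.exists_factor (hn : ‖n‖ = 1) {q : E d → ℝ} (hq : IsAff q) {r : ℝ} (hr : 0 < r)
    (h0 : ∀ x ∈ Metric.ball c r, ⟪n, x - c⟫_ℝ = 0 → q x = 0) :
    ∃ κ : ℝ, ∀ x, q x = κ * ⟪n, x - c⟫_ℝ := by
  have hq' : IsAff (fun x => q (c + x)) := by simpa using hq.comp_dilation c 1
  have h1 := hq'.isQuad.comp_tangentProj_eq_zero hn hr (fun x hx hnx => h0 _ (by simpa using hx)
    (by simpa using hnx))
  obtain ⟨a, g, h⟩ := hq'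
  simp only at h
  refine ⟨⟪g, n⟫_ℝ, fun x => ?_⟩
  have e1 := h (x - c)
  have e2 := h1 (x - c)
  rw [h, tangentProj_apply, inner_sub_right, inner_smul_right] at e2
  rw [add_sub_cancel] at e1
  linear_combination e1 + e2

theorem IsAff.dirDeriv_eq (q : E d → ℝ) (hq : IsAff q) (v x : E d) :
    dirDeriv v q x = q (x + v) - q x := hq.fderiv_apply x v

theorem IsQuad.coordLaplacian_eq {w : E d → ℝ} (hw : IsQuad w) (x : E d) :
    coordLaplacian w x = ∑ k, (w (x + stdVec k) + w (x - stdVec k) - 2 * w x) :=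
  Finset.sum_congr rfl fun k _ => hw.fderiv_fderiv x (stdVec k)

theorem inner_stdVec (n : E d) (k : Fin d) : ⟪n, stdVec k⟫_ℝ = n k := by
  rw [real_inner_comm, EuclideanSpace.inner_single_left]; simp

/-- With `ℓ` the signed distance, `Δ(ℓ m) = 2 ∇ℓ · ∇m = 2 ∂ₙm = 0` and `Δ(κ ℓ²) = 2κ ‖n‖²`. -/
theorem coordLaplacian_factor (hn : ‖n‖ = 1) {w m : E d → ℝ} {κ : ℝ} (hw : IsQuad w)
    (hm : IsAff m) (hmn : ∀ x, dirDeriv n m x = 0)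
    (h : ∀ x, w x = ⟪n, x - c⟫_ℝ * m x + κ * ⟪n, x - c⟫_ℝ ^ 2) (x : E d) :
    coordLaplacian w x = 2 * κ := by
  rw [hw.coordLaplacian_eq]
  have hs : ∑ k, n k ^ 2 = 1 := by
    have := EuclideanSpace.real_norm_sq_eq n
    rw [hn] at this; linarith
  have hk : ∀ k, w (x + stdVec k) + w (x - stdVec k) - 2 * w x =
      2 * (n k * dirDeriv (stdVec k) m x) + 2 * κ * n k ^ 2 := by
    intro k
    have a1 : m (x + stdVec k) = m x + dirDeriv (stdVec k) m x := by
      rw [IsAff.dirDeriv_eq m hm]; ring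
    have a2 : m (x - stdVec k) = m x - dirDeriv (stdVec k) m x := by
      have h1 := IsAff.dirDeriv_eq m hm (stdVec k) (x - stdVec k)
      rw [sub_add_cancel] at h1
      have h2 : dirDeriv (stdVec k) m (x - stdVec k) = dirDeriv (stdVec k) m x := by
        rw [dirDeriv, dirDeriv, hm.fderiv_const, hm.fderiv_const]
      linarith
    have b1 : ⟪n, x + stdVec k - c⟫_ℝ = ⟪n, x - c⟫_ℝ + n k := by
      rw [add_sub_right_comm, inner_add_right, inner_stdVec]
    have b2 : ⟪n, x - stdVec k - c⟫_ℝ = ⟪n, x - c⟫_ℝ - n k := by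
      rw [sub_right_comm, inner_sub_right, inner_stdVec]
    rw [h, h, h, a1, a2, b1, b2]
    ring
  simp only [hk]
  rw [Finset.sum_add_distrib, ← Finset.mul_sum, ← Finset.mul_sum, ← dirDeriv_eq_sum, hmn, hs]
  ring

theorem dirDeriv_factor (hn : ‖n‖ = 1) {w m : E d → ℝ} {κ : ℝ} (hw : IsQuad w)
    (hm : IsAff m) (hmn : ∀ x, dirDeriv n m x = 0)
    (h : ∀ x, w x = ⟪n, x - c⟫_ℝ * m x + κ * ⟪n, x - c⟫_ℝ ^ 2) {x : E d}
    (hx : ⟪n, x - c⟫_ℝ = 0) : dirDeriv n w x = m x := by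
  have h1 := IsAff.dirDeriv_eq m hm n x
  have h2 := IsAff.dirDeriv_eq m hm n (x - n)
  rw [sub_add_cancel, hmn] at h2
  rw [hmn] at h1
  have hnn : ⟪n, n⟫_ℝ = 1 := by rw [real_inner_self_eq_norm_sq, hn]; norm_num
  have b1 : ⟪n, x + n - c⟫_ℝ = 1 := by rw [add_sub_right_comm, inner_add_right, hx, hnn]; ring
  have b2 : ⟪n, x - n - c⟫_ℝ = -1 := by rw [sub_right_comm, inner_sub_right, hx, hnn]; ring
  rw [dirDeriv, hw.fderiv_apply, h, h, b1, b2]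
  linarith

end Hyperplane

/-! ### Estimates on a ball -/

section BallEstimates

variable {d : ℕ}

/-- The state equation of the discrete fields, integrated by parts onto the test function. -/
noncomputable def discreteFunctional (c : E d) (r : ℝ) (i : Fin d) (yT : E d → E d) (pT : E d → ℝ)
    (uT : E d → E d) (φ : E d → ℝ) : ℝ :=
  (∫ x in Metric.ball c r, yT x i * coordLaplacian φ x) +
    (∫ x in Metric.ball c r, pT x * dirDeriv (stdVec i) φ x) +
    ∫ x in Metric.ball c r, uT x i * φ x

/-- The errors of the fields `yT`, `pT`, `uT` on `s` are bounded by `EY`, `EP`, `EU`. -/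
structure ErrorBound (s : Set (E d)) (y yT : E d → E d) (p pT : E d → ℝ) (u uT : E d → E d)
    (EY EP EU : ℝ) : Prop where
  nonneg : 0 ≤ EY
  y_le : ∀ i, ∀ᵐ x ∂(volume.restrict s), |yT x i - y x i| ≤ EY
  p_le : ∫ x in s, (pT x - p x) ^ 2 ≤ EP ^ 2
  u_le : ∀ i, ∫ x in s, (uT x i - u x i) ^ 2 ≤ EU ^ 2

/-- The fields are componentwise square integrable. -/
structure FieldsMemLp (s : Set (E d)) (y : E d → E d) (p : E d → ℝ) (u : E d → E d) : Prop where
  y : ∀ i, MemLp (fun x => y x i) 2 (volume.restrict s)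
  p : MemLp p 2 (volume.restrict s)
  u : ∀ i, MemLp (fun x => u x i) 2 (volume.restrict s)

theorem FieldsMemLp.mono {s t : Set (E d)} {y : E d → E d} {p : E d → ℝ} {u : E d → E d}
    (h : FieldsMemLp t y p u) (hst : s ⊆ t) : FieldsMemLp s y p u :=
  ⟨fun i => (h.y i).mono_measure (Measure.restrict_mono hst le_rfl),
    h.p.mono_measure (Measure.restrict_mono hst le_rfl),
    fun i => (h.u i).mono_measure (Measure.restrict_mono hst le_rfl)⟩

theorem integrable_mul_ball {e ψ : E d → ℝ} {c : E d} {r : ℝ}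
    (he : MemLp e 2 (volume.restrict (Metric.ball c r))) (hψ : Continuous ψ) :
    Integrable (fun x => e x * ψ x) (volume.restrict (Metric.ball c r)) :=
  he.integrable_mul (q := 2) (memLp_ball_of_continuous hψ c r)

theorem integral_sub_mul_ball {e e' ψ : E d → ℝ} {c : E d} {r : ℝ}
    (he : MemLp e 2 (volume.restrict (Metric.ball c r)))
    (he' : MemLp e' 2 (volume.restrict (Metric.ball c r))) (hψ : Continuous ψ) :
    ∫ x in Metric.ball c r, (e x - e' x) * ψ x =
      (∫ x in Metric.ball c r, e x * ψ x) - ∫ x in Metric.ball c r, e' x * ψ x := by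
  rw [← integral_sub (integrable_mul_ball he hψ) (integrable_mul_ball he' hψ)]
  simp only [sub_mul]

/-- The scaled size of the errors. -/
noncomputable def errorSize (d : ℕ) (r EY EP EU : ℝ) : ℝ :=
  r ^ (d - 2) * EY ^ 2 + EP ^ 2 + r ^ 2 * EU ^ 2

theorem errorSize_nonneg {r EY EP EU : ℝ} (hr : 0 ≤ r) : 0 ≤ errorSize d r EY EP EU := by
  unfold errorSize; positivity

variable {Ω : Set (E d)} {P : TrackingData d Ω} {y z u : E d → E d} {p q : E d → ℝ}

theorem testFunction_of_ball {c : E d} {r : ℝ} (hball : Metric.ball c r ⊆ Ω) {φ : E d → ℝ}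
    (hφ : ContDiff ℝ ∞ φ) (hs : tsupport φ ⊆ Metric.ball c r) : IsTestFunction Ω φ :=
  ⟨hφ, hasCompactSupport_of_tsupport_subset_ball hs, hs.trans hball⟩

theorem tsupport_coordLaplacian_subset (φ : E d → ℝ) :
    tsupport (coordLaplacian φ) ⊆ tsupport φ := by
  refine closure_minimal (fun x hx => ?_) (isClosed_tsupport φ)
  by_contra h
  exact hx (coordLaplacian_eq_zero h)

/-- The error representation: the exact fields give zero in the same functional, so the discrete
fields may be replaced by the differences, which `exists_testBound_error` bounds. -/
theorem exists_testBound_discreteFunctional (hd : 2 ≤ d) : ∃ C : ℝ, 0 < C ∧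
    ∀ {Ω : Set (E d)} {P : TrackingData d Ω} {y z u : E d → E d} {p q : E d → ℝ},
    IsOptimalitySystemSolution P y p z q u → IsOpen Ω →
    ∀ (c : E d) (r EY EP EU : ℝ) (yT : E d → E d) (pT : E d → ℝ) (uT : E d → E d) (i : Fin d),
    0 < r → Metric.ball c r ⊆ Ω → FieldsMemLp (Metric.ball c r) y p u →
    FieldsMemLp (Metric.ball c r) yT pT uT →
    ErrorBound (Metric.ball c r) y yT p pT u uT EY EP EU →
    TestBound c r (C * errorSize d r EY EP EU) (discreteFunctional c r i yT pT uT) := by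
  obtain ⟨C, hC, h⟩ := exists_testBound_error hd
  refine ⟨C, hC, ?_⟩
  intro Ω P y z u p q hsol hΩ c r EY EP EU yT pT uT i hr hball hf hfT he φ M h1 h2 h3 h4 h5
  have key := h c r EY EP EU (fun x => yT x i - y x i) (fun x => pT x - p x)
    (fun x => uT x i - u x i) i hr he.nonneg (he.y_le i) (hfT.p.sub hf.p) he.p_le
    ((hfT.u i).sub (hf.u i)) (he.u_le i) φ M h1 h2 h3 h4 h5
  simp only at key
  have hφ := testFunction_of_ball hball h1 h2
  have e := hsol.momentum_testFunction hΩ hφ i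
  rw [setIntegral_eq_setIntegral_of_tsupport ((tsupport_coordLaplacian_subset φ).trans hφ.2.2)
    ((tsupport_coordLaplacian_subset φ).trans h2),
    setIntegral_eq_setIntegral_of_tsupport (hφ.dirDeriv _).2.2
      ((tsupport_dirDeriv_subset _).trans h2),
    setIntegral_eq_setIntegral_of_tsupport hφ.2.2 h2] at e
  rw [integral_sub_mul_ball (hfT.y i) (hf.y i) (ContDiff.coordLaplacian h1).continuous,
    integral_sub_mul_ball hfT.p hf.p (ContDiff.dirDeriv h1 _).continuous,
    integral_sub_mul_ball (hfT.u i) (hf.u i) h1.continuous] at key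
  refine le_trans (le_of_eq ?_) key
  congr 1
  rw [discreteFunctional]
  linarith

theorem exists_testBound_discreteDiv (hd : 2 ≤ d) : ∃ C : ℝ, 0 < C ∧
    ∀ {Ω : Set (E d)} {P : TrackingData d Ω} {y z u : E d → E d} {p q : E d → ℝ},
    IsOptimalitySystemSolution P y p z q u →
    ∀ (c : E d) (r EY : ℝ) (yT : E d → E d), 0 < r → 0 ≤ EY → Metric.ball c r ⊆ Ω →
    (∀ i, MemLp (fun x => y x i) 2 (volume.restrict (Metric.ball c r))) →
    (∀ i, MemLp (fun x => yT x i) 2 (volume.restrict (Metric.ball c r))) →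
    (∀ i, ∀ᵐ x ∂(volume.restrict (Metric.ball c r)), |yT x i - y x i| ≤ EY) →
    TestBound c r (C * (r ^ d * EY ^ 2))
      (fun φ => ∑ i, ∫ x in Metric.ball c r, yT x i * dirDeriv (stdVec i) φ x) := by
  obtain ⟨C, hC, h⟩ := exists_testBound_div hd
  refine ⟨C, hC, ?_⟩
  intro Ω P y z u p q hsol c r EY yT hr hEY hball hf hfT he φ M h1 h2 h3 h4 h5
  have key := h c r EY (fun i x => yT x i - y x i) hr hEY he φ M h1 h2 h3 h4 h5
  have hφ := testFunction_of_ball hball h1 h2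
  have e := hsol.div_testFunction hφ
  simp only [integral_sub_mul_ball (hfT _) (hf _) (ContDiff.dirDeriv h1 _).continuous,
    Finset.sum_sub_distrib] at key
  have e' : ∑ i, ∫ x in Metric.ball c r, y x i * dirDeriv (stdVec i) φ x = 0 := by
    rw [← e]
    refine Finset.sum_congr rfl fun i _ => ?_
    exact setIntegral_eq_setIntegral_of_tsupport ((tsupport_dirDeriv_subset _).trans h2)
      (hφ.dirDeriv _).2.2
  rw [e', sub_zero] at key
  exact key

/-- The residual of fields with polynomial components `Y`, `Q`, `U`. -/
noncomputable def polyResidual (Y : Fin d → E d → ℝ) (Q : E d → ℝ) (U : Fin d → E d → ℝ)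
    (i : Fin d) (x : E d) : ℝ :=
  U i x + coordLaplacian (Y i) x - dirDeriv (stdVec i) Q x

/-- The divergence of the field with components `Y`. -/
noncomputable def polyDiv (Y : Fin d → E d → ℝ) (x : E d) : ℝ :=
  ∑ i, dirDeriv (stdVec i) (Y i) x

/-- On `s`, the fields are given by the polynomials `Y`, `Q`, `U`. -/
structure IsPolyOn (s : Set (E d)) (yT : E d → E d) (pT : E d → ℝ) (uT : E d → E d)
    (Y : Fin d → E d → ℝ) (Q : E d → ℝ) (U : Fin d → E d → ℝ) : Prop where
  isQuad_y : ∀ i, IsQuad (Y i)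
  isAff_p : IsAff Q
  isQuad_u : ∀ i, IsQuad (U i)
  y_eq : ∀ x ∈ s, ∀ i, yT x i = Y i x
  p_eq : ∀ x ∈ s, pT x = Q x
  u_eq : ∀ x ∈ s, ∀ i, uT x i = U i x

theorem IsPolyOn.mono {s t : Set (E d)} {yT : E d → E d} {pT : E d → ℝ} {uT : E d → E d}
    {Y : Fin d → E d → ℝ} {Q : E d → ℝ} {U : Fin d → E d → ℝ} (h : IsPolyOn t yT pT uT Y Q U)
    (hst : s ⊆ t) : IsPolyOn s yT pT uT Y Q U :=
  ⟨h.isQuad_y, h.isAff_p, h.isQuad_u, fun x hx => h.y_eq x (hst hx),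
    fun x hx => h.p_eq x (hst hx), fun x hx => h.u_eq x (hst hx)⟩

theorem IsQuad.coordLaplacian_const {w : E d → ℝ} (hw : IsQuad w) (x : E d) :
    coordLaplacian w x = coordLaplacian w 0 := by
  refine Finset.sum_congr rfl fun k _ => ?_
  have := hw.isAff_fderiv (stdVec k)
  exact (this.fderiv_const x (stdVec k)).trans (this.fderiv_const 0 (stdVec k)).symm

theorem IsPolyOn.isQuad_residual {s : Set (E d)} {yT : E d → E d} {pT : E d → ℝ} {uT : E d → E d}
    {Y : Fin d → E d → ℝ} {Q : E d → ℝ} {U : Fin d → E d → ℝ} (h : IsPolyOn s yT pT uT Y Q U)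
    (i : Fin d) : IsQuad (polyResidual Y Q U i) := by
  have h1 : IsQuad (coordLaplacian (Y i)) := by
    rw [funext (h.isQuad_y i).coordLaplacian_const]; exact isQuad_const _
  exact ((h.isQuad_u i).add h1).sub (h.isAff_p.isQuad.isAff_fderiv _).isQuad

theorem IsPolyOn.isAff_div {s : Set (E d)} {yT : E d → E d} {pT : E d → ℝ} {uT : E d → E d}
    {Y : Fin d → E d → ℝ} {Q : E d → ℝ} {U : Fin d → E d → ℝ} (h : IsPolyOn s yT pT uT Y Q U) :
    IsAff (polyDiv Y) :=
  IsAff.sum _ fun i _ => (h.isQuad_y i).isAff_fderiv _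

theorem integral_residual_mul {Y : Fin d → E d → ℝ} {Q : E d → ℝ} {U : Fin d → E d → ℝ}
    (hY : ∀ i, IsQuad (Y i)) (hQ : IsAff Q) (hU : ∀ i, IsQuad (U i)) {φ : E d → ℝ}
    (hφ : ContDiff ℝ ∞ φ) (hs : HasCompactSupport φ) (i : Fin d) :
    (∫ x, Y i x * coordLaplacian φ x) + (∫ x, Q x * dirDeriv (stdVec i) φ x) + ∫ x, U i x * φ x =
      ∫ x, polyResidual Y Q U i x * φ x := by
  have c1 : Continuous (coordLaplacian (Y i)) :=
    (ContDiff.coordLaplacian (hY i).contDiff).continuous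
  have c2 : Continuous (dirDeriv (stdVec i) Q) := (ContDiff.dirDeriv hQ.contDiff _).continuous
  rw [integral_mul_coordLaplacian (hY i).contDiff hφ hs, integral_mul_dirDeriv hQ.contDiff hφ hs]
  have i1 := integrable_mul_of_hasCompactSupport c1 hφ.continuous hs
  have i2 := integrable_mul_of_hasCompactSupport c2 hφ.continuous hs
  have i3 := integrable_mul_of_hasCompactSupport (hU i).continuous hφ.continuous hs
  have e : ∀ x, polyResidual Y Q U i x * φ x =
      (coordLaplacian (Y i) x * φ x - dirDeriv (stdVec i) Q x * φ x) + U i x * φ x := fun x => by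
    simp only [polyResidual]; ring
  simp only [e]
  have i12 : Integrable (fun x => coordLaplacian (Y i) x * φ x -
    dirDeriv (stdVec i) Q x * φ x) := i1.sub i2
  rw [integral_add i12 i3, integral_sub i1 i2]
  ring

theorem exists_polyResidual_bound (hd : 2 ≤ d) (R : ℝ) : ∃ C : ℝ, 0 < C ∧
    ∀ {Ω : Set (E d)} {P : TrackingData d Ω} {y z u : E d → E d} {p q : E d → ℝ},
    IsOptimalitySystemSolution P y p z q u → IsOpen Ω →
    ∀ (c : E d) (r EY EP EU : ℝ) (yT : E d → E d) (pT : E d → ℝ) (uT : E d → E d)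
      (Y : Fin d → E d → ℝ) (Q : E d → ℝ) (U : Fin d → E d → ℝ),
    0 < r → Metric.ball c r ⊆ Ω → FieldsMemLp (Metric.ball c r) y p u →
    FieldsMemLp (Metric.ball c r) yT pT uT →
    ErrorBound (Metric.ball c r) y yT p pT u uT EY EP EU →
    IsPolyOn (Metric.ball c r) yT pT uT Y Q U → ∀ x ∈ Metric.closedBall c (R * r),
      (∀ i, r ^ (d + 2) * polyResidual Y Q U i x ^ 2 ≤ C * errorSize d r EY EP EU) ∧
      r ^ d * polyDiv Y x ^ 2 ≤ C * errorSize d r EY EP EU := by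
  obtain ⟨C₁, hC₁, h₁⟩ := exists_testBound_discreteFunctional hd
  obtain ⟨C₂, hC₂, h₂⟩ := exists_testBound_discreteDiv hd
  obtain ⟨C₃, hC₃, h₃⟩ := exists_residual_bound hd R
  refine ⟨C₃ * C₁ + C₃ * C₂, by positivity, ?_⟩
  intro Ω P y z u p q hsol hΩ c r EY EP EU yT pT uT Y Q U hr hball hf hfT he hpoly x hx
  have hE := errorSize_nonneg (d := d) (EY := EY) (EP := EP) (EU := EU) hr.le
  have hmeas : MeasurableSet (Metric.ball c r) := Metric.isOpen_ball.measurableSet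
  constructor
  · intro i
    have b := h₃ _ c r _ _ (hpoly.isQuad_residual i) hr (by positivity)
      (h₁ hsol hΩ c r EY EP EU yT pT uT i hr hball hf hfT he) (fun φ hφ hs => by
        rw [← integral_residual_mul hpoly.isQuad_y hpoly.isAff_p hpoly.isQuad_u hφ
          (hasCompactSupport_of_tsupport_subset_ball hs), discreteFunctional]
        congr 1
        · congr 1
          · rw [← setIntegral_eq_integral_of_tsupport
              ((tsupport_coordLaplacian_subset φ).trans hs)]
            exact setIntegral_congr_fun hmeas fun x hx => by simp only [hpoly.y_eq x hx]
          · rw [← setIntegral_eq_integral_of_tsupport ((tsupport_dirDeriv_subset _).trans hs)]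
            exact setIntegral_congr_fun hmeas fun x hx => by simp only [hpoly.p_eq x hx]
        · rw [← setIntegral_eq_integral_of_tsupport hs]
          exact setIntegral_congr_fun hmeas fun x hx => by simp only [hpoly.u_eq x hx]) x hx
    refine b.trans ?_
    nlinarith [mul_nonneg (mul_nonneg hC₃.le hC₂.le) hE]
  -- The sign comes from the integration by parts. The functional bound `r ^ d * EY ^ 2` is `r ^ 2`
  -- times the first term of `errorSize`, and this factor cancels against `r ^ (d + 2)`.
  · have b := h₃ (fun x => -polyDiv Y x) c r _ _
      (by simpa using (hpoly.isAff_div.isQuad.const_mul (-1))) hr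
      (by positivity) (h₂ hsol c r EY yT hr he.nonneg hball hf.y hfT.y he.y_le) (fun φ hφ hs => by
        have hcs := hasCompactSupport_of_tsupport_subset_ball hs
        have e : ∀ x, -polyDiv Y x * φ x = ∑ i, -(dirDeriv (stdVec i) (Y i) x * φ x) := fun x => by
          rw [polyDiv, neg_mul, Finset.sum_mul, Finset.sum_neg_distrib]
        simp only [e]
        rw [integral_finsetSum]
        · refine Finset.sum_congr rfl fun i _ => ?_
          rw [integral_neg, ← integral_mul_dirDeriv (hpoly.isQuad_y i).contDiff hφ hcs,
            ← setIntegral_eq_integral_of_tsupport ((tsupport_dirDeriv_subset _).trans hs)]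
          exact setIntegral_congr_fun hmeas fun x hx => by simp only [hpoly.y_eq x hx]
        · exact fun i _ => (integrable_mul_of_hasCompactSupport
            (ContDiff.dirDeriv (hpoly.isQuad_y i).contDiff _).continuous hφ.continuous hcs).neg)
      x hx
    have hr2 : 0 < r ^ 2 := by positivity
    have hrd : r ^ d = r ^ (d - 2) * r ^ 2 := by rw [← pow_add]; congr 1; omega
    have b' : r ^ 2 * (r ^ d * polyDiv Y x ^ 2) ≤ r ^ 2 * (C₃ * C₂ * (r ^ (d - 2) * EY ^ 2)) := by
      refine le_trans (le_of_eq ?_) (b.trans (le_of_eq ?_))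
      · rw [pow_add, neg_sq]; ring
      · rw [hrd]; ring
    refine (le_of_mul_le_mul_left b' hr2).trans ?_
    have : r ^ (d - 2) * EY ^ 2 ≤ errorSize d r EY EP EU := by
      unfold errorSize
      nlinarith [sq_nonneg EP, mul_nonneg hr2.le (sq_nonneg EU)]
    calc _ ≤ C₃ * C₂ * errorSize d r EY EP EU := by gcongr
      _ ≤ _ := by nlinarith [mul_nonneg (mul_nonneg hC₃.le hC₁.le) hE]

end BallEstimates

/-! ### Normal derivative jumps across a hyperplane -/

section JumpEstimate

variable {d : ℕ}

theorem le_of_mem_halfSpace {n c x : E d} (h : x ∈ halfSpace n c) : 0 ≤ ⟪n, x - c⟫_ℝ :=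
  le_of_lt h

theorem le_of_notMem_halfSpace {n c x : E d} (h : x ∉ halfSpace n c) : ⟪n, x - c⟫_ℝ ≤ 0 :=
  not_lt.1 h

theorem setIntegral_piecewise_mul {n c : E d} {r : ℝ} {f F F' ψ : E d → ℝ}
    (hF : Continuous F) (hF' : Continuous F') (hψ : Continuous ψ)
    (hs : tsupport ψ ⊆ Metric.ball c r)
    (h : ∀ x ∈ Metric.ball c r, x ∈ halfSpace n c → f x = F x)
    (h' : ∀ x ∈ Metric.ball c r, x ∉ halfSpace n c → f x = F' x) :
    ∫ x in Metric.ball c r, f x * ψ x =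
      (∫ x, F' x * ψ x) + ∫ x in halfSpace n c, (F x - F' x) * ψ x := by
  have hcs := hasCompactSupport_of_tsupport_subset_ball hs
  have hmeas := (isOpen_halfSpace n c).measurableSet
  have i1 := integrable_mul_of_hasCompactSupport hF' hψ hcs
  have i2 : Integrable ((halfSpace n c).indicator fun x => (F x - F' x) * ψ x) :=
    (integrable_mul_of_hasCompactSupport (hF.sub hF') hψ hcs).indicator hmeas
  rw [← integral_indicator hmeas, ← integral_add i1 i2,
    ← integral_indicator Metric.isOpen_ball.measurableSet]
  congr 1
  ext x
  by_cases hx : x ∈ Metric.ball c r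
  · rw [Set.indicator_of_mem hx]
    by_cases hxH : x ∈ halfSpace n c
    · rw [Set.indicator_of_mem hxH, h x hx hxH]; ring
    · rw [Set.indicator_of_notMem hxH, h' x hx hxH, add_zero]
  · have h0 : ψ x = 0 := image_eq_zero_of_notMem_tsupport fun h => hx (hs h)
    rw [Set.indicator_of_notMem hx, h0]
    by_cases hxH : x ∈ halfSpace n c
    · rw [Set.indicator_of_mem hxH]; simp [h0]
    · rw [Set.indicator_of_notMem hxH]; simp

theorem dirDeriv_sub {f g : E d → ℝ} (hf : ContDiff ℝ ∞ f) (hg : ContDiff ℝ ∞ g) (v x : E d) :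
    dirDeriv v (fun x => f x - g x) x = dirDeriv v f x - dirDeriv v g x := by
  have hf' := hf.differentiable (by simp) x
  have hg' := hg.differentiable (by simp) x
  simp only [dirDeriv, fderiv_fun_sub hf' hg', _root_.sub_apply]

theorem coordLaplacian_sub {f g : E d → ℝ} (hf : ContDiff ℝ ∞ f) (hg : ContDiff ℝ ∞ g) (x : E d) :
    coordLaplacian (fun x => f x - g x) x = coordLaplacian f x - coordLaplacian g x := by
  rw [coordLaplacian, coordLaplacian, coordLaplacian, ← Finset.sum_sub_distrib]
  refine Finset.sum_congr rfl fun k _ => ?_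
  rw [show dirDeriv (stdVec k) (fun x => f x - g x) =
    fun x => dirDeriv (stdVec k) f x - dirDeriv (stdVec k) g x from
    funext fun x => dirDeriv_sub hf hg _ x]
  exact dirDeriv_sub (ContDiff.dirDeriv hf _) (ContDiff.dirDeriv hg _) _ x

/-- The differences of the pieces are `ℓ m + κ ℓ²` for the velocity and `κ' ℓ` for the pressure,
where `ℓ` is the signed distance, because both fields are continuous across the hyperplane. The
resulting multiples `2κ` and `κ' nᵢ` of `∫ φ` over the half space are exactly the difference of the
two residuals, apart from the control; only the term with `m` survives the subtraction. -/
theorem discreteFunctional_sub_residual {n c : E d} (hn : ‖n‖ = 1) {r : ℝ} (hr : 0 < r)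
    {yT : E d → E d} {pT : E d → ℝ} {uT : E d → E d}
    {Y Y' : Fin d → E d → ℝ} {Q Q' : E d → ℝ} {U U' : Fin d → E d → ℝ}
    (h : IsPolyOn (Metric.ball c r ∩ {x | 0 ≤ ⟪n, x - c⟫_ℝ}) yT pT uT Y Q U)
    (h' : IsPolyOn (Metric.ball c r ∩ {x | ⟪n, x - c⟫_ℝ ≤ 0}) yT pT uT Y' Q' U') (i : Fin d)
    {g : E d → ℝ}
    (hg : ∀ x ∈ Metric.ball c r, x ∈ halfSpace n c → g x = polyResidual Y Q U i x)
    (hg' : ∀ x ∈ Metric.ball c r, x ∉ halfSpace n c → g x = polyResidual Y' Q' U' i x) :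
    ∃ m : E d → ℝ, IsAff m ∧ (∀ x, dirDeriv n m x = 0) ∧
      (∀ x, ⟪n, x - c⟫_ℝ = 0 → dirDeriv n (Y i) x - dirDeriv n (Y' i) x = m x) ∧
      ∀ φ, ContDiff ℝ ∞ φ → tsupport φ ⊆ Metric.ball c r →
        discreteFunctional c r i yT pT uT φ - ∫ x in Metric.ball c r, g x * φ x =
          -∫ x in halfSpace n c, m x * dirDeriv n φ x := by
  have hn0 : n ≠ 0 := by rintro rfl; simp at hn
  have hw : IsQuad (fun x => Y i x - Y' i x) := (h.isQuad_y i).sub (h'.isQuad_y i)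
  have hq : IsAff (fun x => Q x - Q' x) := h.isAff_p.sub h'.isAff_p
  obtain ⟨m, κ, hm, hmn, hwm⟩ := hw.exists_factor hn hr (c := c) fun x hx hx0 => by
    rw [← h.y_eq x ⟨hx, hx0.ge⟩, ← h'.y_eq x ⟨hx, hx0.le⟩, sub_self]
  obtain ⟨κ', hqm⟩ := hq.exists_factor hn hr (c := c) fun x hx hx0 => by
    rw [← h.p_eq x ⟨hx, hx0.ge⟩, ← h'.p_eq x ⟨hx, hx0.le⟩, sub_self]
  have hlap : ∀ x, coordLaplacian (Y i) x - coordLaplacian (Y' i) x = 2 * κ := fun x => by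
    rw [← coordLaplacian_sub (h.isQuad_y i).contDiff (h'.isQuad_y i).contDiff]
    exact coordLaplacian_factor hn hw hm hmn hwm x
  have hdq : ∀ x, dirDeriv (stdVec i) Q x - dirDeriv (stdVec i) Q' x = κ' * n i := fun x => by
    rw [← dirDeriv_sub h.isAff_p.contDiff h'.isAff_p.contDiff, IsAff.dirDeriv_eq _ hq, hqm, hqm,
      add_sub_right_comm, inner_add_right, inner_stdVec]
    ring
  refine ⟨m, hm, hmn, fun x hx => ?_, fun φ hφ hs => ?_⟩
  · rw [← dirDeriv_sub (h.isQuad_y i).contDiff (h'.isQuad_y i).contDiff]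
    exact dirDeriv_factor hn hw hm hmn hwm hx
  have hcs := hasCompactSupport_of_tsupport_subset_ball hs
  have eY := setIntegral_piecewise_mul (f := fun x => yT x i) (h.isQuad_y i).continuous
    (h'.isQuad_y i).continuous (ContDiff.coordLaplacian hφ).continuous
    ((tsupport_coordLaplacian_subset φ).trans hs)
    (fun x hx hxH => h.y_eq x ⟨hx, le_of_mem_halfSpace hxH⟩ i) (fun x hx hxH => h'.y_eq x ⟨hx, le_of_notMem_halfSpace hxH⟩ i)
  have eQ := setIntegral_piecewise_mul (f := pT) h.isAff_p.isQuad.continuous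
    h'.isAff_p.isQuad.continuous (ContDiff.dirDeriv hφ (stdVec i)).continuous
    ((tsupport_dirDeriv_subset _).trans hs)
    (fun x hx hxH => h.p_eq x ⟨hx, le_of_mem_halfSpace hxH⟩) (fun x hx hxH => h'.p_eq x ⟨hx, le_of_notMem_halfSpace hxH⟩)
  have eU := setIntegral_piecewise_mul (f := fun x => uT x i) (h.isQuad_u i).continuous
    (h'.isQuad_u i).continuous hφ.continuous hs
    (fun x hx hxH => h.u_eq x ⟨hx, le_of_mem_halfSpace hxH⟩ i) (fun x hx hxH => h'.u_eq x ⟨hx, le_of_notMem_halfSpace hxH⟩ i)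
  have eG := setIntegral_piecewise_mul (h.isQuad_residual i).continuous
    (h'.isQuad_residual i).continuous hφ.continuous hs hg hg'
  have eR := integral_residual_mul h'.isQuad_y h'.isAff_p h'.isQuad_u hφ hcs i
  have eL : ∫ x in halfSpace n c, (Y i x - Y' i x) * coordLaplacian φ x =
      -(∫ x in halfSpace n c, m x * dirDeriv n φ x) + 2 * κ * ∫ x in halfSpace n c, φ x := by
    simp only [hwm]
    exact integral_halfSpace_mul_coordLaplacian hn c hm hmn κ hφ hcs
  have eP : ∫ x in halfSpace n c, (Q x - Q' x) * dirDeriv (stdVec i) φ x =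
      -(κ' * n i) * ∫ x in halfSpace n c, φ x := by
    have := inner_mul_integral_halfSpace hn0 c (stdVec i) hφ hcs
    rw [inner_stdVec] at this
    simp only [hqm, mul_assoc]
    rw [integral_const_mul]
    linear_combination κ' * this
  have eD : ∫ x in halfSpace n c, (polyResidual Y Q U i x - polyResidual Y' Q' U' i x) * φ x =
      (∫ x in halfSpace n c, (U i x - U' i x) * φ x) +
        (2 * κ - κ' * n i) * ∫ x in halfSpace n c, φ x := by
    have i1 : IntegrableOn (fun x => (U i x - U' i x) * φ x) (halfSpace n c) :=
      (integrable_mul_of_hasCompactSupport ((h.isQuad_u i).continuous.sub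
        (h'.isQuad_u i).continuous) hφ.continuous hcs).integrableOn
    have hφi : Integrable φ := hφ.continuous.integrable_of_hasCompactSupport hcs
    have i2 := (hφi.const_mul (2 * κ - κ' * n i)).integrableOn (s := halfSpace n c)
    rw [← integral_const_mul, ← integral_add i1 i2]
    congr 1
    ext x
    simp only [polyResidual]
    linear_combination φ x * hlap x - φ x * hdq x
  rw [discreteFunctional, eY, eQ, eU, eG, eL, eP, eD, ← eR]
  ring

/-- Subtracting the piecewise residual costs `r ^ (d + 2) * M ^ 2` in `TestBound`, a quantity of the
order of the error once the residuals are estimated. -/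
theorem exists_polyJump_bound (hd : 2 ≤ d) (R : ℝ) : ∃ C : ℝ, 0 < C ∧
    ∀ {Ω : Set (E d)} {P : TrackingData d Ω} {y z u : E d → E d} {p q : E d → ℝ},
    IsOptimalitySystemSolution P y p z q u → IsOpen Ω →
    ∀ (n c : E d) (r EY EP EU M : ℝ) (yT : E d → E d) (pT : E d → ℝ) (uT : E d → E d)
      (Y : Fin d → E d → ℝ) (Q : E d → ℝ) (U : Fin d → E d → ℝ)
      (Y' : Fin d → E d → ℝ) (Q' : E d → ℝ) (U' : Fin d → E d → ℝ),
    ‖n‖ = 1 → 0 < r → Metric.ball c r ⊆ Ω → FieldsMemLp (Metric.ball c r) y p u →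
    FieldsMemLp (Metric.ball c r) yT pT uT →
    ErrorBound (Metric.ball c r) y yT p pT u uT EY EP EU →
    IsPolyOn (Metric.ball c r ∩ {x | 0 ≤ ⟪n, x - c⟫_ℝ}) yT pT uT Y Q U →
    IsPolyOn (Metric.ball c r ∩ {x | ⟪n, x - c⟫_ℝ ≤ 0}) yT pT uT Y' Q' U' →
    0 ≤ M → (∀ i, ∀ x ∈ Metric.ball c r, |polyResidual Y Q U i x| ≤ M) →
    (∀ i, ∀ x ∈ Metric.ball c r, |polyResidual Y' Q' U' i x| ≤ M) →
    ∀ i, ∀ x ∈ Metric.closedBall c (R * r), ⟪n, x - c⟫_ℝ = 0 →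
      r ^ d * (dirDeriv n (Y i) x - dirDeriv n (Y' i) x) ^ 2 ≤
        C * (errorSize d r EY EP EU + r ^ (d + 2) * M ^ 2) := by
  classical
  obtain ⟨C₁, hC₁, h₁⟩ := exists_testBound_discreteFunctional hd
  obtain ⟨C₂, hC₂, h₂⟩ := exists_testBound_of_bound hd
  obtain ⟨C₃, hC₃, h₃⟩ := exists_jump_bound hd R
  refine ⟨C₃ * (2 * (C₁ + C₂)), by positivity, ?_⟩
  intro Ω P y z u p q hsol hΩ n c r EY EP EU M yT pT uT Y Q U Y' Q' U' hn hr hball hf hfT he hp hp'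
    hM hb hb' i x hx hx0
  have hE := errorSize_nonneg (d := d) (EY := EY) (EP := EP) (EU := EU) hr.le
  set g : E d → ℝ := fun x => if x ∈ halfSpace n c then polyResidual Y Q U i x
    else polyResidual Y' Q' U' i x with hg
  obtain ⟨m, hm, hmn, hmeq, hrep⟩ := discreteFunctional_sub_residual hn hr hp hp' i (g := g)
    (fun x _ hx => if_pos hx) (fun x _ hx => if_neg hx)
  have b := h₃ m n c r _ _ hm hn hmn hr (by positivity)
    ((h₁ hsol hΩ c r EY EP EU yT pT uT i hr hball hf hfT he).sub
      (h₂ c r M g hr hM (by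
        filter_upwards [ae_restrict_mem Metric.isOpen_ball.measurableSet] with x hx
        simp only [hg]
        split_ifs
        · exact hb i x hx
        · exact hb' i x hx))) hrep x hx
  rw [hmeq x hx0]
  refine b.trans ?_
  have hM2 : 0 ≤ r ^ (d + 2) * M ^ 2 := by positivity
  calc C₃ * (2 * (C₁ * errorSize d r EY EP EU + C₂ * (r ^ (d + 2) * M ^ 2)))
      ≤ C₃ * (2 * ((C₁ + C₂) * errorSize d r EY EP EU + (C₁ + C₂) * (r ^ (d + 2) * M ^ 2))) := by
        gcongr <;> linarith
    _ = _ := by ring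

end JumpEstimate

/-! ### Barycentric coordinates -/

section Barycentric

variable {d : ℕ}

theorem isAff_affineMap (f : E d →ᵃ[ℝ] ℝ) : IsAff f := by
  refine ⟨f 0, (InnerProductSpace.toDual ℝ (E d)).symm f.linear.toContinuousLinearMap, fun x => ?_⟩
  rw [InnerProductSpace.toDual_symm_apply]
  have h : f x = f.linear x + f 0 := congrFun f.decomp x
  rw [h, add_comm]
  rfl

theorem IsAff.map_sum {f : E d → ℝ} (hf : IsAff f) {ι : Type*} (s : Finset ι) (w : ι → ℝ)
    (p : ι → E d) (hw : ∑ i ∈ s, w i = 1) : f (∑ i ∈ s, w i • p i) = ∑ i ∈ s, w i * f (p i) := by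
  obtain ⟨c, g, h⟩ := hf
  simp only [h, inner_sum, inner_smul_right, mul_add, Finset.sum_add_distrib]
  rw [← Finset.sum_mul, hw, one_mul]

open Classical in
/-- `l v`, for `v ∈ T`, are the barycentric coordinates of the simplex `T`. -/
structure IsBarycentric (T : Finset (E d)) (l : E d → E d → ℝ) : Prop where
  isAff : ∀ v, IsAff (l v)
  apply_vertex : ∀ v ∈ T, ∀ w ∈ T, l v w = if v = w then 1 else 0
  mem_iff : ∀ x, x ∈ simplex T ↔ ∀ v ∈ T, 0 ≤ l v x
  sum_eq_one : ∀ x, ∑ v ∈ T, l v x = 1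
  sum_smul : ∀ x, ∑ v ∈ T, l v x • v = x

theorem exists_isBarycentric {T : Finset (E d)} (hcard : T.card = d + 1)
    (hind : AffineIndependent ℝ ((↑) : T → E d)) : ∃ l, IsBarycentric T l := by
  classical
  have htop : affineSpan ℝ (Set.range ((↑) : T → E d)) = ⊤ := by
    rw [hind.affineSpan_eq_top_iff_card_eq_finrank_add_one]
    simp [hcard]
  let b : AffineBasis T ℝ (E d) := ⟨_, hind, htop⟩
  have hb : ∀ v : T, b v = v := fun v => rfl
  have hrange : Set.range b = (T : Set (E d)) := by
    change Set.range ((↑) : T → E d) = _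
    simp
  -- The coordinates of the affine basis formed by the vertices; the default `0` off `T` keeps every
  -- `l v` affine.
  refine ⟨fun v => if h : v ∈ T then b.coord ⟨v, h⟩ else fun _ => 0, ?_, ?_, ?_, ?_, ?_⟩
  · intro v
    by_cases h : v ∈ T
    · simp only [h, dite_true]; exact isAff_affineMap _
    · simp only [h, dite_false]; exact isAff_const 0
  · intro v hv w hw
    simp only [hv, dite_true]
    have := b.coord_apply ⟨v, hv⟩ ⟨w, hw⟩
    rw [hb] at this
    rw [this]
    simp
  · intro x
    rw [simplex, ← hrange, b.convexHull_eq_nonneg_coord]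
    simp only [Set.mem_ofPred_eq, Subtype.forall]
    exact forall₂_congr fun v hv => by simp [hv]
  · intro x
    rw [← Finset.sum_coe_sort, ← b.sum_coord_apply_eq_one x]
    exact Finset.sum_congr rfl fun v _ => by simp
  · intro x
    conv_rhs => rw [← b.linear_combination_coord_eq_self x]
    rw [← Finset.sum_coe_sort T (fun v => (if h : v ∈ T then ⇑(b.coord ⟨v, h⟩) else fun _ => 0) x • v)]
    exact Finset.sum_congr rfl fun v _ => by simp [hb]

variable {T S : Finset (E d)} {l : E d → E d → ℝ}

theorem IsBarycentric.apply_self (h : IsBarycentric T l) {v : E d} (hv : v ∈ T) : l v v = 1 := by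
  simp [h.apply_vertex v hv v hv]

theorem IsBarycentric.apply_ne (h : IsBarycentric T l) {v w : E d} (hv : v ∈ T) (hw : w ∈ T)
    (hvw : v ≠ w) : l v w = 0 := by
  simp [h.apply_vertex v hv w hw, hvw]

theorem IsBarycentric.aff_eq_sum (h : IsBarycentric T l) {f : E d → ℝ} (hf : IsAff f) (x : E d) :
    f x = ∑ v ∈ T, l v x * f v := by
  conv_lhs => rw [← h.sum_smul x]
  exact hf.map_sum T (fun v => l v x) id (h.sum_eq_one x)

theorem IsBarycentric.aff_eq_of_eq_zero (h : IsBarycentric T l) {f : E d → ℝ} (hf : IsAff f)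
    {v : E d} (hv : v ∈ T) (h0 : ∀ w ∈ T, w ≠ v → f w = 0) (x : E d) : f x = l v x * f v := by
  rw [h.aff_eq_sum hf x, Finset.sum_eq_single v]
  · intro w hw hwv; rw [h0 w hw hwv, mul_zero]
  · exact fun h' => absurd hv h'

theorem IsBarycentric.le_one (h : IsBarycentric T l) {v x : E d} (hv : v ∈ T)
    (hx : x ∈ simplex T) : l v x ≤ 1 := by
  rw [← h.sum_eq_one x]
  exact Finset.single_le_sum (f := fun v => l v x) (fun w hw => (h.mem_iff x).1 hx w hw) hv

theorem IsAff.sub_eq_inner {f : E d → ℝ} (hf : IsAff f) : ∃ g : E d, ∀ x y, f x - f y = ⟪g, x - y⟫_ℝ := by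
  obtain ⟨c, g, h⟩ := hf
  exact ⟨g, fun x y => by rw [h, h, inner_sub_right]; ring⟩

/-- An affine function with values in `[0, 1]` on a ball of diameter `2r` has a gradient of norm at
most `1 / (2r)`. -/
theorem IsBarycentric.abs_sub_le (h : IsBarycentric T l) {c : E d} {r : ℝ} (hr : 0 < r)
    (hc : Metric.closedBall c r ⊆ simplex T) {v : E d} (hv : v ∈ T) (x y : E d) :
    |l v x - l v y| ≤ ‖x - y‖ / (2 * r) := by
  obtain ⟨g, hg⟩ := (h.isAff v).sub_eq_inner
  have hb : ∀ e : E d, ‖e‖ = 1 → ⟪g, e⟫_ℝ ≤ 1 / (2 * r) := by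
    intro e he
    have m1 : c + r • e ∈ simplex T := hc (by simp [norm_smul, he, abs_of_pos hr])
    have m2 : c - r • e ∈ simplex T := hc (by simp [norm_smul, he, abs_of_pos hr])
    have h1 := hg (c + r • e) (c - r • e)
    have h2 := h.le_one hv m1
    have h3 := (h.mem_iff _).1 m2 v hv
    rw [show c + r • e - (c - r • e) = (2 * r) • e by rw [mul_smul, two_smul]; abel,
      inner_smul_right] at h1
    rw [le_div_iff₀ (by positivity)]
    linarith
  rcases eq_or_ne x y with rfl | hxy
  · simp
  have hpos : 0 < ‖x - y‖ := norm_pos_iff.2 (sub_ne_zero.2 hxy)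
  have hn : ‖‖x - y‖⁻¹ • (x - y)‖ = 1 := by
    rw [norm_smul, norm_inv, norm_norm, inv_mul_cancel₀ hpos.ne']
  have b1 := hb _ hn
  have b2 := hb (-(‖x - y‖⁻¹ • (x - y))) (by rw [norm_neg, hn])
  rw [inner_neg_right] at b2
  rw [inner_smul_right] at b1 b2
  rw [hg, abs_le]
  have e : ‖x - y‖ / (2 * r) = ‖x - y‖ * (1 / (2 * r)) := by ring
  have e2 : ⟪g, x - y⟫_ℝ = ‖x - y‖ * (‖x - y‖⁻¹ * ⟪g, x - y⟫_ℝ) := by field_simp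
  rw [e, e2]
  constructor
  · nlinarith
  · nlinarith

theorem isCompact_simplex (T : Finset (E d)) : IsCompact (simplex T) :=
  Set.Finite.isCompact_convexHull (𝕜 := ℝ) T.finite_toSet

theorem vertex_mem_simplex {v : E d} (hv : v ∈ T) : v ∈ simplex T :=
  subset_convexHull ℝ _ hv

theorem simplex_mono (h : S ⊆ T) : simplex S ⊆ simplex T :=
  convexHull_mono (by exact_mod_cast h)

theorem dist_le_size {x y : E d} (hx : x ∈ simplex T) (hy : y ∈ simplex T) : dist x y ≤ size T :=
  Metric.dist_le_diam_of_mem (isCompact_simplex T).isBounded hx hy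

/-- The inball of an element is no larger than any element with which it shares an edge. -/
theorem IsBarycentric.two_mul_le_size (h : IsBarycentric T l) {c : E d} {r : ℝ} (hr : 0 < r)
    (hc : Metric.closedBall c r ⊆ simplex T) {T' : Finset (E d)} (hS : S ⊆ T) (hS' : S ⊆ T')
    (h2 : 2 ≤ S.card) : 2 * r ≤ size T' := by
  -- The coordinate of `a` falls from `1` to `0` between the common vertices `a` and `b`, so these
  -- are at least `2r` apart.
  obtain ⟨a, ha, b, hb, hab⟩ := Finset.one_lt_card.1 (show 1 < S.card by omega)
  have h1 := h.abs_sub_le hr hc (hS ha) a b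
  rw [h.apply_self (hS ha), h.apply_ne (hS ha) (hS hb) hab, sub_zero, abs_one,
    le_div_iff₀ (by positivity), one_mul, ← dist_eq_norm] at h1
  exact h1.trans (dist_le_size (vertex_mem_simplex (hS' ha)) (vertex_mem_simplex (hS' hb)))

/-! ### Sides and normals -/

/-- The barycenter of a side. -/
noncomputable def barycenter (S : Finset (E d)) : E d := ∑ s ∈ S, (S.card : ℝ)⁻¹ • s

theorem IsAff.apply_barycenter {f : E d → ℝ} (hf : IsAff f) (hS : S.Nonempty) :
    f (barycenter S) = ∑ s ∈ S, (S.card : ℝ)⁻¹ * f s :=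
  hf.map_sum S (fun _ => (S.card : ℝ)⁻¹) id (by
    have : (S.card : ℝ) ≠ 0 := by exact_mod_cast hS.card_ne_zero
    simp [this])

theorem barycenter_mem_simplex (hS : S.Nonempty) : barycenter S ∈ simplex S := by
  have : (S.card : ℝ) ≠ 0 := by exact_mod_cast hS.card_ne_zero
  exact (convex_convexHull ℝ _).sum_mem (fun _ _ => by positivity) (by simp [this])
    fun s hs => subset_convexHull ℝ _ hs

theorem IsAff.eq_zero_on_simplex {f : E d → ℝ} (hf : IsAff f) (h : ∀ s ∈ S, f s = 0) {x : E d}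
    (hx : x ∈ simplex S) : f x = 0 := by
  rw [simplex, Finset.mem_convexHull'] at hx
  obtain ⟨w, -, hw1, rfl⟩ := hx
  rw [hf.map_sum S w (fun s => s) hw1]
  exact Finset.sum_eq_zero fun s hs => by rw [h s hs, mul_zero]

/-- `n` is the unit normal on the side `S` of `T` that points towards `T`. -/
def IsUnitNormal (T S : Finset (E d)) (n : E d) : Prop :=
  ‖n‖ = 1 ∧ (∀ x ∈ S, ∀ x' ∈ S, ⟪n, x - x'⟫_ℝ = 0) ∧ ∀ x ∈ S, ∀ v ∈ T, v ∉ S → 0 < ⟪n, v - x⟫_ℝ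

theorem exists_eq_insert (hST : S ⊆ T) (hS : S.card + 1 = T.card) :
    ∃ v ∈ T, v ∉ S ∧ ∀ w ∈ T, w ≠ v → w ∈ S := by
  classical
  obtain ⟨v, hv⟩ : ∃ v, T \ S = {v} := Finset.card_eq_one.1 (by
    rw [Finset.card_sdiff_of_subset hST]; omega)
  have hvm : v ∈ T \ S := by rw [hv]; simp
  refine ⟨v, (Finset.mem_sdiff.1 hvm).1, (Finset.mem_sdiff.1 hvm).2, fun w hw hwv => ?_⟩
  by_contra hwS
  have : w ∈ T \ S := Finset.mem_sdiff.2 ⟨hw, hwS⟩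
  rw [hv, Finset.mem_singleton] at this
  exact hwv this

/-- A normal exists: normalize the gradient of the barycentric coordinate of the vertex opposite to
`S`. -/
theorem IsBarycentric.isUnitNormal_unitNormal (h : IsBarycentric T l) (hST : S ⊆ T)
    (hS : S.card + 1 = T.card) (hne : S.Nonempty) : IsUnitNormal T S (unitNormal T S) := by
  have hex : ∃ n, IsUnitNormal T S n := by
    obtain ⟨v, hvT, hvS, hv⟩ := exists_eq_insert hST hS
    obtain ⟨g, hg⟩ := (h.isAff v).sub_eq_inner
    have hs : ∀ s ∈ S, l v s = 0 := fun s hs =>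
      h.apply_ne hvT (hST hs) (by rintro rfl; exact hvS hs)
    have hg0 : g ≠ 0 := by
      rintro rfl
      obtain ⟨s, hsS⟩ := hne
      have := hg v s
      rw [h.apply_self hvT, hs s hsS, inner_zero_left] at this
      norm_num at this
    have hpos : 0 < ‖g‖ := norm_pos_iff.2 hg0
    refine ⟨‖g‖⁻¹ • g, by rw [norm_smul, norm_inv, norm_norm, inv_mul_cancel₀ hpos.ne'], ?_, ?_⟩
    · intro x hx x' hx'
      rw [inner_smul_left, ← hg, hs x hx, hs x' hx']; simp
    · intro x hx w hw hwS
      have : w = v := by by_contra hwv; exact hwS (hv w hw hwv)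
      rw [inner_smul_left, ← hg, this, hs x hx, h.apply_self hvT]
      simpa using hg0
  rw [unitNormal]
  rw [dif_pos (show ∃ n : E d, ‖n‖ = 1 ∧ (∀ x ∈ S, ∀ x' ∈ S, ⟪n, x - x'⟫_ℝ = 0) ∧
      ∀ x ∈ S, ∀ v ∈ T, v ∉ S → 0 < ⟪n, v - x⟫_ℝ from hex)]
  exact Exists.choose_spec _

theorem isAff_inner_sub (n c : E d) : IsAff (fun x => ⟪n, x - c⟫_ℝ) := by
  have := (isAff_inner n).sub (isAff_const ⟪n, c⟫_ℝ)
  simpa only [inner_sub_right] using this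

theorem IsUnitNormal.inner_sub_barycenter {n : E d} (hn : IsUnitNormal T S n) (hne : S.Nonempty)
    {x : E d} (hx : x ∈ simplex S) : ⟪n, x - barycenter S⟫_ℝ = 0 := by
  obtain ⟨s, hs⟩ := hne
  have h0 : ∀ y ∈ simplex S, ⟪n, y - s⟫_ℝ = 0 := fun y hy =>
    (isAff_inner_sub n s).eq_zero_on_simplex (fun w hw => hn.2.1 w hw s hs) hy
  have h1 := h0 x hx
  have h2 := h0 _ (barycenter_mem_simplex ⟨s, hs⟩)
  rw [← sub_sub_sub_cancel_right x (barycenter S) s, inner_sub_right, h1, h2, sub_zero]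

/-- Near the barycenter of the side `S`, the element `T` is a half space. -/
theorem IsBarycentric.mem_simplex_iff_of_near (h : IsBarycentric T l) (hST : S ⊆ T)
    (hS : S.card + 1 = T.card) (hne : S.Nonempty) {c : E d} {r : ℝ} (hr : 0 < r)
    (hc : Metric.closedBall c r ⊆ simplex T) {n : E d} (hn : IsUnitNormal T S n) {x : E d}
    (hx : dist x (barycenter S) ≤ 2 * r / S.card) :
    x ∈ simplex T ↔ 0 ≤ ⟪n, x - barycenter S⟫_ℝ := by
  classical
  obtain ⟨v, hvT, hvS, hv⟩ := exists_eq_insert hST hS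
  have hcard : (0 : ℝ) < S.card := by exact_mod_cast hne.card_pos
  have hpos : 0 < ⟪n, v - barycenter S⟫_ℝ := by
    obtain ⟨s, hs⟩ := hne
    have e1 := hn.2.2 s hs v hvT hvS
    have e2 := hn.inner_sub_barycenter ⟨s, hs⟩ (vertex_mem_simplex hs)
    rw [← sub_add_sub_cancel v s (barycenter S), inner_add_right, e2, add_zero]
    exact e1
  have hl := h.aff_eq_of_eq_zero (isAff_inner_sub n (barycenter S)) hvT (fun w hw hwv =>
    hn.inner_sub_barycenter hne (vertex_mem_simplex (hv w hw hwv))) x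
  -- At the barycenter these coordinates equal `1 / S.card`, and with slope at most `1 / (2r)` they
  -- stay nonnegative up to distance `2r / S.card`. Only the coordinate of the opposite vertex can
  -- change sign, and it is a positive multiple of `⟪n, x - barycenter S⟫`.
  have hside : ∀ s ∈ S, 0 ≤ l s x := by
    intro s hs
    have e1 : l s (barycenter S) = (S.card : ℝ)⁻¹ := by
      rw [(h.isAff s).apply_barycenter hne, Finset.sum_eq_single s]
      · rw [h.apply_self (hST hs), mul_one]
      · intro w hw hws
        rw [h.apply_ne (hST hs) (hST hw) (Ne.symm hws), mul_zero]
      · exact fun h' => absurd hs h'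
    have e2 := h.abs_sub_le hr hc (hST hs) x (barycenter S)
    rw [e1, ← dist_eq_norm] at e2
    have e3 : dist x (barycenter S) / (2 * r) ≤ (S.card : ℝ)⁻¹ := by
      rw [div_le_iff₀ (by positivity)]
      exact hx.trans_eq (by field_simp)
    linarith [neg_abs_le (l s x - (S.card : ℝ)⁻¹)]
  rw [h.mem_iff, hl]
  constructor
  · exact fun h' => mul_nonneg (h' v hvT) hpos.le
  · intro h' w hw
    by_cases hwv : w = v
    · subst hwv; exact nonneg_of_mul_nonneg_left h' hpos
    · exact hside w (hv w hw hwv)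

/-- Both affine functions `⟪n, · - b⟫` and `⟪n', · - b⟫` vanish on `S`, hence are multiples of the
one remaining barycentric coordinate of `T`. -/
theorem IsBarycentric.isUnitNormal_eq_or (h : IsBarycentric T l) {T' : Finset (E d)} (hST : S ⊆ T)
    (hS : S.card + 1 = T.card) (hne : S.Nonempty) {n n' : E d} (hn : IsUnitNormal T S n)
    (hn' : IsUnitNormal T' S n') : n' = n ∨ n' = -n := by
  obtain ⟨v, hvT, hvS, hv⟩ := exists_eq_insert hST hS
  set b := barycenter S
  have hpos : 0 < ⟪n, v - b⟫_ℝ := by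
    obtain ⟨s, hs⟩ := hne
    have e1 := hn.2.2 s hs v hvT hvS
    have e2 := hn.inner_sub_barycenter ⟨s, hs⟩ (vertex_mem_simplex hs)
    rw [← sub_add_sub_cancel v s b, inner_add_right, e2, add_zero]
    exact e1
  have h1 := h.aff_eq_of_eq_zero (isAff_inner_sub n b) hvT (fun w hw hwv =>
    hn.inner_sub_barycenter hne (vertex_mem_simplex (hv w hw hwv)))
  have h2 := h.aff_eq_of_eq_zero (isAff_inner_sub n' b) hvT (fun w hw hwv =>
    hn'.inner_sub_barycenter hne (vertex_mem_simplex (hv w hw hwv)))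
  set t := ⟪n', v - b⟫_ℝ / ⟪n, v - b⟫_ℝ with ht
  have h3 : n' = t • n := by
    refine ext_inner_right ℝ fun w => ?_
    have a1 := h1 (b + w)
    have a2 := h2 (b + w)
    simp only [add_sub_cancel_left] at a1 a2
    rw [inner_smul_left, conj_trivial, a1, a2, ht]
    field_simp
  have h4 : |t| = 1 := by
    have := hn'.1
    rwa [h3, norm_smul, hn.1, mul_one, Real.norm_eq_abs] at this
  rcases eq_or_eq_neg_of_abs_eq h4 with h5 | h5
  · left; rw [h3, h5, one_smul]
  · right; rw [h3, h5, neg_smul, one_smul]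

end Barycentric

/-! ### Geometry of the mesh -/

section Mesh

variable {d : ℕ} {Ω : Set (E d)} {𝒯 : Finset (Finset (E d))} {T T' S : Finset (E d)}

/-- A Lipschitz boundary admits no slits. Moving from a boundary point against the vertical
direction keeps the graph height and lowers the point, so arbitrarily near there are points strictly
below the graph, with neighbourhoods that miss `Ω`. -/
theorem IsLipschitzDomain.interior_closure (h : IsLipschitzDomain Ω) :
    interior (closure Ω) = Ω := by
  refine Set.Subset.antisymm (fun x₀ hx₀ => ?_) (h.isOpen.subset_interior_iff.2 subset_closure)
  by_contra hxΩ
  have hfr : x₀ ∈ frontier Ω := by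
    rw [h.isOpen.frontier_eq]; exact ⟨interior_subset hx₀, hxΩ⟩
  obtain ⟨e, he, K, γ, hγ, U, hU, hUiff⟩ := h.lipschitz x₀ hfr
  have hγc : Continuous (fun x : E d => γ (x - ⟪e, x⟫_ℝ • e) - ⟪e, x⟫_ℝ) :=
    (hγ.continuous.comp (by fun_prop)).sub (by fun_prop)
  have hval : 0 ≤ γ (x₀ - ⟪e, x₀⟫_ℝ • e) - ⟪e, x₀⟫_ℝ := by
    have := (hUiff x₀ (mem_of_mem_nhds hU)).not.1 hxΩ
    linarith
  have hN : interior U ∩ interior (closure Ω) ∈ 𝓝 x₀ :=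
    inter_mem (interior_mem_nhds.2 hU) (isOpen_interior.mem_nhds hx₀)
  have htend : Tendsto (fun s : ℝ => x₀ - s • e) (𝓝[>] 0) (𝓝 x₀) := by
    have : Continuous (fun s : ℝ => x₀ - s • e) := by fun_prop
    have := this.tendsto 0
    simp only [zero_smul, sub_zero] at this
    exact this.mono_left nhdsWithin_le_nhds
  obtain ⟨s, hsN, hs0⟩ := ((htend.eventually hN).and self_mem_nhdsWithin).exists
  have hs0' : (0 : ℝ) < s := hs0
  set x₁ := x₀ - s • e
  have hin : ⟪e, x₁⟫_ℝ = ⟪e, x₀⟫_ℝ - s := by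
    rw [inner_sub_right, inner_smul_right, real_inner_self_eq_norm_sq, he]; ring
  have hproj : x₁ - ⟪e, x₁⟫_ℝ • e = x₀ - ⟪e, x₀⟫_ℝ • e := by
    rw [hin, sub_smul]; simp only [x₁]; abel
  have hpos : 0 < γ (x₁ - ⟪e, x₁⟫_ℝ • e) - ⟪e, x₁⟫_ℝ := by rw [hproj, hin]; linarith
  have hV : IsOpen (interior U ∩ {x | 0 < γ (x - ⟪e, x⟫_ℝ • e) - ⟪e, x⟫_ℝ}) :=
    isOpen_interior.inter (isOpen_lt continuous_const hγc)
  obtain ⟨w, ⟨hwU, hw⟩, hwΩ⟩ := mem_closure_iff.1 (interior_subset hsN.2) _ hV ⟨hsN.1, hpos⟩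
  have := (hUiff w (interior_subset hwU)).1 hwΩ
  simp only [Set.mem_ofPred_eq] at hw
  linarith

theorem IsConformingMesh.simplex_subset (h : IsConformingMesh Ω 𝒯) (hT : T ∈ 𝒯) :
    simplex T ⊆ closure Ω := by
  rw [← h.iUnion_eq]
  exact Set.subset_biUnion_of_mem (u := fun T => simplex T) hT

/-- Places in `Ω` the open balls used for testing, which are only known to be covered by elements;
in particular those centered on a side. -/
theorem IsLipschitzDomain.subset_of_subset_closure (h : IsLipschitzDomain Ω) {U : Set (E d)}
    (hU : IsOpen U) (hs : U ⊆ closure Ω) : U ⊆ Ω := by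
  rw [← h.interior_closure]
  exact hU.subset_interior_iff.2 hs

open Classical in
theorem IsConformingMesh.inter_eq_of_side (h : IsConformingMesh Ω 𝒯) (hT : T ∈ 𝒯) (hT' : T' ∈ 𝒯)
    (hne : T' ≠ T) (hS : S ⊆ T) (hS' : S ⊆ T') (hcard : S.card = d) : T ∩ T' = S := by
  refine (Finset.eq_of_subset_of_card_le (Finset.subset_inter hS hS') ?_).symm
  by_contra hlt
  have h1 := h.card_eq T hT
  have h2 := h.card_eq T' hT'
  have e1 : T ∩ T' = T := Finset.eq_of_subset_of_card_le Finset.inter_subset_left (by omega)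
  have e2 : T ∩ T' = T' := Finset.eq_of_subset_of_card_le Finset.inter_subset_right (by omega)
  exact hne (e2.symm.trans e1)

/-- The unit normals of the two elements at a common side are opposite. -/
theorem IsConformingMesh.isUnitNormal_neg (h : IsConformingMesh Ω 𝒯) (hT : T ∈ 𝒯) (hT' : T' ∈ 𝒯)
    (hTT' : T' ≠ T) (hS : S ⊆ T) (hS' : S ⊆ T') (hcard : S.card = d) (hne : S.Nonempty)
    {c c' : E d} {r r' : ℝ} (hr : 0 < r) (hr' : 0 < r') (hc : Metric.closedBall c r ⊆ simplex T)
    (hc' : Metric.closedBall c' r' ⊆ simplex T') {n n' : E d} (hn : IsUnitNormal T S n)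
    (hn' : IsUnitNormal T' S n') : n' = -n := by
  classical
  obtain ⟨l, hl⟩ := exists_isBarycentric (h.card_eq T hT) (h.affineIndependent T hT)
  obtain ⟨l', hl'⟩ := exists_isBarycentric (h.card_eq T' hT') (h.affineIndependent T' hT')
  have hk : S.card + 1 = T.card := by rw [h.card_eq T hT, hcard]
  have hk' : S.card + 1 = T'.card := by rw [h.card_eq T' hT', hcard]
  rcases hl.isUnitNormal_eq_or hS hk hne hn hn' with e | e
  swap
  · exact e
  exfalso
  subst e
  have hcp : (0 : ℝ) < S.card := by exact_mod_cast hne.card_pos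
  -- With equal normals, a point slightly above the barycenter lies in both elements, hence by
  -- conformity in the simplex `S`, where the signed distance is zero.
  set ε := min (2 * r / S.card) (2 * r' / S.card) with hε
  have hε0 : 0 < ε := lt_min (by positivity) (by positivity)
  set x := barycenter S + ε • n' with hx
  have hd : dist x (barycenter S) = ε := by
    rw [dist_eq_norm, hx, add_sub_cancel_left, norm_smul, hn.1, mul_one, Real.norm_of_nonneg hε0.le]
  have hin : ⟪n', x - barycenter S⟫_ℝ = ε := by
    rw [hx, add_sub_cancel_left, inner_smul_right, real_inner_self_eq_norm_sq, hn.1]; ring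
  have m1 : x ∈ simplex T := (hl.mem_simplex_iff_of_near hS hk hne hr hc hn
    (hd.le.trans (min_le_left _ _))).2 (by rw [hin]; exact hε0.le)
  have m2 : x ∈ simplex T' := (hl'.mem_simplex_iff_of_near hS' hk' hne hr' hc' hn'
    (hd.le.trans (min_le_right _ _))).2 (by rw [hin]; exact hε0.le)
  have m3 : x ∈ simplex T ∩ simplex T' := ⟨m1, m2⟩
  rw [h.inter_eq T hT T' hT', h.inter_eq_of_side hT hT' hTT' hS hS' hcard] at m3
  have := hn.inner_sub_barycenter hne m3
  linarith

end Mesh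

/-! ### The indicator of piecewise polynomial fields -/

section Pieces

variable {d : ℕ} {s : Set (E d)} {yT uT : E d → E d} {pT Q : E d → ℝ} {Y U : Fin d → E d → ℝ}

theorem fderiv_apply_coord {F : E d → E d} {x : E d} (hF : DifferentiableAt ℝ F x) (v : E d)
    (i : Fin d) : fderiv ℝ F x v i = dirDeriv v (fun x' => F x' i) x := by
  let π : E d →L[ℝ] ℝ := EuclideanSpace.proj i
  have h : HasFDerivAt (fun x' => F x' i) (π.comp (fderiv ℝ F x)) x :=
    (π.hasFDerivAt (x := F x)).comp x hF.hasFDerivAt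
  rw [dirDeriv, h.fderiv]
  rfl

theorem contDiff_toLp (hY : ∀ i, ContDiff ℝ ∞ (Y i)) :
    ContDiff ℝ ∞ (fun x => (WithLp.toLp 2 (fun i => Y i x) : E d)) := by
  rw [contDiff_euclidean]
  exact hY

theorem IsPolyOn.eqOn_toLp (h : IsPolyOn s yT pT uT Y Q U) :
    Set.EqOn yT (fun x => (WithLp.toLp 2 (fun i => Y i x) : E d)) s := by
  intro x hx
  ext i
  exact h.y_eq x hx i

theorem IsPolyOn.contDiff_toLp (h : IsPolyOn s yT pT uT Y Q U) :
    ContDiff ℝ ∞ (fun x => (WithLp.toLp 2 (fun i => Y i x) : E d)) :=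
  StokesOCP.contDiff_toLp fun i => (h.isQuad_y i).contDiff

theorem IsPolyOn.fderivWithin_eq (h : IsPolyOn s yT pT uT Y Q U) (hs : UniqueDiffOn ℝ s)
    {x : E d} (hx : x ∈ s) : fderivWithin ℝ yT s x =
      fderiv ℝ (fun x => (WithLp.toLp 2 (fun i => Y i x) : E d)) x := by
  rw [fderivWithin_congr h.eqOn_toLp (h.eqOn_toLp hx)]
  exact fderivWithin_eq_fderiv (hs x hx) (h.contDiff_toLp.differentiable (by simp) x)

theorem IsPolyOn.fderivWithin_apply (h : IsPolyOn s yT pT uT Y Q U) (hs : UniqueDiffOn ℝ s)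
    {x : E d} (hx : x ∈ s) (v : E d) (i : Fin d) :
    fderivWithin ℝ yT s x v i = dirDeriv v (Y i) x := by
  rw [h.fderivWithin_eq hs hx, fderiv_apply_coord (h.contDiff_toLp.differentiable (by simp) x)]

theorem IsPolyOn.laplacianWithin_apply (h : IsPolyOn s yT pT uT Y Q U) (hs : UniqueDiffOn ℝ s)
    {x : E d} (hx : x ∈ s) (i : Fin d) :
    InnerProductSpace.laplacianWithin yT s x i = coordLaplacian (Y i) x := by
  set F := fun x => (WithLp.toLp 2 (fun i => Y i x) : E d) with hF
  have hFd : ContDiff ℝ ∞ F := h.contDiff_toLp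
  have hdF : ContDiff ℝ ∞ (fderiv ℝ F) := hFd.fderiv_right (by simp)
  rw [InnerProductSpace.laplacianWithin_eq_iteratedFDerivWithin_orthonormalBasis yT hs hx
    (EuclideanSpace.basisFun (Fin d) ℝ), coordLaplacian]
  rw [WithLp.ofLp_sum, Finset.sum_apply]
  refine Finset.sum_congr rfl fun k _ => ?_
  rw [iteratedFDerivWithin_two_apply _ hs hx]
  have e : Set.EqOn (fderivWithin ℝ yT s) (fderiv ℝ F) s := fun z hz => h.fderivWithin_eq hs hz
  rw [fderivWithin_congr e (e hx),
    fderivWithin_eq_fderiv (hs x hx) (hdF.differentiable (by simp) x)]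
  have e2 : (fderiv ℝ (fderiv ℝ F) x (stdVec k)) (stdVec k) =
      fderiv ℝ (fun z => fderiv ℝ F z (stdVec k)) x (stdVec k) := by
    rw [fderiv_clm_apply (hdF.differentiable (by simp) x) (by fun_prop)]
    simp
  have e3 : (fun z => fderiv ℝ F z (stdVec k) i) = dirDeriv (stdVec k) (Y i) := by
    funext z
    rw [fderiv_apply_coord (hFd.differentiable (by simp) z)]
  have hk : EuclideanSpace.basisFun (Fin d) ℝ k = stdVec k := by
    simp [stdVec]
  simp only [hk, Matrix.cons_val_zero, Matrix.cons_val_one]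
  rw [e2, fderiv_apply_coord ((hdF.clm_apply contDiff_const).differentiable (by simp) x), e3]

theorem IsPolyOn.gradientWithin_apply (h : IsPolyOn s yT pT uT Y Q U) (hs : UniqueDiffOn ℝ s)
    {x : E d} (hx : x ∈ s) (i : Fin d) :
    gradientWithin pT s x i = dirDeriv (stdVec i) Q x := by
  rw [← inner_stdVec, gradientWithin, InnerProductSpace.toDual_symm_apply,
    fderivWithin_congr (h.p_eq) (h.p_eq x hx),
    fderivWithin_eq_fderiv (hs x hx) (h.isAff_p.contDiff.differentiable one_ne_zero x)]
  rfl

variable {T : Finset (E d)}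

theorem IsPolyOn.elementResidual_apply (h : IsPolyOn (simplex T) yT pT uT Y Q U)
    (hs : UniqueDiffOn ℝ (simplex T)) {x : E d} (hx : x ∈ simplex T) (i : Fin d) :
    elementResidual T yT pT uT x i = polyResidual Y Q U i x := by
  rw [elementResidual, PiLp.sub_apply, PiLp.add_apply, h.laplacianWithin_apply hs hx,
    h.gradientWithin_apply hs hx, h.u_eq x hx, polyResidual]

theorem IsPolyOn.elementDiv_eq (h : IsPolyOn (simplex T) yT pT uT Y Q U)
    (hs : UniqueDiffOn ℝ (simplex T)) {x : E d} (hx : x ∈ simplex T) :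
    elementDiv T yT x = polyDiv Y x :=
  Finset.sum_congr rfl fun i _ => h.fderivWithin_apply hs hx _ i

theorem uniqueDiffOn_simplex {c : E d} {r : ℝ} (hr : 0 < r)
    (hc : Metric.closedBall c r ⊆ simplex T) : UniqueDiffOn ℝ (simplex T) :=
  uniqueDiffOn_convex (convex_convexHull ℝ _)
    ⟨c, mem_interior_iff_mem_nhds.2 (mem_of_superset (Metric.closedBall_mem_nhds c hr) hc)⟩

theorem IsDiscreteSolution.exists_isPolyOn {Ω : Set (E d)} {P : TrackingData d Ω}
    {𝒯 : Finset (Finset (E d))} {zT : E d → E d} {rT : E d → ℝ}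
    (h : IsDiscreteSolution P 𝒯 yT pT zT rT uT) (hT : T ∈ 𝒯) :
    ∃ Y Q U, IsPolyOn (simplex T) yT pT uT Y Q U := by
  choose PY hPY hY using h.y_mem.1.2 T hT
  choose PU hPU hU using h.u_mem.2 T hT
  obtain ⟨PQ, hPQ, hQ⟩ := h.p_mem.2 T hT
  exact ⟨fun i x => MvPolynomial.eval (fun j => x j) (PY i),
    fun x => MvPolynomial.eval (fun j => x j) PQ,
    fun i x => MvPolynomial.eval (fun j => x j) (PU i),
    fun i => isQuad_eval (hPY i), isAff_eval hPQ, fun i => isQuad_eval (hPU i),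
    fun x hx i => hY i x hx, hQ, fun x hx i => hU i x hx⟩

end Pieces

/-! ### Measures of elements and sides -/

section Measures

theorem norm_sq_le_of_coord {d : ℕ} {x : E d} {M : ℝ} (h : ∀ i, x i ^ 2 ≤ M) :
    ‖x‖ ^ 2 ≤ d * M := by
  rw [EuclideanSpace.real_norm_sq_eq]
  calc ∑ i, x i ^ 2 ≤ ∑ _i : Fin d, M := Finset.sum_le_sum fun i _ => h i
    _ = d * M := by simp

/-- The squared `L²` norm of a field bounded by `M`. -/
theorem eLpNorm_two_sq_le {α F : Type*} [MeasurableSpace α] [NormedAddCommGroup F] {μ : Measure α}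
    {f : α → F} {M V : ℝ} (hf : ∀ᵐ x ∂μ, ‖f x‖ ^ 2 ≤ M) (hM : 0 ≤ M)
    (hV : μ Set.univ ≤ ENNReal.ofReal V) : eLpNorm f 2 μ ^ 2 ≤ ENNReal.ofReal (V * M) := by
  rcases le_or_gt V 0 with hV0 | hV0
  · have : μ = 0 := by
      rw [← Measure.measure_univ_eq_zero]
      simpa [ENNReal.ofReal_of_nonpos hV0] using hV
    simp [this]
  have h := eLpNorm_le_of_ae_bound (p := 2) (C := Real.sqrt M) (f := f) (μ := μ)
    (hf.mono fun x hx => Real.le_sqrt_of_sq_le hx)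
  calc eLpNorm f 2 μ ^ 2 ≤ (μ Set.univ ^ (2 : ℝ≥0∞).toReal⁻¹ * ENNReal.ofReal (Real.sqrt M)) ^ 2 := by
        gcongr
    _ = μ Set.univ * ENNReal.ofReal M := by
        rw [mul_pow, ← ENNReal.rpow_natCast, ← ENNReal.rpow_mul,
          ← ENNReal.ofReal_pow (Real.sqrt_nonneg _), Real.sq_sqrt hM]
        simp
    _ ≤ ENNReal.ofReal V * ENNReal.ofReal M := by gcongr
    _ = ENNReal.ofReal (V * M) := (ENNReal.ofReal_mul hV0.le).symm

theorem volume_simplex_le {d : ℕ} {T : Finset (E d)} (hT : T.Nonempty) :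
    volume (simplex T) ≤
      ENNReal.ofReal (size T ^ d * volume.real (Metric.closedBall (0 : E d) 1)) := by
  obtain ⟨v, hv⟩ := hT
  have hsub : simplex T ⊆ Metric.closedBall v (size T) := fun x hx =>
    dist_le_size hx (vertex_mem_simplex hv)
  refine (measure_mono hsub).trans ?_
  have h0 : 0 ≤ size T := Metric.diam_nonneg
  rw [Measure.addHaar_closedBall' _ _ h0, ENNReal.ofReal_mul (by positivity), measureReal_def,
    ENNReal.ofReal_toReal measure_closedBall_lt_top.ne]
  simp

/-- The surface measure of a set of diameter at most `h` in a hyperplane. -/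
theorem surface_measure_le {m : ℕ} {s : Set (E (m + 1))} {n c : E (m + 1)} (hn : n ≠ 0) {h : ℝ}
    (h0 : 0 ≤ h) (hs : ∀ x ∈ s, dist x c ≤ h ∧ ⟪n, x - c⟫_ℝ = 0) :
    μHE[m] s ≤ ENNReal.ofReal (h ^ m * volume.real (Metric.closedBall (0 : E m) 1)) := by
  have : Fact (Module.finrank ℝ (E (m + 1)) = m + 1) := ⟨by simp⟩
  -- The hyperplane is an isometric image of `ℝᵐ`, where the normalized Hausdorff measure is
  -- Lebesgue measure.
  let b := OrthonormalBasis.fromOrthogonalSpanSingleton (𝕜 := ℝ) (E := E (m + 1)) m hn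
  let f : E m → E (m + 1) := fun w => c + (b.repr.symm w : E (m + 1))
  have hf : Isometry f := by
    refine Isometry.of_dist_eq fun x y => ?_
    simp only [f, dist_add_left]
    rw [← Subtype.dist_eq, b.repr.symm.dist_map]
  have hsub : s ⊆ f '' Metric.closedBall 0 h := by
    intro x hx
    obtain ⟨h1, h2⟩ := hs x hx
    have hmem : x - c ∈ (Submodule.span ℝ {n})ᗮ := Submodule.mem_orthogonal_singleton_iff_inner_right.2 h2
    refine ⟨b.repr ⟨x - c, hmem⟩, ?_, ?_⟩
    · rw [mem_closedBall_zero_iff, b.repr.norm_map]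
      change ‖x - c‖ ≤ h
      rwa [← dist_eq_norm]
    · simp [f]
  refine (measure_mono hsub).trans ?_
  rw [hf.euclideanHausdorffMeasure_image, EuclideanSpace.euclideanHausdorffMeasure_eq_volume,
    Measure.addHaar_closedBall' _ _ h0, ENNReal.ofReal_mul (by positivity), measureReal_def,
    ENNReal.ofReal_toReal measure_closedBall_lt_top.ne]
  simp

end Measures

/-! ### Errors on a patch -/

section Errors

variable {d : ℕ} {Ω : Set (E d)} {P : TrackingData d Ω} {𝒯 : Finset (Finset (E d))}
  {y z u yT zT uT : E d → E d} {p q pT qT : E d → ℝ}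

theorem memLp_coord {μ : Measure (E d)} {v : E d → E d} (hv : MemLp v 2 μ) (i : Fin d) :
    MemLp (fun x => v x i) 2 μ :=
  hv.continuousLinearMap_comp (EuclideanSpace.proj i : E d →L[ℝ] ℝ)

theorem MemH10Vec.memLp (h : MemH10Vec (fun _ => 1) Ω y) (i : Fin d) :
    MemLp (fun x => y x i) 2 (volume.restrict Ω) := by
  have := (h i).1.1
  rwa [weightedMeasure_one] at this

theorem IsOptimalitySystemSolution.fieldsMemLp (h : IsOptimalitySystemSolution P y p z q u) :
    FieldsMemLp Ω y p u :=
  ⟨h.y_mem.memLp, h.p_mem, memLp_coord h.u_mem.1⟩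

theorem IsDiscreteSolution.fieldsMemLp (hΩ : Bornology.IsBounded Ω)
    (h : IsDiscreteSolution P 𝒯 yT pT zT qT uT) : FieldsMemLp Ω yT pT uT := by
  refine ⟨h.y_mem.2.memLp, ?_, memLp_coord h.u_admissible.1⟩
  have hc : IsCompact (closure Ω) := hΩ.isCompact_closure
  obtain ⟨M, hM⟩ := hc.exists_bound_of_continuousOn h.p_mem.1
  have : IsFiniteMeasure (volume.restrict (closure Ω)) := ⟨by simpa using hc.measure_lt_top⟩
  refine MemLp.mono_measure (Measure.restrict_mono subset_closure le_rfl)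
    (MemLp.of_bound (h.p_mem.1.aestronglyMeasurable isClosed_closure.measurableSet) M ?_)
  filter_upwards [ae_restrict_mem isClosed_closure.measurableSet] with x hx using hM x hx

theorem integral_sq_eq_eLpNorm {μ : Measure (E d)} {f : E d → ℝ} (hf : MemLp f 2 μ) :
    ∫ x, f x ^ 2 ∂μ = (eLpNorm f 2 μ).toReal ^ 2 := by
  rw [← norm_sq_toLp hf, Lp.norm_toLp]

theorem abs_coord_le_norm (x : E d) (i : Fin d) : |x i| ≤ ‖x‖ := by
  simpa using PiLp.norm_apply_le x i

/-- Finiteness of the three norms makes their real values faithful; the bounds then pass to the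
smaller set and to components. -/
theorem errorBound_of_subset {s N : Set (E d)} (hs : s ⊆ N) (hf : FieldsMemLp s y p u)
    (hfT : FieldsMemLp s yT pT uT)
    (hy : eLpNorm (fun x => y x - yT x) ∞ (volume.restrict N) ≠ ⊤)
    (hp : eLpNorm (fun x => p x - pT x) 2 (volume.restrict N) ≠ ⊤)
    (hu : eLpNorm (fun x => u x - uT x) 2 (volume.restrict N) ≠ ⊤) :
    ErrorBound s y yT p pT u uT
      (eLpNorm (fun x => y x - yT x) ∞ (volume.restrict N)).toReal
      (eLpNorm (fun x => p x - pT x) 2 (volume.restrict N)).toReal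
      (eLpNorm (fun x => u x - uT x) 2 (volume.restrict N)).toReal := by
  have hμ : volume.restrict s ≤ volume.restrict N := Measure.restrict_mono hs le_rfl
  refine ⟨ENNReal.toReal_nonneg, fun i => ?_, ?_, fun i => ?_⟩
  · have h1 := ae_le_eLpNormEssSup (f := fun x => y x - yT x) (μ := volume.restrict N)
    rw [eLpNorm_exponent_top] at hy ⊢
    filter_upwards [ae_mono hμ h1] with x hx
    have h2 := ENNReal.toReal_mono hy hx
    rw [toReal_enorm] at h2
    refine le_trans ?_ h2
    rw [abs_sub_comm]
    exact abs_coord_le_norm (y x - yT x) i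
  · have e : ∀ x, (pT x - p x) ^ 2 = (p x - pT x) ^ 2 := fun x => by ring
    simp only [e]
    rw [integral_sq_eq_eLpNorm (f := fun x => p x - pT x) (hf.p.sub hfT.p)]
    have := ENNReal.toReal_mono hp (eLpNorm_mono_measure (p := 2) (fun x => p x - pT x) hμ)
    gcongr
  · have e : ∀ x, (uT x i - u x i) ^ 2 = (u x i - uT x i) ^ 2 := fun x => by ring
    simp only [e]
    rw [integral_sq_eq_eLpNorm (f := fun x => u x i - uT x i) ((hf.u i).sub (hfT.u i))]
    have h1 : eLpNorm (fun x => u x i - uT x i) 2 (volume.restrict s) ≤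
        eLpNorm (fun x => u x - uT x) 2 (volume.restrict s) :=
      eLpNorm_mono fun x => by
        rw [Real.norm_eq_abs]; exact abs_coord_le_norm (u x - uT x) i
    have := ENNReal.toReal_mono hu (h1.trans (eLpNorm_mono_measure (p := 2) _ hμ))
    gcongr

theorem errorSize_mono {r r' EY EP EU : ℝ} (hr : 0 ≤ r) (h : r ≤ r') :
    errorSize d r EY EP EU ≤ errorSize d r' EY EP EU := by
  unfold errorSize; gcongr

end Errors

/-! ### Sides of the mesh -/

section Sides

variable {d : ℕ} {Ω : Set (E d)} {𝒯 : Finset (Finset (E d))} {T T' S : Finset (E d)}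

theorem measurableSet_simplex (T : Finset (E d)) : MeasurableSet (simplex T) :=
  (isCompact_simplex T).measurableSet

theorem surface_simplex_le (hd : 1 ≤ d) (hST : S ⊆ T) {n : E d} (hn : IsUnitNormal T S n)
    (hne : S.Nonempty) : μHE[d - 1] (simplex S) ≤ ENNReal.ofReal
      (size T ^ (d - 1) * volume.real (Metric.closedBall (0 : E (d - 1)) 1)) := by
  obtain ⟨m, rfl⟩ : ∃ m, d = m + 1 := ⟨d - 1, by omega⟩
  have hn0 : n ≠ 0 := by
    rintro rfl
    simpa using hn.1
  exact surface_measure_le hn0 Metric.diam_nonneg fun x hx =>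
    ⟨dist_le_size (simplex_mono hST hx) (simplex_mono hST (barycenter_mem_simplex hne)),
      hn.inner_sub_barycenter hne hx⟩

theorem mem_interiorSides : S ∈ interiorSides 𝒯 T ↔
    (S ⊆ T ∧ S.card = d) ∧ ∃ T' ∈ 𝒯, T' ≠ T ∧ S ⊆ T' := by
  simp [interiorSides, Finset.mem_powersetCard]

theorem card_interiorSides_le (hT : T.card = d + 1) : (interiorSides 𝒯 T).card ≤ d + 1 := by
  refine (Finset.card_filter_le _ _).trans ?_
  rw [Finset.card_powersetCard, hT, Nat.choose_succ_self_right]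

theorem simplex_subset_patch (hT : T ∈ 𝒯) : simplex T ⊆ patch 𝒯 T := fun x hx => by
  simp only [patch, Set.mem_iUnion]
  exact ⟨T, ⟨hT, Or.inl rfl⟩, hx⟩

theorem simplex_subset_patch_of_side (hT : T ∈ 𝒯) (hT' : T' ∈ 𝒯) (hTT' : T' ≠ T) (hS : S ⊆ T)
    (hS' : S ⊆ T') (hcard : S.card = d) : simplex T' ⊆ patch 𝒯 T := fun x hx => by
  simp only [patch, Set.mem_iUnion]
  refine ⟨T', ⟨hT', Or.inr ⟨S, ?_⟩⟩, hx⟩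
  rw [Finset.mem_inter, mem_interiorSides, mem_interiorSides]
  exact ⟨⟨⟨hS, hcard⟩, T', hT', hTT', hS'⟩, ⟨hS', hcard⟩, T, hT, hTT'.symm, hS⟩

theorem IsConformingMesh.isUnitNormal_unitNormal (h : IsConformingMesh Ω 𝒯) (hT : T ∈ 𝒯)
    (hS : S ⊆ T) (hcard : S.card = d) (hne : S.Nonempty) :
    IsUnitNormal T S (unitNormal T S) := by
  obtain ⟨l, hl⟩ := exists_isBarycentric (h.card_eq T hT) (h.affineIndependent T hT)
  exact hl.isUnitNormal_unitNormal hS (by rw [h.card_eq T hT, hcard]) hne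

theorem IsConformingMesh.unitNormal_eq_neg {σ : ℝ} (h : IsConformingMesh Ω 𝒯)
    (hσ : IsShapeRegular σ 𝒯) (hT : T ∈ 𝒯) (hT' : T' ∈ 𝒯) (hTT' : T' ≠ T) (hS : S ⊆ T)
    (hS' : S ⊆ T') (hcard : S.card = d) (hne : S.Nonempty) :
    unitNormal T' S = -unitNormal T S := by
  obtain ⟨c, r, hr, hc, -⟩ := hσ T hT
  obtain ⟨c', r', hr', hc', -⟩ := hσ T' hT'
  exact h.isUnitNormal_neg hT hT' hTT' hS hS' hcard hne hr hr' hc hc'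
    (h.isUnitNormal_unitNormal hT hS hcard hne) (h.isUnitNormal_unitNormal hT' hS' hcard hne)

open Classical in
/-- An interior side belongs to exactly two elements. -/
theorem IsConformingMesh.sidePatch_eq {σ : ℝ} (h : IsConformingMesh Ω 𝒯)
    (hσ : IsShapeRegular σ 𝒯) (hT : T ∈ 𝒯) (hT' : T' ∈ 𝒯) (hTT' : T' ≠ T) (hS : S ⊆ T)
    (hS' : S ⊆ T') (hcard : S.card = d) (hne : S.Nonempty) : sidePatch 𝒯 S = {T, T'} := by
  ext T₂
  simp only [sidePatch, Finset.mem_filter, Finset.mem_insert, Finset.mem_singleton]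
  constructor
  · rintro ⟨hT₂, hS₂⟩
    by_contra! hcon
    -- Three elements at one side would have pairwise opposite unit normals, so that `n = -n`.
    have e1 := h.unitNormal_eq_neg hσ hT hT' hTT' hS hS' hcard hne
    have e2 := h.unitNormal_eq_neg hσ hT hT₂ hcon.1 hS hS₂ hcard hne
    have e3 := h.unitNormal_eq_neg hσ hT' hT₂ hcon.2 hS' hS₂ hcard hne
    rw [e1, neg_neg] at e3
    have h1 := (h.isUnitNormal_unitNormal hT hS hcard hne).1
    have h0 : unitNormal T S = 0 := by
      have h2 : (2 : ℝ) • unitNormal T S = 0 := by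
        rw [two_smul]
        exact eq_neg_iff_add_eq_zero.1 (e3.symm.trans e2)
      simpa using h2
    rw [h0, norm_zero] at h1
    exact zero_ne_one h1
  · rintro (rfl | rfl)
    · exact ⟨hT, hS⟩
    · exact ⟨hT', hS'⟩

variable {yT uT : E d → E d} {pT Q Q' : E d → ℝ} {Y U Y' U' : Fin d → E d → ℝ}

theorem IsConformingMesh.jump_apply {σ : ℝ} (h : IsConformingMesh Ω 𝒯)
    (hσ : IsShapeRegular σ 𝒯) (hT : T ∈ 𝒯) (hT' : T' ∈ 𝒯) (hTT' : T' ≠ T) (hS : S ⊆ T)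
    (hS' : S ⊆ T') (hcard : S.card = d) (hne : S.Nonempty)
    (hp : IsPolyOn (simplex T) yT pT uT Y Q U) (hp' : IsPolyOn (simplex T') yT pT uT Y' Q' U')
    {x : E d} (hx : x ∈ simplex S) (i : Fin d) : jump 𝒯 yT S x i =
      dirDeriv (unitNormal T S) (Y i) x - dirDeriv (unitNormal T S) (Y' i) x := by
  classical
  obtain ⟨c, r, hr, hc, -⟩ := hσ T hT
  obtain ⟨c', r', hr', hc', -⟩ := hσ T' hT'
  rw [jump, h.sidePatch_eq hσ hT hT' hTT' hS hS' hcard hne, Finset.sum_pair hTT'.symm,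
    PiLp.add_apply, hp.fderivWithin_apply (uniqueDiffOn_simplex hr hc) (simplex_mono hS hx),
    hp'.fderivWithin_apply (uniqueDiffOn_simplex hr' hc') (simplex_mono hS' hx),
    h.unitNormal_eq_neg hσ hT hT' hTT' hS hS' hcard hne, sub_eq_add_neg]
  congr 1
  simp [dirDeriv]

end Sides

/-! ### Local efficiency -/

section Efficiency

/-- A continuous and a discrete solution whose errors on `N` are bounded by `EY`, `EP`, `EU`. -/
structure IsErrorSetting {d : ℕ} {Ω : Set (E d)} (σ : ℝ) (P : TrackingData d Ω)
    (𝒯 : Finset (Finset (E d))) (y : E d → E d) (p : E d → ℝ) (z : E d → E d) (q : E d → ℝ)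
    (u yT : E d → E d) (pT : E d → ℝ) (zT : E d → E d) (qT : E d → ℝ) (uT : E d → E d)
    (N : Set (E d)) (EY EP EU : ℝ) : Prop where
  domain : IsLipschitzDomain Ω
  solution : IsOptimalitySystemSolution P y p z q u
  mesh : IsConformingMesh Ω 𝒯
  regular : IsShapeRegular σ 𝒯
  discrete : IsDiscreteSolution P 𝒯 yT pT zT qT uT
  errorBound : ∀ s, s ⊆ N → s ⊆ Ω → ErrorBound s y yT p pT u uT EY EP EU

variable {d : ℕ}

theorem size_nonneg (T : Finset (E d)) : 0 ≤ size T := Metric.diam_nonneg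

theorem IsConformingMesh.two_mul_le_size {Ω : Set (E d)} {𝒯 : Finset (Finset (E d))}
    (h : IsConformingMesh Ω 𝒯) (hd : 2 ≤ d) {T T' S : Finset (E d)} (hT : T ∈ 𝒯) {c : E d} {r : ℝ}
    (hr : 0 < r) (hc : Metric.closedBall c r ⊆ simplex T) (hS : S ⊆ T) (hS' : S ⊆ T')
    (hcard : d ≤ S.card) : 2 * r ≤ size T' := by
  obtain ⟨l, hl⟩ := exists_isBarycentric (h.card_eq T hT) (h.affineIndependent T hT)
  exact hl.two_mul_le_size hr hc hS hS' (by omega)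

/-- Points outside `T` are allowed on purpose: near a side, the polynomial pieces of both elements
have to be bounded on a full ball. -/
theorem exists_residual_bound_of_element (hd : 2 ≤ d) (R : ℝ) : ∃ C : ℝ, 0 < C ∧
    ∀ {σ : ℝ} {Ω : Set (E d)} {P : TrackingData d Ω} {𝒯 : Finset (Finset (E d))}
      {y z u yT zT uT : E d → E d} {p q pT qT : E d → ℝ} {N : Set (E d)} {EY EP EU : ℝ},
    IsErrorSetting σ P 𝒯 y p z q u yT pT zT qT uT N EY EP EU →
    ∀ T ∈ 𝒯, simplex T ⊆ N → ∀ Y Q U, IsPolyOn (simplex T) yT pT uT Y Q U →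
    ∀ (c : E d) (r : ℝ), 0 < r → Metric.closedBall c r ⊆ simplex T →
    ∀ x ∈ Metric.closedBall c (R * r),
      (∀ i, r ^ (d + 2) * polyResidual Y Q U i x ^ 2 ≤ C * errorSize d r EY EP EU) ∧
      r ^ d * polyDiv Y x ^ 2 ≤ C * errorSize d r EY EP EU := by
  obtain ⟨C, hC, h⟩ := exists_polyResidual_bound hd R
  refine ⟨C, hC, ?_⟩
  intro σ Ω P 𝒯 y z u yT zT uT p q pT qT N EY EP EU hs T hT hTN Y Q U hp c r hr hc x hx
  have hb : Metric.ball c r ⊆ simplex T := Metric.ball_subset_closedBall.trans hc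
  have hΩ : Metric.ball c r ⊆ Ω := hs.domain.subset_of_subset_closure Metric.isOpen_ball
    (hb.trans (hs.mesh.simplex_subset hT))
  exact h hs.solution hs.domain.isOpen c r EY EP EU yT pT uT Y Q U hr hΩ
    (hs.solution.fieldsMemLp.mono hΩ) ((hs.discrete.fieldsMemLp hs.domain.isBounded).mono hΩ)
    (hs.errorBound _ (hb.trans hTN) hΩ) (hp.mono hb) x hx

theorem exists_element_indicator_bound (hd : 2 ≤ d) (σ : ℝ) : ∃ C : ℝ, 0 < C ∧
    ∀ {Ω : Set (E d)} {P : TrackingData d Ω} {𝒯 : Finset (Finset (E d))}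
      {y z u yT zT uT : E d → E d} {p q pT qT : E d → ℝ} {N : Set (E d)} {EY EP EU : ℝ},
    IsErrorSetting σ P 𝒯 y p z q u yT pT zT qT uT N EY EP EU →
    ∀ T ∈ 𝒯, simplex T ⊆ N →
      ENNReal.ofReal (size T ^ 2) *
          eLpNorm (elementResidual T yT pT uT) 2 (volume.restrict (simplex T)) ^ 2 ≤
        ENNReal.ofReal (C * errorSize d (size T) EY EP EU) ∧
      eLpNorm (elementDiv T yT) 2 (volume.restrict (simplex T)) ^ 2 ≤
        ENNReal.ofReal (C * errorSize d (size T) EY EP EU) := by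
  -- `h_T ≤ σ (2r)`, so `T` lies in the ball of radius `s * r` about the center of its inball.
  set s : ℝ := 2 * |σ|
  obtain ⟨C, hC, h⟩ := exists_residual_bound_of_element hd s
  set V := volume.real (Metric.closedBall (0 : E d) 1)
  have hV : 0 ≤ V := measureReal_nonneg
  have hs0 : 0 ≤ s := by positivity
  refine ⟨s ^ (d + 2) * V * d * C + s ^ d * V * C + 1, by positivity, ?_⟩
  intro Ω P 𝒯 y z u yT zT uT p q pT qT N EY EP EU hset T hT hTN
  obtain ⟨c, r, hr, hc, hsz⟩ := hset.regular T hT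
  obtain ⟨Y, Q, U, hp⟩ := hset.discrete.exists_isPolyOn hT
  have hu := uniqueDiffOn_simplex hr hc
  have hcard := hset.mesh.card_eq T hT
  have hne : T.Nonempty := Finset.card_pos.1 (by omega)
  have hrH : r ≤ size T := by
    have := hset.mesh.two_mul_le_size hd hT hr hc subset_rfl subset_rfl (by omega)
    linarith
  have hHr : size T ≤ s * r := hsz.trans (by nlinarith [le_abs_self σ])
  have hH := size_nonneg T
  have hr' : errorSize d r EY EP EU ≤ errorSize d (size T) EY EP EU := errorSize_mono hr.le hrH
  have hE : 0 ≤ errorSize d (size T) EY EP EU := errorSize_nonneg hH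
  set A := errorSize d (size T) EY EP EU
  have hb : ∀ x ∈ simplex T, (∀ i, polyResidual Y Q U i x ^ 2 ≤ C * A / r ^ (d + 2)) ∧
      polyDiv Y x ^ 2 ≤ C * A / r ^ d := by
    intro x hx
    have hxc : x ∈ Metric.closedBall c (s * r) :=
      (dist_le_size hx (hc (Metric.mem_closedBall_self hr.le))).trans hHr
    obtain ⟨h1, h2⟩ := h hset T hT hTN Y Q U hp c r hr hc x hxc
    have h3 : C * errorSize d r EY EP EU ≤ C * A := by gcongr
    exact ⟨fun i => by rw [le_div_iff₀' (by positivity)]; exact (h1 i).trans h3,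
      by rw [le_div_iff₀' (by positivity)]; exact h2.trans h3⟩
  have hvol : volume.restrict (simplex T) Set.univ ≤ ENNReal.ofReal (size T ^ d * V) := by
    rw [Measure.restrict_apply_univ]; exact volume_simplex_le hne
  have e1 : eLpNorm (elementResidual T yT pT uT) 2 (volume.restrict (simplex T)) ^ 2 ≤
      ENNReal.ofReal (size T ^ d * V * (d * (C * A / r ^ (d + 2)))) := by
    refine eLpNorm_two_sq_le ?_ (by positivity) hvol
    filter_upwards [ae_restrict_mem (measurableSet_simplex T)] with x hx
    refine norm_sq_le_of_coord fun i => ?_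
    rw [hp.elementResidual_apply hu hx]
    exact (hb x hx).1 i
  have e2 : eLpNorm (elementDiv T yT) 2 (volume.restrict (simplex T)) ^ 2 ≤
      ENNReal.ofReal (size T ^ d * V * (C * A / r ^ d)) := by
    refine eLpNorm_two_sq_le ?_ (by positivity) hvol
    filter_upwards [ae_restrict_mem (measurableSet_simplex T)] with x hx
    rw [Real.norm_eq_abs, sq_abs, hp.elementDiv_eq hu hx]
    exact (hb x hx).2
  have p0 : 0 ≤ s ^ (d + 2) * V * d * C := by positivity
  have p1 : 0 ≤ s ^ d * V * C := by positivity
  constructor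
  · calc _ ≤ ENNReal.ofReal (size T ^ 2) *
        ENNReal.ofReal (size T ^ d * V * (d * (C * A / r ^ (d + 2)))) := by gcongr
      _ = ENNReal.ofReal (size T ^ (d + 2) * (V * d * C * A) / r ^ (d + 2)) := by
        rw [← ENNReal.ofReal_mul (by positivity)]; congr 1; ring
      _ ≤ _ := by
        refine ENNReal.ofReal_le_ofReal ?_
        calc size T ^ (d + 2) * (V * d * C * A) / r ^ (d + 2)
            ≤ (s * r) ^ (d + 2) * (V * d * C * A) / r ^ (d + 2) := by gcongr
          _ = s ^ (d + 2) * V * d * C * A := by rw [mul_pow]; field_simp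
          _ ≤ _ := by gcongr; linarith
  · refine e2.trans (ENNReal.ofReal_le_ofReal ?_)
    calc size T ^ d * V * (C * A / r ^ d) ≤ (s * r) ^ d * V * (C * A / r ^ d) := by gcongr
      _ = s ^ d * V * C * A := by rw [mul_pow]; field_simp
      _ ≤ _ := by gcongr; linarith

theorem exists_side_indicator_bound (hd : 2 ≤ d) (σ : ℝ) : ∃ C : ℝ, 0 < C ∧
    ∀ {Ω : Set (E d)} {P : TrackingData d Ω} {𝒯 : Finset (Finset (E d))}
      {y z u yT zT uT : E d → E d} {p q pT qT : E d → ℝ} {T : Finset (E d)} {EY EP EU : ℝ},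
    IsErrorSetting σ P 𝒯 y p z q u yT pT zT qT uT (patch 𝒯 T) EY EP EU →
    T ∈ 𝒯 → ∀ S ∈ interiorSides 𝒯 T,
      ENNReal.ofReal (size T / 2) * eLpNorm (jump 𝒯 yT S) 2 (μHE[d - 1].restrict (simplex S)) ^ 2 ≤
        ENNReal.ofReal (C * errorSize d (size T) EY EP EU) := by
  set s : ℝ := |σ|
  have hs0 : 0 ≤ s := abs_nonneg σ
  -- The ball about the barycenter has radius `ρ ≤ r` and `h_T ≤ 2 s r`, so its points are within
  -- `(1 + 2s) r` of the inball center; likewise for the neighbour.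
  obtain ⟨C₁, hC₁, h₁⟩ := exists_residual_bound_of_element hd (1 + 2 * s)
  -- `h_T ≤ 2 s r ≤ 2 s² m = d s² ρ`, so this multiple of the ball about the barycenter covers the
  -- side.
  obtain ⟨C₂, hC₂, h₂⟩ := exists_polyJump_bound hd (d * s ^ 2)
  set V := volume.real (Metric.closedBall (0 : E (d - 1)) 1)
  have hV : 0 ≤ V := measureReal_nonneg
  refine ⟨(d * s ^ 2) ^ d * V * d * (C₂ * (1 + C₁)) + 1, by positivity, ?_⟩
  intro Ω P 𝒯 y z u yT zT uT p q pT qT T EY EP EU hset hT S hS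
  obtain ⟨⟨hST, hcard⟩, T', hT', hTT', hST'⟩ := mem_interiorSides.1 hS
  have hd0 : (2 : ℝ) ≤ d := by exact_mod_cast hd
  have hne : S.Nonempty := Finset.card_pos.1 (by omega)
  obtain ⟨c, r, hr, hc, hsz⟩ := hset.regular T hT
  obtain ⟨c', r', hr', hc', hsz'⟩ := hset.regular T' hT'
  obtain ⟨Y, Q, U, hp⟩ := hset.discrete.exists_isPolyOn hT
  obtain ⟨Y', Q', U', hp'⟩ := hset.discrete.exists_isPolyOn hT'
  have hn := hset.mesh.isUnitNormal_unitNormal hT hST hcard hne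
  have hn' := hset.mesh.isUnitNormal_unitNormal hT' hST' hcard hne
  have hnn := hset.mesh.unitNormal_eq_neg hset.regular hT hT' hTT' hST hST' hcard hne
  have hjump := fun x hx i => hset.mesh.jump_apply hset.regular hT hT' hTT' hST hST' hcard hne
    hp hp' (x := x) hx i
  obtain ⟨l, hl⟩ := exists_isBarycentric (hset.mesh.card_eq T hT) (hset.mesh.affineIndependent T hT)
  obtain ⟨l', hl'⟩ := exists_isBarycentric (hset.mesh.card_eq T' hT')
    (hset.mesh.affineIndependent T' hT')
  have hk : S.card + 1 = T.card := by rw [hset.mesh.card_eq T hT, hcard]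
  have hk' : S.card + 1 = T'.card := by rw [hset.mesh.card_eq T' hT', hcard]
  have hN := simplex_subset_patch (𝒯 := 𝒯) hT
  have hN' := simplex_subset_patch_of_side hT hT' hTT' hST hST' hcard
  rw [hnn] at hn'
  set n := unitNormal T S
  set b := barycenter S
  have hbS : b ∈ simplex S := barycenter_mem_simplex hne
  have hH := size_nonneg T
  -- comparison of the sizes
  have q1 : 2 * r ≤ size T :=
    hset.mesh.two_mul_le_size hd hT hr hc subset_rfl subset_rfl (by omega)
  have q2 : 2 * r ≤ size T' := hset.mesh.two_mul_le_size hd hT hr hc hST hST' hcard.ge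
  have q3 : 2 * r' ≤ size T := hset.mesh.two_mul_le_size hd hT' hr' hc' hST' hST hcard.ge
  have hsz1 : size T ≤ 2 * s * r := hsz.trans (by nlinarith [le_abs_self σ])
  have hsz2 : size T' ≤ 2 * s * r' := hsz'.trans (by nlinarith [le_abs_self σ])
  have hs1 : 1 ≤ s := by nlinarith
  have hrr' : r ≤ s * r' := by linarith
  have hE : 0 ≤ errorSize d (size T) EY EP EU := errorSize_nonneg hH
  set m := min r r' with hm
  have hm0 : 0 < m := lt_min hr hr'
  have hmr : m ≤ r := min_le_left _ _
  have hmr' : m ≤ r' := min_le_right _ _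
  have hrm : r ≤ s * m := by
    rcases min_choice r r' with e | e <;> rw [hm, e]
    · nlinarith
    · exact hrr'
  -- A side has `d` vertices, so this is the radius up to which both elements are half spaces; `ρ ≤
  -- m` because `2 ≤ d`.
  set ρ := 2 * m / d with hρ
  have hρ0 : 0 < ρ := by positivity
  have hρm : ρ ≤ m := by rw [hρ, div_le_iff₀ (by positivity)]; nlinarith
  have hHρ : size T ≤ d * s ^ 2 * ρ := by
    have : d * s ^ 2 * ρ = 2 * s * (s * m) := by rw [hρ]; field_simp
    rw [this]
    exact hsz1.trans (by gcongr)
  have m1 : errorSize d r EY EP EU ≤ errorSize d (size T) EY EP EU :=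
    errorSize_mono hr.le (by linarith)
  have m2 : errorSize d r' EY EP EU ≤ errorSize d (size T) EY EP EU :=
    errorSize_mono hr'.le (by linarith)
  have m3 : errorSize d ρ EY EP EU ≤ errorSize d (size T) EY EP EU :=
    errorSize_mono hρ0.le (by linarith)
  set A := errorSize d (size T) EY EP EU
  -- the two elements near the barycenter of the side
  have near : ∀ x ∈ Metric.ball b ρ, x ∈ simplex T ↔ 0 ≤ ⟪n, x - b⟫_ℝ := fun x hx =>
    hl.mem_simplex_iff_of_near hST hk hne hr hc hn ((Metric.mem_ball.1 hx).le.trans (by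
      rw [hcard, hρ]; gcongr))
  have near' : ∀ x ∈ Metric.ball b ρ, x ∈ simplex T' ↔ ⟪n, x - b⟫_ℝ ≤ 0 := fun x hx => by
    rw [hl'.mem_simplex_iff_of_near hST' hk' hne hr' hc' hn' ((Metric.mem_ball.1 hx).le.trans (by
      rw [hcard, hρ]; gcongr)), inner_neg_left, neg_nonneg]
  have hball : ∀ x ∈ Metric.ball b ρ, x ∈ simplex T ∨ x ∈ simplex T' := fun x hx => by
    rw [near x hx, near' x hx]; exact le_total _ _
  have hbN : Metric.ball b ρ ⊆ patch 𝒯 T := fun x hx =>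
    (hball x hx).elim (fun h => hN h) fun h => hN' h
  have hbΩ : Metric.ball b ρ ⊆ Ω := hset.domain.subset_of_subset_closure Metric.isOpen_ball
    fun x hx => (hball x hx).elim (fun h => hset.mesh.simplex_subset hT h)
      fun h => hset.mesh.simplex_subset hT' h
  -- bound of the residuals of both elements near the side
  set M := Real.sqrt (C₁ * A / m ^ (d + 2)) with hM
  have hres : ∀ {r₀ t : ℝ}, m ≤ r₀ → r₀ ^ (d + 2) * t ^ 2 ≤ C₁ * A → |t| ≤ M := by
    intro r₀ t hr₀ ht
    refine Real.abs_le_sqrt ?_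
    rw [le_div_iff₀' (by positivity)]
    refine le_trans ?_ ht
    gcongr
  have b1 : ∀ i, ∀ x ∈ Metric.ball b ρ, |polyResidual Y Q U i x| ≤ M := fun i x hx => by
    refine hres hmr (((h₁ hset T hT hN Y Q U hp c r hr hc x ?_).1 i).trans (by gcongr))
    have t1 := dist_triangle x b c
    have t2 : dist b c ≤ size T :=
      dist_le_size (simplex_mono hST hbS) (hc (Metric.mem_closedBall_self hr.le))
    have t3 := Metric.mem_ball.1 hx
    rw [Metric.mem_closedBall]
    linarith
  have b2 : ∀ i, ∀ x ∈ Metric.ball b ρ, |polyResidual Y' Q' U' i x| ≤ M := fun i x hx => by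
    refine hres hmr' (((h₁ hset T' hT' hN' Y' Q' U' hp' c' r' hr' hc' x ?_).1 i).trans (by gcongr))
    have t1 := dist_triangle x b c'
    have t2 : dist b c' ≤ size T' :=
      dist_le_size (simplex_mono hST' hbS) (hc' (Metric.mem_closedBall_self hr'.le))
    have t3 := Metric.mem_ball.1 hx
    rw [Metric.mem_closedBall]
    linarith
  have hMsq : ρ ^ (d + 2) * M ^ 2 ≤ C₁ * A := by
    rw [hM, Real.sq_sqrt (by positivity)]
    calc ρ ^ (d + 2) * (C₁ * A / m ^ (d + 2)) ≤ m ^ (d + 2) * (C₁ * A / m ^ (d + 2)) := by gcongr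
      _ = C₁ * A := by field_simp
  have hJ : ∀ x ∈ simplex S, ∀ i, jump 𝒯 yT S x i ^ 2 ≤ C₂ * (1 + C₁) * A / ρ ^ d := by
    intro x hx i
    rw [hjump x hx i, le_div_iff₀' (by positivity)]
    refine (h₂ hset.solution hset.domain.isOpen n b ρ EY EP EU M yT pT uT Y Q U Y' Q' U' hn.1 hρ0
      hbΩ (hset.solution.fieldsMemLp.mono hbΩ)
      ((hset.discrete.fieldsMemLp hset.domain.isBounded).mono hbΩ) (hset.errorBound _ hbN hbΩ)
      (hp.mono fun x hx => (near x hx.1).2 hx.2) (hp'.mono fun x hx => (near' x hx.1).2 hx.2)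
      (Real.sqrt_nonneg _) b1 b2 i x ?_ (hn.inner_sub_barycenter hne hx)).trans ?_
    · exact (dist_le_size (simplex_mono hST hx) (simplex_mono hST hbS)).trans hHρ
    · rw [mul_assoc]
      gcongr
      linarith
  have e1 : eLpNorm (jump 𝒯 yT S) 2 (μHE[d - 1].restrict (simplex S)) ^ 2 ≤
      ENNReal.ofReal (size T ^ (d - 1) * V * (d * (C₂ * (1 + C₁) * A / ρ ^ d))) := by
    refine eLpNorm_two_sq_le ?_ (by positivity) ?_
    · filter_upwards [ae_restrict_mem (measurableSet_simplex S)] with x hx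
      exact norm_sq_le_of_coord (hJ x hx)
    · rw [Measure.restrict_apply_univ]
      exact surface_simplex_le (by omega) hST hn hne
  calc _ ≤ ENNReal.ofReal (size T / 2) *
        ENNReal.ofReal (size T ^ (d - 1) * V * (d * (C₂ * (1 + C₁) * A / ρ ^ d))) := by gcongr
    _ ≤ _ := by
      rw [← ENNReal.ofReal_mul (by positivity)]
      refine ENNReal.ofReal_le_ofReal ?_
      have hpow : size T * size T ^ (d - 1) = size T ^ d := by
        rw [← pow_succ', Nat.sub_add_cancel (by omega)]
      calc size T / 2 * (size T ^ (d - 1) * V * (d * (C₂ * (1 + C₁) * A / ρ ^ d)))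
          = size T * size T ^ (d - 1) * (V * d * (C₂ * (1 + C₁)) * A) / ρ ^ d / 2 := by ring
        _ ≤ size T * size T ^ (d - 1) * (V * d * (C₂ * (1 + C₁)) * A) / ρ ^ d :=
          half_le_self (by positivity)
        _ ≤ (d * s ^ 2 * ρ) ^ d * (V * d * (C₂ * (1 + C₁)) * A) / ρ ^ d := by
          rw [hpow]; gcongr
        _ = (d * s ^ 2) ^ d * V * d * (C₂ * (1 + C₁)) * A := by rw [mul_pow _ ρ]; field_simp
        _ ≤ _ := by gcongr; linarith

theorem exists_indicatorSt_bound (hd : 2 ≤ d) (σ : ℝ) : ∃ C : ℝ, 0 < C ∧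
    ∀ {Ω : Set (E d)} {P : TrackingData d Ω} {𝒯 : Finset (Finset (E d))}
      {y z u yT zT uT : E d → E d} {p q pT qT : E d → ℝ} {T : Finset (E d)} {EY EP EU : ℝ},
    IsErrorSetting σ P 𝒯 y p z q u yT pT zT qT uT (patch 𝒯 T) EY EP EU →
    T ∈ 𝒯 → indicatorSt 𝒯 T yT pT uT ^ 2 ≤
      ENNReal.ofReal (C * errorSize d (size T) EY EP EU) := by
  obtain ⟨C₁, hC₁, h₁⟩ := exists_element_indicator_bound hd σ
  obtain ⟨C₂, hC₂, h₂⟩ := exists_side_indicator_bound hd σ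
  -- Two element terms and at most `d + 1` sides.
  refine ⟨2 * C₁ + (d + 1) * C₂, by positivity, ?_⟩
  intro Ω P 𝒯 y z u yT zT uT p q pT qT T EY EP EU hset hT
  have hE : 0 ≤ errorSize d (size T) EY EP EU := errorSize_nonneg (size_nonneg T)
  set A := errorSize d (size T) EY EP EU
  obtain ⟨e1, e2⟩ := h₁ hset T hT (simplex_subset_patch hT)
  have e3 : ENNReal.ofReal (size T / 2) * ∑ S ∈ interiorSides 𝒯 T,
      eLpNorm (jump 𝒯 yT S) 2 (μHE[d - 1].restrict (simplex S)) ^ 2 ≤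
      ENNReal.ofReal ((d + 1) * C₂ * A) := by
    rw [Finset.mul_sum]
    calc _ ≤ ∑ _S ∈ interiorSides 𝒯 T, ENNReal.ofReal (C₂ * A) :=
          Finset.sum_le_sum fun S hS => h₂ hset hT S hS
      _ = ((interiorSides 𝒯 T).card : ℝ≥0∞) * ENNReal.ofReal (C₂ * A) := by simp
      _ ≤ ((d + 1 : ℕ) : ℝ≥0∞) * ENNReal.ofReal (C₂ * A) := by
        gcongr
        exact_mod_cast card_interiorSides_le (hset.mesh.card_eq T hT)
      _ = _ := by
        rw [← Nat.cast_add_one, mul_assoc,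
          ENNReal.ofReal_mul (p := ((d + 1 : ℕ) : ℝ)) (by positivity), ENNReal.ofReal_natCast]
  rw [indicatorSt, ← ENNReal.rpow_natCast, ← ENNReal.rpow_mul]
  norm_num
  calc _ ≤ ENNReal.ofReal (C₁ * A) + ENNReal.ofReal ((d + 1) * C₂ * A) + ENNReal.ofReal (C₁ * A) := by
        gcongr
    _ = _ := by
      rw [← ENNReal.ofReal_add (by positivity) (by positivity),
        ← ENNReal.ofReal_add (by positivity) (by positivity)]
      congr 1
      ring

end Efficiency

end StokesOCP

/-! ### Local efficiency of the indicator -/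

theorem mainTheorem6 (d : ℕ) (hd : d = 2 ∨ d = 3) (σ : ℝ) :
    ∃ C : ℝ≥0, ∀ (Ω : Set (StokesOCP.E d)), StokesOCP.IsLipschitzDomain Ω →
      ∀ (P : StokesOCP.TrackingData d Ω)
        (y : StokesOCP.E d → StokesOCP.E d) (p : StokesOCP.E d → ℝ)
        (z : StokesOCP.E d → StokesOCP.E d) (r : StokesOCP.E d → ℝ)
        (u : StokesOCP.E d → StokesOCP.E d),
      StokesOCP.IsOptimalitySystemSolution P y p z r u →
      ∀ (𝒯 : Finset (Finset (StokesOCP.E d))),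
      StokesOCP.IsConformingMesh Ω 𝒯 → StokesOCP.IsShapeRegular σ 𝒯 →
      ∀ (yT : StokesOCP.E d → StokesOCP.E d) (pT : StokesOCP.E d → ℝ)
        (zT : StokesOCP.E d → StokesOCP.E d) (rT : StokesOCP.E d → ℝ)
        (uT : StokesOCP.E d → StokesOCP.E d),
      StokesOCP.IsDiscreteSolution P 𝒯 yT pT zT rT uT →
      ∀ T ∈ 𝒯,
        StokesOCP.indicatorSt 𝒯 T yT pT uT ^ 2 ≤
          C * (ENNReal.ofReal (StokesOCP.size T ^ (d - 2)) *
                eLpNorm (fun x => y x - yT x) ∞ (volume.restrict (StokesOCP.patch 𝒯 T)) ^ 2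
            + eLpNorm (fun x => p x - pT x) 2 (volume.restrict (StokesOCP.patch 𝒯 T)) ^ 2
            + ENNReal.ofReal (StokesOCP.size T ^ 2) *
                eLpNorm (fun x => u x - uT x) 2
                  (volume.restrict (StokesOCP.patch 𝒯 T)) ^ 2) := by
  obtain ⟨C, hC, h⟩ := StokesOCP.exists_indicatorSt_bound (d := d) (by omega) σ
  refine ⟨C.toNNReal, ?_⟩
  intro Ω hΩ P y p z r u hsol 𝒯 hmesh hreg yT pT zT rT uT hdisc T hT
  obtain ⟨c, δ, hδ, hc, -⟩ := hreg T hT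
  have hd2 : 2 ≤ d := by omega
  have hcard := hmesh.card_eq T hT
  have hsize : 0 < StokesOCP.size T := by
    have := hmesh.two_mul_le_size hd2 hT hδ hc subset_rfl subset_rfl (by omega)
    linarith
  set N := StokesOCP.patch 𝒯 T
  set ey := eLpNorm (fun x => y x - yT x) ∞ (volume.restrict N) with hey
  set ep := eLpNorm (fun x => p x - pT x) 2 (volume.restrict N) with hep
  set eu := eLpNorm (fun x => u x - uT x) 2 (volume.restrict N) with heu
  change _ ≤ ENNReal.ofReal C * _
  have hC0 : ENNReal.ofReal C ≠ 0 := by simpa using hC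
  have hs1 : ENNReal.ofReal (StokesOCP.size T ^ (d - 2)) ≠ 0 := by simpa using pow_pos hsize _
  have hs2 : ENNReal.ofReal (StokesOCP.size T ^ 2) ≠ 0 := by simpa using hsize.ne'
  -- If an error norm is infinite, the right-hand side is `⊤`, since all its coefficients are
  -- positive.
  by_cases hy : ey = ⊤
  · simp [hy, ENNReal.mul_top, hs1, hC0]
  by_cases hp : ep = ⊤
  · simp [hp, ENNReal.mul_top, hC0]
  by_cases hu : eu = ⊤
  · simp [hu, ENNReal.mul_top, hs2, hC0]
  have hset : StokesOCP.IsErrorSetting σ P 𝒯 y p z r u yT pT zT rT uT N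
      ey.toReal ep.toReal eu.toReal :=
    ⟨hΩ, hsol, hmesh, hreg, hdisc, fun s hsN hsΩ => StokesOCP.errorBound_of_subset hsN
      (hsol.fieldsMemLp.mono hsΩ) ((hdisc.fieldsMemLp hΩ.isBounded).mono hsΩ) hy hp hu⟩
  refine (h hset hT).trans_eq ?_
  rw [ENNReal.ofReal_mul hC.le, StokesOCP.errorSize, ENNReal.ofReal_add (by positivity)
    (by positivity), ENNReal.ofReal_add (by positivity) (by positivity),
    ENNReal.ofReal_mul (by positivity), ENNReal.ofReal_mul (by positivity),
    ENNReal.ofReal_pow ENNReal.toReal_nonneg, ENNReal.ofReal_pow ENNReal.toReal_nonneg,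
    ENNReal.ofReal_pow ENNReal.toReal_nonneg, ENNReal.ofReal_toReal hy, ENNReal.ofReal_toReal hp,
    ENNReal.ofReal_toReal hu]
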